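/- **Setting.** Fix a generalized linear model with canonical link: a $\sigma$-finite measure $\nu$ on $\mathbb R$, a dispersion $\phi>0$ and measurable functions $a\ge 0$, $d(\cdot\,;\cdot)$ and a differentiable mean function $g:\mathbb R\to\mathbb R$ such that, for every $\eta\in\mathbb R$, $f_\eta(y)=a(y)\exp\{-d(y;g(\eta))/(2\phi)\}$ is a probability density with respect to $\nu$ with mean $g(\eta)$, and $\frac{\partial}{\partial\eta}d(y;g(\eta))=g(\eta)-y$ for all $y$. Consider a sequence of experiments (the index of the sequence is suppressed). In each of them, observations $(x_i,y_i)\in\mathbb R^p\times\mathbb R$ arrive in batches $\mathcal D_1,\dots,\mathcal D_b$ of sizes $n_1,\dots,n_b$, with $N_j=n_1+\dots+n_j$. The pairs $(x_i,y_i)$ are i.i.d., and given $x_i$ the response $y_i$ has density $f_{x_i^\top\beta^0}$. Write $X^{(j)},y^{(j)}$ for the design matrix and response vector of batch $j$. Put $J^{(j)}(\beta)=\sum_{i\in\mathcal D_j}g'(x_i^\top\beta)x_ix_i^\top$, $J=\mathbb E[J^{(1)}(\beta^0)]/N_1$, $\Theta=J^{-1}$; fix a coordinate $r$, and let $\gamma_r^0$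 minimize $J_{r,r}-2J_{r,-r}\gamma+\gamma^\top J_{-r,-r}\gamma$ over $\gamma\in\mathbb R^{p-1}$. Let $s_0=\max(1,|\{k:\beta^0_k\ne0\}|)$ and $s_r=\max(1,|\{k\neq r:\Theta_{k,r}\ne0\}|)$. **Estimators.** With $\lambda_j=C\sqrt{\log p/N_j}$ and $\widetilde J^{(j)}=\sum_{i\le j}J^{(i)}(\widehat\beta^{(i)})$, let, for $j=1,\dots,b$, $$\widehat\beta^{(j)}\in\arg\min_{\beta\in\mathbb R^p}\ \frac1{2N_j}\Big\{\sum_{i\in\mathcal D_j}d(y_i;g(x_i^\top\beta))+\tfrac12(\beta-\widehat\beta^{(j-1)})^\top\widetilde J^{(j-1)}(\beta-\widehat\beta^{(j-1)})\Big\}+\lambda_j\|\beta\|_1,$$ $$\widehat\gamma_r^{(j)}\in\arg\min_{\gamma\in\mathbb R^{p-1}}\ \frac1{2N_j}\big(\widetilde J^{(j)}_{r,r}-2\widetilde J^{(j)}_{r,-r}\gamma+\gamma^\top\widetilde J^{(j)}_{-r,-r}\gamma\big)+\lambda_j\|\gamma\|_1$$ ($\widetilde J^{(0)}=0$), let $\widehat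 z_r^{(j)}=X^{(j)}_{\cdot r}-X^{(j)}_{\cdot,-r}\widehat\gamma^{(j)}_r$, $\widehat\tau^{(j)}_r=\widetilde J^{(j)}_{r,r}-\widetilde J^{(j)}_{r,-r}\widehat\gamma_r^{(j)}$, let $\widetilde\gamma_r^{(j)}\in\mathbb R^p$ be $\widehat\gamma_r^{(j)}$ with an additional $r$-th entry $-1$, and $$\widehat\beta^{(b)}_{\mathrm{on},r}=\widehat\beta^{(b)}_r+\frac1{\widehat\tau_r^{(b)}}\Big[\sum_{j=1}^b\{\widehat z_r^{(j)}\}^\top\{y^{(j)}-g(X^{(j)}\widehat\beta^{(j)})\}+\sum_{j=1}^b\{\widetilde\gamma_r^{(j)}\}^\top J^{(j)}(\widehat\beta^{(j)})\{\widehat\beta^{(b)}-\widehat\beta^{(j)}\}\Big].$$ **Regularity.** There are constants $K,M,L,K_2,K_3$ and $\delta,\kappa>0$, the same for all experiments, such that almost surely for all $i$: $\|x_i\|_\infty\le K$; $|x_i^\top\beta^0|\le M$ and $|(x_i)_{-r}^\top\gamma_r^0|\le M$; for all $\beta,\beta'$ with $\|\beta-\beta^0\|_1,\|\beta'-\beta^0\|_1\le\delta$,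 $|g'(x_i^\top\beta)-g'(x_i^\top\beta')|\le L|x_i^\top\beta-x_i^\top\beta'|$, $|g'(x_i^\top\beta)|\le K_2$, $g'(x_i^\top\beta)\neq 0$ and $|1/g'(x_i^\top\beta)|\le K_3$; and every eigenvalue of $J$ is at least $\kappa$. **Theorem 3.** There is $C_0>0$, depending only on the model and the constants above, such that for every $C\ge C_0$ there are $A\ge1$ and $c>0$, depending only on these and $C$, with the following property. Put $c_1^{(j)}=A^j$, and suppose that along the sequence $N_b\to\infty$, $p\to\infty$, $b=o(\log N_b)$, $n_1\ge c\,s_0\log p$, $N_j\ge c\,c_1^{(j)}s_0^2s_r^2\log p$ for $j=1,\dots,b$, and that for some $\epsilon>0$ $$s_0^2\log(p)\log(N_b)N_b^{-1/2+\epsilon}=o(1),\qquad s_0s_r\log(p)N_b^{-1/2+\epsilon}=o(1).$$ Then, with probability tending to one, $\|\widehat\beta^{(j)}-\beta^0\|_1\le c_1^{(j)}s_0\lambda_j$ for all $j=1,\dots,b$ and $\widehat\tau_r^{(b)}>0$; and $$\frac{\widehat\tau_r^{(b)}}{\sqrt{N_b}}\big(\widehat\beta^{(b)}_{\mathrm{on},r}-\beta^0_r\big)=W_r+V_r,\qquad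 W_r=\frac1{\sqrt{N_b}}\sum_{j=1}^b\{\widehat z_r^{(j)}\}^\top\big(y^{(j)}-g(X^{(j)}\beta^0)\big),\qquad V_r=o_p(1).$$ -/

import Mathlib

open MeasureTheory ProbabilityTheory Filter Topology Asymptotics
open scoped Matrix

noncomputable section

namespace OnlineGLM

/-- The exponential dispersion density `a(y; φ) exp (-d(y; mean) / (2 φ))`. -/
def edmDensity (a : ℝ → ℝ) (d : ℝ → ℝ → ℝ) (φ mean y : ℝ) : ℝ :=
  a y * Real.exp (-(d y mean) / (2 * φ))

/-- A generalized linear model: an exponential dispersion family of densities with respect to a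
σ-finite measure `ν` on `ℝ` (Lebesgue or counting measure, say), with mean `g η` at the linear
predictor `η`.  The link is canonical, `∂/∂η d(y; g η) = g η - y`, so that the Hessian of
`β ↦ ∑ᵢ d(yᵢ; g (xᵢᵀ β))` is the information matrix `∑ᵢ g'(xᵢᵀ β) xᵢ xᵢᵀ`. -/
structure GLM where
  ν : Measure ℝ
  sigmaFinite : SigmaFinite ν
  a : ℝ → ℝ
  d : ℝ → ℝ → ℝ
  φ : ℝ
  g : ℝ → ℝ
  φ_pos : 0 < φ
  a_nonneg : ∀ y, 0 ≤ a y
  measurable_a : Measurable a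
  measurable_d : ∀ η, Measurable fun y => d y (g η)
  differentiable_g : Differentiable ℝ g
  hasDerivAt_d : ∀ y η, HasDerivAt (fun t => d y (g t)) (g η - y) η
  lintegral_density : ∀ η, ∫⁻ y, ENNReal.ofReal (edmDensity a d φ (g η) y) ∂ν = 1
  integrable_density : ∀ η, Integrable (fun y => y * edmDensity a d φ (g η) y) ν
  mean_density : ∀ η, ∫ y, y * edmDensity a d φ (g η) y ∂ν = g η

/-- The `ℓ₁` norm of a vector. -/
def l1 {ι : Type*} [Fintype ι] (v : ι → ℝ) : ℝ := ∑ k, |v k|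

/-- `M_{r,r} - 2 M_{r,-r} γ + γᵀ M_{-r,-r} γ`, for `γ` indexed by the coordinates other
than `r`. -/
def projQuad {p : ℕ} (M : Matrix (Fin p) (Fin p) ℝ) (r : Fin p) (γ : {k // k ≠ r} → ℝ) : ℝ :=
  M r r - 2 * ∑ k, M r k.1 * γ k + ∑ k, ∑ l, γ k * M k.1 l.1 * γ l

/-- The raw data of one streaming experiment.  Observations are numbered `0, 1, 2, …` in their
order of arrival; batches are numbered from `1` to `b`, and batch `j` has `n j` observations.
Only the observations in batches `1, …, b` and the estimators at steps `1, …, b` matter. -/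
structure Stream (Ω : Type*) where
  /-- dimension -/
  p : ℕ
  /-- number of batches -/
  b : ℕ
  /-- batch sizes -/
  n : ℕ → ℕ
  /-- covariates -/
  x : ℕ → Ω → Fin p → ℝ
  /-- responses -/
  y : ℕ → Ω → ℝ
  /-- true coefficient vector -/
  β₀ : Fin p → ℝ
  /-- the coordinate of interest -/
  r : Fin p
  /-- population projection coefficient -/
  γ₀ : {k // k ≠ r} → ℝ
  /-- online lasso estimators -/
  βhat : ℕ → Ω → Fin p → ℝ
  /-- low-dimensional projections -/
  γhat : ℕ → Ω → {k // k ≠ r} → ℝ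

namespace Stream

variable {Ω : Type*} (S : Stream Ω) (G : GLM)

/-- Cumulative sample size `N_j = n_1 + ⋯ + n_j`. -/
def N (j : ℕ) : ℕ := ∑ i ∈ Finset.Icc 1 j, S.n i

/-- The observations in batch `j ≥ 1`. -/
def batch (j : ℕ) : Finset ℕ := Finset.Ico (S.N (j - 1)) (S.N j)

/-- The tuning parameter `λ_j = C √(log p / N_j)`. -/
def lam (C : ℝ) (j : ℕ) : ℝ := C * √(Real.log S.p / S.N j)

/-- Information matrix of batch `j` at `β`. -/
def J (j : ℕ) (β : Fin S.p → ℝ) (ω : Ω) : Matrix (Fin S.p) (Fin S.p) ℝ :=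
  Matrix.of fun k l => ∑ i ∈ S.batch j, deriv G.g (S.x i ω ⬝ᵥ β) * S.x i ω k * S.x i ω l

/-- Aggregated information matrix `∑_{i ≤ j} J^{(i)}(βhat^{(i)})`. -/
def Jtilde (j : ℕ) (ω : Ω) : Matrix (Fin S.p) (Fin S.p) ℝ :=
  ∑ i ∈ Finset.Icc 1 j, S.J G i (S.βhat i ω) ω

/-- The objective function of the online lasso at step `j`.  For `j = 1` the quadratic term
vanishes and this is the objective function of the ordinary lasso on the first batch. -/
def lassoObjective (C : ℝ) (j : ℕ) (ω : Ω) (β : Fin S.p → ℝ) : ℝ :=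
  1 / (2 * (S.N j : ℝ)) *
      (∑ i ∈ S.batch j, G.d (S.y i ω) (G.g (S.x i ω ⬝ᵥ β)) +
        1 / 2 * ((β - S.βhat (j - 1) ω) ⬝ᵥ
          (S.Jtilde G (j - 1) ω *ᵥ (β - S.βhat (j - 1) ω)))) +
    S.lam C j * l1 β

/-- The objective function of the low-dimensional projection at step `j`. -/
def projObjective (C : ℝ) (j : ℕ) (ω : Ω) (γ : {k // k ≠ S.r} → ℝ) : ℝ :=
  1 / (2 * (S.N j : ℝ)) * projQuad (S.Jtilde G j ω) S.r γ + S.lam C j * l1 γ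

/-- The extension of `γhat^{(j)}` to all coordinates, with `r`-th entry `-1`. -/
def γtilde (j : ℕ) (ω : Ω) (k : Fin S.p) : ℝ :=
  if h : k = S.r then -1 else S.γhat j ω ⟨k, h⟩

/-- The entry at observation `i` of `zhat^{(j)} = x_r^{(j)} - X_{-r}^{(j)} γhat^{(j)}`. -/
def zhat (j i : ℕ) (ω : Ω) : ℝ :=
  S.x i ω S.r - ∑ k : {k // k ≠ S.r}, S.x i ω k.1 * S.γhat j ω k

/-- `τhat^{(j)} = Jtilde^{(j)}_{r,r} - Jtilde^{(j)}_{r,-r} γhat^{(j)}`. -/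
def τhat (j : ℕ) (ω : Ω) : ℝ :=
  S.Jtilde G j ω S.r S.r - ∑ k : {k // k ≠ S.r}, S.Jtilde G j ω S.r k.1 * S.γhat j ω k

/-- The online debiased lasso estimator of the `r`-th coefficient after the last batch. -/
def βon (ω : Ω) : ℝ :=
  S.βhat S.b ω S.r + 1 / S.τhat G S.b ω *
    (∑ j ∈ Finset.Icc 1 S.b, ∑ i ∈ S.batch j,
        S.zhat j i ω * (S.y i ω - G.g (S.x i ω ⬝ᵥ S.βhat j ω)) +
      ∑ j ∈ Finset.Icc 1 S.b,
        S.γtilde j ω ⬝ᵥ (S.J G j (S.βhat j ω) ω *ᵥ (S.βhat S.b ω - S.βhat j ω)))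

/-- The leading term `W_r`. -/
def W (ω : Ω) : ℝ :=
  1 / √(S.N S.b : ℝ) * ∑ j ∈ Finset.Icc 1 S.b, ∑ i ∈ S.batch j,
    S.zhat j i ω * (S.y i ω - G.g (S.x i ω ⬝ᵥ S.β₀))

variable [MeasurableSpace Ω] (μ : Measure Ω)

/-- Population information matrix `𝔼[J^{(1)}(β₀)] / N_1`. -/
def popJ : Matrix (Fin S.p) (Fin S.p) ℝ :=
  Matrix.of fun k l => (∫ ω, S.J G 1 S.β₀ ω k l ∂μ) / S.N 1

/-- `s_0`, the number of nonzero entries of `β₀` (read as `1` if there is none). -/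
def s₀ : ℕ := max 1 (Nat.card {k // S.β₀ k ≠ 0})

/-- `s_r`, the number of nonzero off-diagonal entries in column `r` of the inverse of the
population information matrix (read as `1` if there is none). -/
def sr : ℕ := max 1 (Nat.card {k // k ≠ S.r ∧ (S.popJ G μ)⁻¹ k S.r ≠ 0})

/-- The observations `(x_i, y_i)` of the `b` batches are i.i.d., and given `x_i` the response
`y_i` has the density of the model at the linear predictor `x_iᵀ β₀`. -/
structure IsSample : Prop where
  measurable_x : ∀ i < S.N S.b, Measurable (S.x i)
  measurable_y : ∀ i < S.N S.b, Measurable (S.y i)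
  indep : iIndepFun (fun (i : Fin (S.N S.b)) ω => (S.x i ω, S.y i ω)) μ
  ident : ∀ i < S.N S.b, ∀ i' < S.N S.b,
    IdentDistrib (fun ω => (S.x i ω, S.y i ω)) (fun ω => (S.x i' ω, S.y i' ω)) μ μ
  condDensity : ∀ i < S.N S.b, ∀ A : Set (Fin S.p → ℝ), MeasurableSet A →
    ∀ B : Set ℝ, MeasurableSet B →
      μ (S.x i ⁻¹' A ∩ S.y i ⁻¹' B) =
        ∫⁻ ω in S.x i ⁻¹' A, ∫⁻ y in B,
          ENNReal.ofReal (edmDensity G.a G.d G.φ (G.g (S.x i ω ⬝ᵥ S.β₀)) y) ∂G.ν ∂μ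

/-- The regularity conditions (A1)-(A4), with explicit constants; (A3) is required on the
`ℓ₁`-ball of radius `δ` around `β₀`. -/
structure Regular (K M L δ K₂ K₃ κ : ℝ) : Prop where
  bounded_x : ∀ᵐ ω ∂μ, ∀ i < S.N S.b, ∀ k, |S.x i ω k| ≤ K
  isMinOn_γ₀ : IsMinOn (projQuad (S.popJ G μ) S.r) Set.univ S.γ₀
  bounded_predictor : ∀ᵐ ω ∂μ, ∀ i < S.N S.b, |S.x i ω ⬝ᵥ S.β₀| ≤ M
  bounded_projection : ∀ᵐ ω ∂μ, ∀ i < S.N S.b,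
    |∑ k : {k // k ≠ S.r}, S.x i ω k.1 * S.γ₀ k| ≤ M
  lipschitz : ∀ᵐ ω ∂μ, ∀ i < S.N S.b, ∀ β β' : Fin S.p → ℝ,
    l1 (β - S.β₀) ≤ δ → l1 (β' - S.β₀) ≤ δ →
      |deriv G.g (S.x i ω ⬝ᵥ β) - deriv G.g (S.x i ω ⬝ᵥ β')| ≤
        L * |S.x i ω ⬝ᵥ β - S.x i ω ⬝ᵥ β'|
  bounded_deriv : ∀ᵐ ω ∂μ, ∀ i < S.N S.b, ∀ β : Fin S.p → ℝ, l1 (β - S.β₀) ≤ δ →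
    |deriv G.g (S.x i ω ⬝ᵥ β)| ≤ K₂
  bounded_inv_deriv : ∀ᵐ ω ∂μ, ∀ i < S.N S.b, ∀ β : Fin S.p → ℝ, l1 (β - S.β₀) ≤ δ →
    deriv G.g (S.x i ω ⬝ᵥ β) ≠ 0 ∧ |1 / deriv G.g (S.x i ω ⬝ᵥ β)| ≤ K₃
  eigenvalue : ∀ t : ℝ, Module.End.HasEigenvalue (Matrix.toLin' (S.popJ G μ)) t → κ ≤ t

/-- `βhat` and `γhat` are (some choice of) the online lasso estimators and low-dimensional
projections with tuning parameters `λ_j = C √(log p / N_j)`. -/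
structure IsEstimator (C : ℝ) : Prop where
  lasso : ∀ᵐ ω ∂μ, ∀ j ∈ Finset.Icc 1 S.b,
    IsMinOn (S.lassoObjective G C j ω) Set.univ (S.βhat j ω)
  proj : ∀ᵐ ω ∂μ, ∀ j ∈ Finset.Icc 1 S.b,
    IsMinOn (S.projObjective G C j ω) Set.univ (S.γhat j ω)

end Stream

end OnlineGLM

end

/-! Outside a set of measure at most 6/p, all estimators obey deterministic bounds in every batch at
once. The good event (`GoodOutcome`) contains entrywise deviation bounds at level √(N_j (log p + j))
for the score, the information matrix and the projection residuals. The additional j makes the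
failure probabilities summable over any number of batches (`measure_not_goodOutcome_le`). The
canonical link enters through exponential tilting: tilting computes the moment generating function
of the score, and it forces g to be monotone, so that every objective is convex.

On the good event the lasso is analysed by induction over batches (`lasso_error_bounds`). Replacing
the past losses by a quadratic surrogate costs a multiple of the previous squared prediction error,
so the bounds grow by the factor 16 K₂ K₃ per batch; this geometric growth is the source of c₁^{(j)}
= A^j. Convexity localizes the argument to the ℓ₁-ball of radius δ, the only place where regularity
is assumed. Curvature comes from the population matrix, up to a slack proportional to the squared ℓ₁
norm, which large samples allow to be absorbed (`lasso_step`). The low-dimensional projection is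
treated in the same way (`proj_error_bounds`). Its target is sparse because, extended by -1, it is a
multiple of column r of the inverse population matrix.

The scaled error of the debiased estimator is then decomposed exactly (`τhat_mul_βon_sub`) into the
leading sum and three remainders: the first order condition of the last projection paired with the
lasso error, the drift of the projections between batches paired with the lasso error, and the
Taylor remainders of g weighted by residuals. With a = 16 K₂ K₃ each is at most of order b a^{2b}
(s₀ + s_r) s₀ log p. Since b = o(log N_b), the factor b a^{2b} is eventually below N_b^ε, and
division by √N_b leaves quantities that vanish by assumption (`tendsto_remainder_zero`). -/

noncomputable section

namespace OnlineGLM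

/-! ### Exponential families: tilting, monotonicity of the mean, Bregman bounds. -/

namespace GLM

variable (G : GLM)

/-- The cumulant function, up to an additive constant: a primitive of the mean function. -/
def cumulant (t : ℝ) : ℝ := G.d 0 (G.g t)

lemma hasDerivAt_cumulant (t : ℝ) : HasDerivAt G.cumulant (G.g t) t :=
  (G.hasDerivAt_d 0 t).congr_deriv (sub_zero _)

/-- The deviance is the cumulant function minus the linear term, up to a constant. -/
lemma d_sub_d (y s t : ℝ) :
    G.d y (G.g t) - G.d y (G.g s) = G.cumulant t - G.cumulant s - y * (t - s) := by
  have h : ∀ u, HasDerivAt (fun u => G.d y (G.g u) - G.cumulant u + y * u) 0 u := by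
    intro u
    exact (((G.hasDerivAt_d y u).sub (G.hasDerivAt_cumulant u)).add
      ((hasDerivAt_id u).const_mul y)).congr_deriv (by ring)
  have := is_const_of_deriv_eq_zero (fun u => (h u).differentiableAt) (fun u => (h u).deriv) t s
  linarith

/-- The density of the response at the linear predictor `η`. -/
def density (η y : ℝ) : ℝ := edmDensity G.a G.d G.φ (G.g η) y

lemma density_nonneg (η y : ℝ) : 0 ≤ G.density η y :=
  mul_nonneg (G.a_nonneg y) (Real.exp_pos _).le

lemma measurable_density (η : ℝ) : Measurable (G.density η) := by
  unfold density edmDensity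
  exact G.measurable_a.mul (((G.measurable_d η).neg.div_const _).exp)

/-- Exponential tilting moves the linear predictor. -/
lemma density_tilt (η t y : ℝ) :
    G.density (η + t) y = G.density η y *
      Real.exp ((t * y - (G.cumulant (η + t) - G.cumulant η)) / (2 * G.φ)) := by
  have h := G.d_sub_d y η (η + t)
  unfold density edmDensity
  rw [mul_assoc, ← Real.exp_add]
  congr 2
  rw [← add_div]
  congr 1
  linarith

lemma integrable_density' (η : ℝ) : Integrable (G.density η) G.ν := by
  refine ⟨(G.measurable_density η).aestronglyMeasurable, ?_⟩
  rw [hasFiniteIntegral_iff_ofReal (ae_of_all _ (G.density_nonneg η))]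
  have := G.lintegral_density η
  unfold density
  rw [this]
  exact ENNReal.one_lt_top

lemma integral_density (η : ℝ) : ∫ y, G.density η y ∂G.ν = 1 := by
  rw [integral_eq_lintegral_of_nonneg_ae (ae_of_all _ (G.density_nonneg η))
    (G.measurable_density η).aestronglyMeasurable]
  have := G.lintegral_density η
  unfold density
  rw [this]
  simp

/-- The mean function of the canonical link is monotone. -/
lemma monotone_g : Monotone G.g := by
  intro η η' h
  obtain ⟨t, rfl⟩ : ∃ t, η' = η + t := ⟨η' - η, by ring⟩
  rcases eq_or_lt_of_le (show 0 ≤ t by linarith) with h0 | h0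
  · simp [← h0]
  have hint : ∀ η, Integrable (fun y => y * G.density η y) G.ν := G.integrable_density
  have hmean : ∀ η, ∫ y, y * G.density η y ∂G.ν = G.g η := G.mean_density
  -- The densities at η + t and η have ratio exp (t (y - m) / (2 φ)), which crosses 1 at y = m, so
  -- (y - m) times their difference is nonnegative. On integration the terms with m cancel, both
  -- masses being one, and the difference of the means remains.
  set m := (G.cumulant (η + t) - G.cumulant η) / t with hm
  have key : 0 ≤ ∫ y, (y * G.density (η + t) y - y * G.density η y -
      (m * G.density (η + t) y - m * G.density η y)) ∂G.ν := by
    refine integral_nonneg fun y => ?_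
    have e : y * G.density (η + t) y - y * G.density η y -
      (m * G.density (η + t) y - m * G.density η y) = (y - m) *
        (Real.exp (t / (2 * G.φ) * (y - m)) - 1) * G.density η y := by
      rw [G.density_tilt η t y]
      have : (t * y - (G.cumulant (η + t) - G.cumulant η)) / (2 * G.φ) =
          t / (2 * G.φ) * (y - m) := by
        rw [hm]; field_simp
      rw [this]; ring
    simp only [Pi.zero_apply]
    rw [e]
    refine mul_nonneg ?_ (G.density_nonneg _ _)
    have hφ := G.φ_pos
    have hc : 0 < t / (2 * G.φ) := by positivity
    rcases le_total 0 (y - m) with hy | hy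
    · refine mul_nonneg hy ?_
      have := Real.one_le_exp (mul_nonneg hc.le hy)
      linarith
    · refine mul_nonneg_of_nonpos_of_nonpos hy ?_
      have := Real.exp_le_one_iff.2 (mul_nonpos_of_nonneg_of_nonpos hc.le hy)
      linarith
  have i1 := hint (η + t)
  have i2 := hint η
  have i3 := (G.integrable_density' (η + t)).const_mul m
  have i4 := (G.integrable_density' η).const_mul m
  rw [integral_sub (f := fun y => _ - _) (g := fun y => _ - _) (i1.sub i2) (i3.sub i4),
    integral_sub i1 i2, integral_sub i3 i4, hmean, hmean,
    integral_const_mul, integral_const_mul, integral_density, integral_density] at key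
  linarith

lemma deriv_g_nonneg (t : ℝ) : 0 ≤ deriv G.g t := G.monotone_g.deriv_nonneg

lemma hasDerivAt_g (t : ℝ) : HasDerivAt G.g (deriv G.g t) t :=
  (G.differentiable_g t).hasDerivAt

lemma convexOn_cumulant : ConvexOn ℝ Set.univ G.cumulant := by
  refine MonotoneOn.convexOn_of_deriv convex_univ ?_ ?_ ?_
  · exact fun t _ => (G.hasDerivAt_cumulant t).continuousAt.continuousWithinAt
  · exact fun t _ => (G.hasDerivAt_cumulant t).differentiableAt.differentiableWithinAt
  · intro s _ t _ h
    rw [(G.hasDerivAt_cumulant s).deriv, (G.hasDerivAt_cumulant t).deriv]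
    exact G.monotone_g h

/-- Upper bound on the Bregman divergence of the cumulant function. -/
lemma cumulant_bregman_le {η t K₂ : ℝ} (h : ∀ θ ∈ Set.Icc (0 : ℝ) 1, deriv G.g (η + θ * t) ≤ K₂) :
    G.cumulant (η + t) - G.cumulant η - t * G.g η ≤ K₂ * t ^ 2 := by
  -- Two mean value steps write the divergence as a value of g' times θ t² with 0 < θ < 1. Bounding
  -- θ by one costs only the usual factor 1/2.
  obtain ⟨θ, hθ, e⟩ := exists_hasDerivAt_eq_slope (fun u => G.cumulant (η + u * t))
    (fun u => G.g (η + u * t) * t) zero_lt_one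
    (fun u _ => by
      have h1 : HasDerivAt (fun u : ℝ => η + u * t) t u := by
        simpa using ((hasDerivAt_id u).mul_const t).const_add η
      exact ((G.hasDerivAt_cumulant _).comp u h1).continuousAt.continuousWithinAt)
    (fun u _ => by
      have h1 : HasDerivAt (fun u : ℝ => η + u * t) t u := by
        simpa using ((hasDerivAt_id u).mul_const t).const_add η
      exact (G.hasDerivAt_cumulant _).comp u h1)
  simp only [one_mul, zero_mul, add_zero, sub_zero, div_one] at e
  obtain ⟨θ', hθ', e'⟩ := exists_hasDerivAt_eq_slope (fun u => G.g (η + u * t))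
    (fun u => deriv G.g (η + u * t) * t) hθ.1
    (fun u _ => by
      have h1 : HasDerivAt (fun u : ℝ => η + u * t) t u := by
        simpa using ((hasDerivAt_id u).mul_const t).const_add η
      exact ((G.hasDerivAt_g _).comp u h1).continuousAt.continuousWithinAt)
    (fun u _ => by
      have h1 : HasDerivAt (fun u : ℝ => η + u * t) t u := by
        simpa using ((hasDerivAt_id u).mul_const t).const_add η
      exact (G.hasDerivAt_g _).comp u h1)
  have hθ0 := hθ.1
  simp only [zero_mul, add_zero, sub_zero] at e'
  rw [eq_div_iff hθ0.ne'] at e'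
  have hd := h θ' ⟨hθ'.1.le, (hθ'.2.trans hθ.2).le⟩
  have hd0 := G.deriv_g_nonneg (η + θ' * t)
  have : G.cumulant (η + t) - G.cumulant η - t * G.g η = deriv G.g (η + θ' * t) * θ * t ^ 2 := by
    rw [← e]
    have : G.g (η + θ * t) = G.g η + deriv G.g (η + θ' * t) * t * θ := by linarith
    rw [this]; ring
  rw [this]
  refine mul_le_mul_of_nonneg_right ?_ (sq_nonneg t)
  nlinarith [hθ.2]

/-- Lower bound on the Bregman divergence of the cumulant function. -/
lemma le_cumulant_bregman {η t m : ℝ} (h : ∀ θ ∈ Set.Icc (0 : ℝ) 1, m ≤ deriv G.g (η + θ * t)) :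
    m / 2 * t ^ 2 ≤ G.cumulant (η + t) - G.cumulant η - t * G.g η := by
  have h1 : ∀ u : ℝ, HasDerivAt (fun u : ℝ => η + u * t) t u := fun u => by
    simpa using ((hasDerivAt_id u).mul_const t).const_add η
  -- Once the quadratic of curvature m and the tangent are subtracted, the slope along the segment
  -- starts at zero and is increasing, so the function itself increases. Only differentiability of g
  -- is used.
  have hψ : ∀ u : ℝ, HasDerivAt (fun u => G.g (η + u * t) * t - m * t ^ 2 * u)
      (deriv G.g (η + u * t) * t * t - m * t ^ 2) u := fun u => by
    exact ((((G.hasDerivAt_g _).comp u (h1 u)).mul_const t).sub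
      ((hasDerivAt_id u).const_mul (m * t ^ 2))).congr_deriv (by ring)
  have hψm : MonotoneOn (fun u => G.g (η + u * t) * t - m * t ^ 2 * u) (Set.Icc 0 1) := by
    refine monotoneOn_of_deriv_nonneg (convex_Icc 0 1)
      (fun u _ => (hψ u).continuousAt.continuousWithinAt)
      (fun u _ => (hψ u).differentiableAt.differentiableWithinAt) ?_
    intro u hu
    rw [interior_Icc] at hu
    rw [(hψ u).deriv]
    nlinarith [h u ⟨hu.1.le, hu.2.le⟩, sq_nonneg t]
  have hF : ∀ u : ℝ, HasDerivAt
      (fun u => G.cumulant (η + u * t) - u * (t * G.g η) - m / 2 * t ^ 2 * u ^ 2)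
      (G.g (η + u * t) * t - t * G.g η - m * t ^ 2 * u) u := fun u => by
    exact (((((G.hasDerivAt_cumulant _).comp u (h1 u))).sub
      ((hasDerivAt_id u).mul_const (t * G.g η))).sub
      ((hasDerivAt_pow 2 u).const_mul (m / 2 * t ^ 2))).congr_deriv (by norm_num; ring)
  have hFm : MonotoneOn
      (fun u => G.cumulant (η + u * t) - u * (t * G.g η) - m / 2 * t ^ 2 * u ^ 2)
      (Set.Icc 0 1) := by
    refine monotoneOn_of_deriv_nonneg (convex_Icc 0 1)
      (fun u _ => (hF u).continuousAt.continuousWithinAt)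
      (fun u _ => (hF u).differentiableAt.differentiableWithinAt) ?_
    intro u hu
    rw [interior_Icc] at hu
    rw [(hF u).deriv]
    have := hψm (by simp) ⟨hu.1.le, hu.2.le⟩ hu.1.le
    simp only [zero_mul, add_zero, mul_zero, sub_zero] at this
    linarith
  have := hFm (by simp) (by simp) zero_le_one
  simp only [zero_mul, add_zero, sub_zero, one_mul, ne_eq, OfNat.ofNat_ne_zero,
    not_false_eq_true, zero_pow, mul_zero, one_pow, mul_one] at this
  linarith

/-- First order expansion of the mean function, when its derivative is Lipschitz on the segment. -/
lemma abs_g_expansion_le {u₀ u₁ L : ℝ}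
    (h : ∀ θ ∈ Set.Icc (0 : ℝ) 1,
      |deriv G.g (u₀ + θ * (u₁ - u₀)) - deriv G.g u₁| ≤ L * |u₁ - u₀|) :
    |G.g u₀ - G.g u₁ + deriv G.g u₁ * (u₁ - u₀)| ≤ L * (u₁ - u₀) ^ 2 := by
  set t := u₁ - u₀ with ht
  have h1 : ∀ u : ℝ, HasDerivAt (fun u : ℝ => u₀ + u * t) t u := fun u => by
    simpa using ((hasDerivAt_id u).mul_const t).const_add u₀
  obtain ⟨θ, hθ, e⟩ := exists_hasDerivAt_eq_slope (fun u => G.g (u₀ + u * t))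
    (fun u => deriv G.g (u₀ + u * t) * t) zero_lt_one
    (fun u _ => ((G.hasDerivAt_g _).comp u (h1 u)).continuousAt.continuousWithinAt)
    (fun u _ => (G.hasDerivAt_g _).comp u (h1 u))
  have hu : u₀ + t = u₁ := by rw [ht]; ring
  simp only [one_mul, zero_mul, add_zero, sub_zero, div_one, hu] at e
  have : G.g u₀ - G.g u₁ + deriv G.g u₁ * t =
      -((deriv G.g (u₀ + θ * t) - deriv G.g u₁) * t) := by linarith
  rw [this, abs_neg, abs_mul, ← sq_abs t, sq, ← mul_assoc]
  exact mul_le_mul_of_nonneg_right (h θ ⟨hθ.1.le, hθ.2.le⟩) (abs_nonneg _)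

end GLM

/-! ### Chernoff bounds at a single argument. -/

section Chernoff

variable {Ω ι : Type*} [MeasurableSpace Ω] {μ : Measure Ω} {X : ι → Ω → ℝ}

/-- One-sided Chernoff bound for sums of independent variables whose moment generating functions
are sub-Gaussian at the optimal argument. -/
lemma measureReal_sum_ge_le (hind : iIndepFun X μ) (hm : ∀ i, Measurable (X i)) (s : Finset ι)
    {σ q N t : ℝ} (hσ : 0 ≤ σ) (hN0 : 0 < N) (hN : (s.card : ℝ) ≤ N) (ht : 0 ≤ t)
    (hint : ∀ i ∈ s, Integrable (fun ω => Real.exp (√(t / N) * X i ω)) μ)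
    (hmgf : ∀ i ∈ s, mgf (X i) μ √(t / N) ≤ Real.exp (σ * √(t / N) ^ 2)) :
    μ.real {ω | (σ + q) * √(N * t) ≤ ∑ i ∈ s, X i ω} ≤ Real.exp (-(q * t)) := by
  have : IsProbabilityMeasure μ := hind.isProbabilityMeasure
  set θ := √(t / N) with hθ
  have hθ2 : θ ^ 2 = t / N := Real.sq_sqrt (by positivity)
  have hθt : θ * √(N * t) = t := by
    rw [hθ, ← Real.sqrt_mul (by positivity), show t / N * (N * t) = t ^ 2 by field_simp,
      Real.sqrt_sq ht]
  have h1 := measure_ge_le_exp_mul_mgf (μ := μ) (X := ∑ i ∈ s, X i) ((σ + q) * √(N * t))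
    (Real.sqrt_nonneg (t / N)) (hind.integrable_exp_mul_sum hm hint)
  simp only [Finset.sum_apply] at h1
  refine h1.trans ?_
  rw [hind.mgf_sum hm]
  -- At the argument √(t / N) the factors contribute at most σ t and the threshold contributes (σ +
  -- q) t, which leaves q t. No other argument is involved; this matters for the score, which is
  -- controlled only near the origin.
  have h2 : ∏ i ∈ s, mgf (X i) μ √(t / N) ≤ Real.exp (σ * t) := by
    calc ∏ i ∈ s, mgf (X i) μ √(t / N) ≤ ∏ _i ∈ s, Real.exp (σ * θ ^ 2) :=
          Finset.prod_le_prod (fun i _ => mgf_nonneg) hmgf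
      _ = Real.exp (s.card * (σ * θ ^ 2)) := by
          rw [Finset.prod_const, ← Real.exp_nat_mul]
      _ ≤ Real.exp (σ * t) := by
          refine Real.exp_le_exp.2 ?_
          rw [hθ2]
          calc (s.card : ℝ) * (σ * (t / N)) ≤ N * (σ * (t / N)) := by gcongr
            _ = σ * t := by field_simp
  calc Real.exp (-√(t / N) * ((σ + q) * √(N * t))) * ∏ i ∈ s, mgf (X i) μ √(t / N)
      ≤ Real.exp (-√(t / N) * ((σ + q) * √(N * t))) * Real.exp (σ * t) := by gcongr
    _ = Real.exp (-(q * t)) := by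
        rw [← Real.exp_add]
        congr 1
        have : -√(t / N) * ((σ + q) * √(N * t)) = -(σ + q) * (θ * √(N * t)) := by rw [hθ]; ring
        rw [this, hθt]; ring

/-- Two-sided Chernoff bound. -/
lemma measure_abs_sum_gt_le (hind : iIndepFun X μ) (hm : ∀ i, Measurable (X i)) (s : Finset ι)
    {σ q N t : ℝ} (hσ : 0 ≤ σ) (hN0 : 0 < N) (hN : (s.card : ℝ) ≤ N) (ht : 0 ≤ t)
    (h : ∀ i ∈ s, ∀ θ : ℝ, |θ| = √(t / N) → Integrable (fun ω => Real.exp (θ * X i ω)) μ ∧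
      mgf (X i) μ θ ≤ Real.exp (σ * θ ^ 2)) :
    μ {ω | (σ + q) * √(N * t) < |∑ i ∈ s, X i ω|} ≤ ENNReal.ofReal (2 * Real.exp (-(q * t))) := by
  have : IsProbabilityMeasure μ := hind.isProbabilityMeasure
  have habs : |√(t / N)| = √(t / N) := abs_of_nonneg (Real.sqrt_nonneg _)
  have h1 := measureReal_sum_ge_le (q := q) hind hm s hσ hN0 hN ht
    (fun i hi => (h i hi _ habs).1) (fun i hi => (h i hi _ habs).2)
  have hind' : iIndepFun (fun i ω => -X i ω) μ :=
    hind.comp (fun _ x => -x) (fun _ => measurable_neg)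
  have h2 := measureReal_sum_ge_le (q := q) hind' (fun i => (hm i).neg) s hσ hN0 hN ht
    (fun i hi => by
      have := (h i hi (-√(t / N)) (by rw [abs_neg, habs])).1
      simpa using this)
    (fun i hi => by
      have := (h i hi (-√(t / N)) (by rw [abs_neg, habs])).2
      rw [neg_sq] at this
      refine le_trans (le_of_eq ?_) this
      simp [mgf])
  have hsub : {ω | (σ + q) * √(N * t) < |∑ i ∈ s, X i ω|} ⊆
      {ω | (σ + q) * √(N * t) ≤ ∑ i ∈ s, X i ω} ∪
      {ω | (σ + q) * √(N * t) ≤ ∑ i ∈ s, -X i ω} := by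
    intro ω hω
    simp only [Set.mem_ofPred_eq, Set.mem_union, Finset.sum_neg_distrib] at hω ⊢
    rcases lt_abs.1 hω with h | h
    · exact Or.inl h.le
    · exact Or.inr h.le
  refine (measure_mono hsub).trans ((measure_union_le _ _).trans ?_)
  rw [two_mul, ENNReal.ofReal_add (Real.exp_pos _).le (Real.exp_pos _).le]
  refine add_le_add ?_ ?_
  · exact (ENNReal.le_ofReal_iff_toReal_le (measure_ne_top _ _) (Real.exp_pos _).le).2 h1
  · exact (ENNReal.le_ofReal_iff_toReal_le (measure_ne_top _ _) (Real.exp_pos _).le).2 h2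

/-- Hoeffding's lemma for a centered variable bounded in absolute value. -/
lemma integrable_exp_and_mgf_le_of_abs_le [IsProbabilityMeasure μ] {Y : Ω → ℝ} {B : ℝ}
    (hm : Measurable Y) (hB : ∀ᵐ ω ∂μ, |Y ω| ≤ B) (h0 : ∫ ω, Y ω ∂μ = 0) (θ : ℝ) :
    Integrable (fun ω => Real.exp (θ * Y ω)) μ ∧ mgf Y μ θ ≤ Real.exp (B ^ 2 * θ ^ 2) := by
  have h := hasSubgaussianMGF_of_mem_Icc_of_integral_eq_zero (a := -B) (b := B) hm.aemeasurable
    (hB.mono fun ω hω => abs_le.1 hω) h0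
  refine ⟨h.integrable_exp_mul θ, (h.mgf_le θ).trans (Real.exp_le_exp.2 ?_)⟩
  have : (((‖B - -B‖₊ / 2) ^ 2 : NNReal) : ℝ) = B ^ 2 := by
    push_cast
    rw [Real.norm_eq_abs, show B - -B = 2 * B by ring, abs_mul]
    simp
  rw [this]
  nlinarith [sq_nonneg (B * θ)]

end Chernoff

/-! ### Law of one observation and moment generating function of the response. -/

namespace GLM

variable (G : GLM)

/-- Continuity in the predictor and measurability in the response give the joint measurability
needed to disintegrate the law of an observation. -/
lemma measurable_uncurry_density : Measurable (Function.uncurry G.density) := by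
  refine measurable_uncurry_of_continuous_of_measurable (fun y => ?_) G.measurable_density
  unfold density edmDensity
  have : Continuous fun t => G.d y (G.g t) :=
    continuous_iff_continuousAt.2 fun t => (G.hasDerivAt_d y t).continuousAt
  fun_prop

/-- Moment generating function of the centered response. -/
lemma lintegral_exp_mul_density (η θ : ℝ) :
    ∫⁻ y, ENNReal.ofReal (Real.exp (θ * (y - G.g η))) * ENNReal.ofReal (G.density η y) ∂G.ν =
      ENNReal.ofReal (Real.exp ((G.cumulant (η + 2 * G.φ * θ) - G.cumulant η -
        2 * G.φ * θ * G.g η) / (2 * G.φ))) := by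
  have hφ := G.φ_pos
  have h : ∀ y, ENNReal.ofReal (Real.exp (θ * (y - G.g η))) * ENNReal.ofReal (G.density η y) =
      ENNReal.ofReal (Real.exp ((G.cumulant (η + 2 * G.φ * θ) - G.cumulant η -
        2 * G.φ * θ * G.g η) / (2 * G.φ))) *
        ENNReal.ofReal (G.density (η + 2 * G.φ * θ) y) := by
    intro y
    rw [← ENNReal.ofReal_mul (Real.exp_pos _).le, ← ENNReal.ofReal_mul (Real.exp_pos _).le,
      G.density_tilt η (2 * G.φ * θ) y]
    congr 1
    rw [mul_left_comm, mul_comm, ← Real.exp_add]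
    congr 2
    field_simp
    ring
  simp_rw [h]
  rw [lintegral_const_mul _ ((G.measurable_density _).ennreal_ofReal)]
  have := G.lintegral_density (η + 2 * G.φ * θ)
  unfold density
  rw [this, mul_one]

end GLM

namespace Stream

variable {Ω : Type*} {S : Stream Ω} {G : GLM} [MeasurableSpace Ω] {μ : Measure Ω}

/-- Conditional expectations given the covariates are integrals against the model density. -/
lemma IsSample.lintegral_comp [IsProbabilityMeasure μ] (hS : S.IsSample G μ) {i : ℕ}
    (hi : i < S.N S.b) {h : (Fin S.p → ℝ) × ℝ → ENNReal} (hh : Measurable h) :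
    ∫⁻ ω, h (S.x i ω, S.y i ω) ∂μ = ∫⁻ ω, ∫⁻ y, h (S.x i ω, y) *
      ENNReal.ofReal (G.density (S.x i ω ⬝ᵥ S.β₀) y) ∂G.ν ∂μ := by
  have := G.sigmaFinite
  have hx := hS.measurable_x i hi
  have hy := hS.measurable_y i hi
  have hdot : Measurable fun ω => S.x i ω ⬝ᵥ S.β₀ := by
    unfold dotProduct
    exact Finset.measurable_sum _ fun k _ => ((measurable_pi_apply k).comp hx).mul_const _
  have hf : Measurable fun z : Ω × ℝ =>
      ENNReal.ofReal (G.density (S.x i z.1 ⬝ᵥ S.β₀) z.2) := by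
    have := G.measurable_uncurry_density.comp
      ((hdot.comp measurable_fst).prodMk measurable_snd : Measurable fun z : Ω × ℝ => _)
    exact this.ennreal_ofReal
  have hmap : Measurable fun z : Ω × ℝ => (S.x i z.1, z.2) :=
    (hx.comp measurable_fst).prodMk measurable_snd
  have hc : Measurable fun z : Ω × ℝ => h (S.x i z.1, z.2) := hh.comp hmap
  -- Rectangles determine a probability law on a product, and on rectangles the identity is
  -- `condDensity`.
  have hlaw : μ.map (fun ω => (S.x i ω, S.y i ω)) =
      ((μ.prod G.ν).withDensity fun z =>
        ENNReal.ofReal (G.density (S.x i z.1 ⬝ᵥ S.β₀) z.2)).map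
          (fun z : Ω × ℝ => (S.x i z.1, z.2)) := by
    have : IsProbabilityMeasure (μ.map (fun ω => (S.x i ω, S.y i ω))) :=
      Measure.isProbabilityMeasure_map (hx.prodMk hy).aemeasurable
    refine Measure.ext_prod fun {A B} hA hB => ?_
    rw [Measure.map_apply (hx.prodMk hy) (hA.prod hB), Measure.map_apply hmap (hA.prod hB)]
    have e1 : (fun ω => (S.x i ω, S.y i ω)) ⁻¹' A ×ˢ B = S.x i ⁻¹' A ∩ S.y i ⁻¹' B := by
      ext ω; simp
    have e2 : (fun z : Ω × ℝ => (S.x i z.1, z.2)) ⁻¹' A ×ˢ B = (S.x i ⁻¹' A) ×ˢ B := by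
      ext ω; simp
    rw [e1, e2, hS.condDensity i hi A hA B hB, withDensity_apply _ ((hx hA).prod hB),
      ← Measure.prod_restrict, lintegral_prod _ hf.aemeasurable]
    rfl
  have h1 : ∫⁻ ω, h (S.x i ω, S.y i ω) ∂μ = ∫⁻ z, h z ∂(μ.map (fun ω => (S.x i ω, S.y i ω))) :=
    (lintegral_map hh (hx.prodMk hy)).symm
  rw [h1, hlaw, lintegral_map hh hmap, lintegral_withDensity_eq_lintegral_mul _ hf hc,
    lintegral_prod _ (hf.mul hc).aemeasurable]
  simp only [Pi.mul_apply, mul_comm]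

end Stream

/-! ### Deterministic analysis of one lasso step. -/

section LassoStep

/-- Here a₁ and a₂ stand for the ℓ₁ and ℓ₂ norms of the error. By `h₁`, a₁ is controlled by a₂ and
E, so the slack ρ a₁² is absorbed into half of the curvature plus E, without a cone condition.
Young's inequality for H a₂ does the rest. -/
lemma lasso_bounds_of_curvature {Q w H E q ρ a₁ a₂ : ℝ} (ha₁ : 0 ≤ a₁)
    (hw : 0 < w) (hq : 0 < q) (hE : 0 ≤ E) (hρ : 0 ≤ ρ) (hQ : 0 ≤ Q)
    (h₁ : Q + w / 2 * a₁ ≤ H * a₂ + E) (h₂ : q * a₂ ^ 2 - ρ * a₁ ^ 2 ≤ Q)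
    (h₃ : 16 * ρ * H ^ 2 ≤ q * w ^ 2) (h₄ : 8 * ρ * E ≤ w ^ 2) :
    Q ≤ 2 * E + 3 * (H ^ 2 / q) ∧ w * a₁ ≤ 3 * E + 4 * (H ^ 2 / q) := by
  have e1 : w ^ 2 * a₁ ^ 2 ≤ 8 * H ^ 2 * a₂ ^ 2 + 8 * E ^ 2 := by
    have h5 : w / 2 * a₁ ≤ H * a₂ + E := by linarith
    have h6 : (w / 2 * a₁) ^ 2 ≤ (H * a₂ + E) ^ 2 := by gcongr
    nlinarith [sq_nonneg (H * a₂ - E)]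
  have e2 : ρ * a₁ ^ 2 ≤ q / 2 * a₂ ^ 2 + E := by
    have hw2 : 0 < w ^ 2 := by positivity
    refine le_of_mul_le_mul_left ?_ hw2
    have i1 : 16 * ρ * H ^ 2 * a₂ ^ 2 ≤ q * w ^ 2 * a₂ ^ 2 := by gcongr
    have i2 : 8 * ρ * E * E ≤ w ^ 2 * E := by gcongr
    have i3 : ρ * (w ^ 2 * a₁ ^ 2) ≤ ρ * (8 * H ^ 2 * a₂ ^ 2 + 8 * E ^ 2) := by gcongr
    nlinarith
  have e3 : H * a₂ ≤ q / 8 * a₂ ^ 2 + 2 * (H ^ 2 / q) := by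
    have : q / 8 * a₂ ^ 2 + 2 * (H ^ 2 / q) - H * a₂ = (q * a₂ - 4 * H) ^ 2 / (8 * q) := by
      field_simp; ring
    have h0 : 0 ≤ (q * a₂ - 4 * H) ^ 2 / (8 * q) := by positivity
    linarith
  have hwa : 0 ≤ w * a₁ := by positivity
  have hHq : 0 ≤ H ^ 2 / q := by positivity
  constructor <;> linarith

variable {ι : Type*} [Fintype ι]

lemma l1_nonneg (v : ι → ℝ) : 0 ≤ l1 v := Finset.sum_nonneg fun _ _ => abs_nonneg _

lemma l1_add_le (u v : ι → ℝ) : l1 (u + v) ≤ l1 u + l1 v := by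
  unfold l1
  rw [← Finset.sum_add_distrib]
  exact Finset.sum_le_sum fun k _ => abs_add_le _ _

lemma l1_smul (c : ℝ) (v : ι → ℝ) : l1 (c • v) = |c| * l1 v := by
  simp [l1, abs_mul, Finset.mul_sum]

lemma l1_neg (v : ι → ℝ) : l1 (-v) = l1 v := by simp [l1]

lemma l1_sub_le (u v : ι → ℝ) : l1 (u - v) ≤ l1 u + l1 v := by
  rw [sub_eq_add_neg, ← l1_neg v]; exact l1_add_le _ _

lemma abs_dotProduct_le_l1 {u v : ι → ℝ} {B : ℝ} (h : ∀ k, |u k| ≤ B) : |u ⬝ᵥ v| ≤ B * l1 v := by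
  unfold dotProduct l1
  rw [Finset.mul_sum]
  refine (Finset.abs_sum_le_sum_abs _ _).trans (Finset.sum_le_sum fun k _ => ?_)
  rw [abs_mul]
  exact mul_le_mul_of_nonneg_right (h k) (abs_nonneg _)

lemma sum_abs_le_sqrt_card_mul (T : Finset ι) (v : ι → ℝ) :
    ∑ k ∈ T, |v k| ≤ √(T.card : ℝ) * √(∑ k, v k ^ 2) := by
  rw [← Real.sqrt_mul (by positivity)]
  refine Real.le_sqrt_of_sq_le ?_
  calc (∑ k ∈ T, |v k|) ^ 2 ≤ T.card * ∑ k ∈ T, |v k| ^ 2 := sq_sum_le_card_mul_sum_sq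
    _ ≤ T.card * ∑ k, v k ^ 2 := by
        gcongr
        simp only [sq_abs]
        exact Finset.sum_le_sum_of_subset_of_nonneg (Finset.subset_univ _)
          fun _ _ _ => sq_nonneg _

lemma l1_le_sqrt_card_mul (v : ι → ℝ) : l1 v ≤ √(Fintype.card ι : ℝ) * √(∑ k, v k ^ 2) :=
  sum_abs_le_sqrt_card_mul Finset.univ v

/-- The lasso penalty controls the error off the support of the target. -/
lemma l1_sub_two_mul_le (β₀ v : ι → ℝ) {s : ℝ} (hs : (Nat.card {k // β₀ k ≠ 0} : ℝ) ≤ s) :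
    l1 v - 2 * (√s * √(∑ k, v k ^ 2)) ≤ l1 (β₀ + v) - l1 β₀ := by
  classical
  set T : Finset ι := Finset.univ.filter fun k => β₀ k ≠ 0 with hT
  have hTc : (T.card : ℝ) ≤ s := by
    rwa [Nat.card_eq_fintype_card, Fintype.card_subtype] at hs
  have h1 : ∑ k ∈ T, |v k| ≤ √s * √(∑ k, v k ^ 2) :=
    (sum_abs_le_sqrt_card_mul T v).trans (by gcongr)
  have h2 : l1 v - 2 * ∑ k ∈ T, |v k| ≤ l1 (β₀ + v) - l1 β₀ := by
    unfold l1
    have : ∑ k ∈ T, |v k| = ∑ k, if β₀ k ≠ 0 then |v k| else 0 := by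
      rw [hT, Finset.sum_filter]
    rw [this, Finset.mul_sum, ← Finset.sum_sub_distrib, ← Finset.sum_sub_distrib]
    refine Finset.sum_le_sum fun k _ => ?_
    by_cases hk : β₀ k = 0
    · simp [hk]
    · simp only [ne_eq, hk, not_false_eq_true, if_true, Pi.add_apply]
      have := abs_sub_abs_le_abs_sub (β₀ k) (β₀ k + v k)
      rw [show β₀ k - (β₀ k + v k) = -v k by ring, abs_neg] at this
      linarith
  linarith

/-- Error bounds for one lasso step with curvature `Q`, noise level of order `√(N (ℓ + j))`,
penalty level `2 C √(N ℓ)` and additional error `E`.  When `j` exceeds `ℓ` the noise may dominate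
the penalty, but then the dimension is at most `exp j`. -/
lemma lasso_step (β₀ v : ι → ℝ) {C C₁ N ℓ q₀ ρ₁ s E Q : ℝ} {j : ℕ} (hC₁ : 0 ≤ C₁)
    (hC : 3 * C₁ ≤ C) (hC0 : 0 < C) (hN0 : 0 < N) (hℓ : 1 ≤ ℓ) (hq : 0 < q₀) (hρ : 0 ≤ ρ₁)
    (hs : 1 ≤ s) (hcard : (Nat.card {k // β₀ k ≠ 0} : ℝ) ≤ s)
    (hι : (Fintype.card ι : ℝ) ≤ Real.exp ℓ) (hE : 0 ≤ E) (hQ : 0 ≤ Q)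
    (basic : Q + 2 * C * √(N * ℓ) * (l1 (β₀ + v) - l1 β₀) ≤
      2 * C₁ * √(N * (ℓ + j)) * l1 v + E)
    (re : q₀ * N * ∑ k, v k ^ 2 - ρ₁ * √(N * (ℓ + j)) * l1 v ^ 2 ≤ Q)
    (hN₁ : (288 * ρ₁ / q₀) ^ 2 * Real.exp (4 * j) * s ^ 2 * (ℓ + j) ≤ N)
    (hN₂ : 8 * (ρ₁ * √(N * (ℓ + j))) * E ≤ 4 * C ^ 2 * (N * ℓ)) :
    Q ≤ 2 * E + 3 * (72 * C ^ 2 / q₀ * (Real.exp (2 * j) * s * ℓ)) ∧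
      2 * C * √(N * ℓ) * l1 v ≤ 3 * E + 4 * (72 * C ^ 2 / q₀ * (Real.exp (2 * j) * s * ℓ)) := by
  have hℓ0 : 0 < ℓ := by linarith
  have hs0 : 0 < s := by linarith
  set a₂ := √(∑ k, v k ^ 2) with ha₂
  have ha₂sq : a₂ ^ 2 = ∑ k, v k ^ 2 := Real.sq_sqrt (Finset.sum_nonneg fun _ _ => sq_nonneg _)
  set w := 2 * C * √(N * ℓ) with hw
  have hw0 : 0 < w := by positivity
  have hw2 : w ^ 2 = 4 * C ^ 2 * (N * ℓ) := by
    rw [hw, mul_pow, Real.sq_sqrt (by positivity)]; ring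
  have hv0 := l1_nonneg v
  have hej : (1 : ℝ) ≤ Real.exp (2 * j) := Real.one_le_exp (by positivity)
  obtain ⟨H, hH, hHsq⟩ : ∃ H : ℝ, Q + w / 2 * l1 v ≤ H * a₂ + E ∧
      H ^ 2 ≤ 72 * C ^ 2 * N * (Real.exp (2 * j) * s * ℓ) := by
    -- For j ≤ ℓ the noise is at most half the penalty and the support argument applies. For j > ℓ
    -- there are fewer than exp j coordinates, so comparing ℓ₁ with ℓ₂ over all of them costs only a
    -- factor exponential in j.
    rcases le_or_gt (j : ℝ) ℓ with hjℓ | hjℓ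
    · refine ⟨2 * w * √s, ?_, ?_⟩
      · have hη : 2 * C₁ * √(N * (ℓ + j)) ≤ w / 2 := by
          have : √(N * (ℓ + j)) ≤ 3 / 2 * √(N * ℓ) := by
            rw [Real.sqrt_le_left (by positivity), mul_pow, Real.sq_sqrt (by positivity)]
            have : N * j ≤ N * ℓ := by gcongr
            nlinarith [mul_pos hN0 hℓ0]
          calc 2 * C₁ * √(N * (ℓ + j)) ≤ 2 * C₁ * (3 / 2 * √(N * ℓ)) := by gcongr
            _ = 3 * C₁ * √(N * ℓ) := by ring
            _ ≤ C * √(N * ℓ) := by gcongr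
            _ = w / 2 := by rw [hw]; ring
        have h1 := l1_sub_two_mul_le β₀ v hcard
        have h2 : w * (l1 v - 2 * (√s * a₂)) ≤ w * (l1 (β₀ + v) - l1 β₀) := by gcongr
        have h3 : 2 * C₁ * √(N * (ℓ + j)) * l1 v ≤ w / 2 * l1 v := by gcongr
        linarith
      · rw [mul_pow, mul_pow, Real.sq_sqrt hs0.le, hw2]
        have : C ^ 2 * N * (s * ℓ) ≤ C ^ 2 * N * (Real.exp (2 * j) * s * ℓ) := by
          have : s * ℓ ≤ Real.exp (2 * j) * (s * ℓ) := le_mul_of_one_le_left (by positivity) hej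
          rw [mul_assoc (Real.exp _)]
          gcongr
        nlinarith [show 0 ≤ C ^ 2 * N * (s * ℓ) by positivity]
    · set η := 2 * C₁ * √(N * (ℓ + j)) with hη
      have hη0 : 0 ≤ η := by positivity
      refine ⟨2 * (w + η) * √(Fintype.card ι : ℝ), ?_, ?_⟩
      · have h1 := l1_le_sqrt_card_mul v
        have h2 : -l1 v ≤ l1 (β₀ + v) - l1 β₀ := by
          have := l1_sub_le (β₀ + v) v
          rw [add_sub_cancel_right] at this
          linarith
        have h3 : w * (-l1 v) ≤ w * (l1 (β₀ + v) - l1 β₀) := by gcongr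
        have h4 : 2 * (w + η) * l1 v ≤ 2 * (w + η) * (√(Fintype.card ι : ℝ) * a₂) := by gcongr
        nlinarith [mul_nonneg hw0.le hv0, mul_nonneg hη0 hv0]
      · have hr : √(N * ℓ) ≤ √(N * (ℓ + j)) := by
          gcongr
          linarith [Nat.cast_nonneg (α := ℝ) j]
        have hwη : w + η ≤ 3 * C * √(N * (ℓ + j)) := by
          have : w ≤ 2 * C * √(N * (ℓ + j)) := by rw [hw]; gcongr
          have : η ≤ C * √(N * (ℓ + j)) := by rw [hη]; gcongr; linarith
          linarith
        have hwη2 : (w + η) ^ 2 ≤ 9 * C ^ 2 * (N * (ℓ + j)) := by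
          calc (w + η) ^ 2 ≤ (3 * C * √(N * (ℓ + j))) ^ 2 := by gcongr
            _ = _ := by rw [mul_pow, Real.sq_sqrt (by positivity)]; ring
        have hcj : (Fintype.card ι : ℝ) ≤ Real.exp j := hι.trans (Real.exp_le_exp.2 hjℓ.le)
        have hjj : (j : ℝ) ≤ Real.exp j := by
          have := Real.add_one_le_exp (j : ℝ); linarith
        rw [mul_pow, mul_pow, Real.sq_sqrt (by positivity)]
        have hsl : 1 ≤ s * ℓ := one_le_mul_of_one_le_of_one_le hs hℓ
        calc 2 ^ 2 * (w + η) ^ 2 * (Fintype.card ι : ℝ)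
            ≤ 2 ^ 2 * (9 * C ^ 2 * (N * (ℓ + j))) * Real.exp j := by gcongr
          _ ≤ 2 ^ 2 * (9 * C ^ 2 * (N * (Real.exp j + Real.exp j))) * Real.exp j := by
              gcongr; linarith
          _ = 72 * C ^ 2 * N * (Real.exp (2 * j) * 1) := by
              rw [two_mul (j : ℝ), Real.exp_add]; ring
          _ ≤ 72 * C ^ 2 * N * (Real.exp (2 * j) * (s * ℓ)) := by gcongr
          _ = _ := by ring
  -- The constant 288 is 16 · 72 / 4, with 72 from the bound on H² and 4 from w².
  have h₃ : 16 * (ρ₁ * √(N * (ℓ + j))) * H ^ 2 ≤ q₀ * N * w ^ 2 := by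
    have hk : 288 * ρ₁ * √(N * (ℓ + j)) * (Real.exp (2 * j) * s) ≤ q₀ * N := by
      have hT : (288 * ρ₁ / q₀ * Real.exp (2 * j) * s) ^ 2 * (ℓ + j) ≤ N := by
        refine le_trans (le_of_eq ?_) hN₁
        rw [mul_pow, mul_pow, ← Real.exp_nat_mul]
        congr 4
        push_cast; ring
      have h1 : 288 * ρ₁ / q₀ * Real.exp (2 * j) * s * √(N * (ℓ + j)) ≤ N := by
        rw [← Real.sqrt_sq (show 0 ≤ 288 * ρ₁ / q₀ * Real.exp (2 * j) * s by positivity),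
          ← Real.sqrt_mul (sq_nonneg _)]
        rw [Real.sqrt_le_left hN0.le]
        calc (288 * ρ₁ / q₀ * Real.exp (2 * j) * s) ^ 2 * (N * (ℓ + j))
            = (288 * ρ₁ / q₀ * Real.exp (2 * j) * s) ^ 2 * (ℓ + j) * N := by ring
          _ ≤ N * N := by gcongr
          _ = N ^ 2 := by ring
      calc 288 * ρ₁ * √(N * (ℓ + j)) * (Real.exp (2 * j) * s)
          = q₀ * (288 * ρ₁ / q₀ * Real.exp (2 * j) * s * √(N * (ℓ + j))) := by field_simp
        _ ≤ q₀ * N := by gcongr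
    calc 16 * (ρ₁ * √(N * (ℓ + j))) * H ^ 2
        ≤ 16 * (ρ₁ * √(N * (ℓ + j))) * (72 * C ^ 2 * N * (Real.exp (2 * j) * s * ℓ)) := by gcongr
      _ = 4 * C ^ 2 * (N * ℓ) * (288 * ρ₁ * √(N * (ℓ + j)) * (Real.exp (2 * j) * s)) := by ring
      _ ≤ 4 * C ^ 2 * (N * ℓ) * (q₀ * N) := by gcongr
      _ = q₀ * N * w ^ 2 := by rw [hw2]; ring
  have hmain := lasso_bounds_of_curvature hv0 hw0
    (mul_pos hq hN0) hE (by positivity : 0 ≤ ρ₁ * √(N * (ℓ + j))) hQ hH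
    (by rw [ha₂sq]; exact re) h₃ (by rw [hw2]; exact hN₂)
  have hHq : H ^ 2 / (q₀ * N) ≤ 72 * C ^ 2 / q₀ * (Real.exp (2 * j) * s * ℓ) := by
    rw [div_le_iff₀ (mul_pos hq hN0)]
    refine hHsq.trans (le_of_eq ?_)
    field_simp
  exact ⟨by linarith [hmain.1], by linarith [hmain.2]⟩

end LassoStep

/-! ### Vectors with a prescribed r-th entry. -/

section Extend

variable {p : ℕ} {r : Fin p}

/-- The vector with `r`-th entry `c` and the other entries given by `γ`. -/
def extend (r : Fin p) (c : ℝ) (γ : {k // k ≠ r} → ℝ) (k : Fin p) : ℝ :=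
  if h : k = r then c else γ ⟨k, h⟩

@[simp] lemma extend_self (c : ℝ) (γ : {k // k ≠ r} → ℝ) : extend r c γ r = c := by
  simp [extend]

@[simp] lemma extend_ne (c : ℝ) (γ : {k // k ≠ r} → ℝ) (k : {k // k ≠ r}) :
    extend r c γ k.1 = γ k := by
  simp [extend, k.2]

lemma dotProduct_extend (x : Fin p → ℝ) (c : ℝ) (γ : {k // k ≠ r} → ℝ) :
    x ⬝ᵥ extend r c γ = c * x r + ∑ k : {k // k ≠ r}, x k.1 * γ k := by
  unfold dotProduct
  rw [Fintype.sum_eq_add_sum_subtype_ne _ r]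
  simp [mul_comm]

lemma extend_add (c c' : ℝ) (γ γ' : {k // k ≠ r} → ℝ) :
    extend r (c + c') (γ + γ') = extend r c γ + extend r c' γ' := by
  funext k
  by_cases h : k = r <;> simp [extend, h]

lemma l1_extend (c : ℝ) (γ : {k // k ≠ r} → ℝ) : l1 (extend r c γ) = |c| + l1 γ := by
  unfold l1
  rw [Fintype.sum_eq_add_sum_subtype_ne _ r]
  simp

lemma sum_sq_extend (c : ℝ) (γ : {k // k ≠ r} → ℝ) :
    ∑ k, extend r c γ k ^ 2 = c ^ 2 + ∑ k, γ k ^ 2 := by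
  rw [Fintype.sum_eq_add_sum_subtype_ne _ r]
  simp

/-- This turns the projection problem into a quadratic form of the full matrix on the slice where
coordinate r is -1. Symmetry merges the two cross terms. -/
lemma projQuad_eq_extend {M : Matrix (Fin p) (Fin p) ℝ} (hM : M.IsSymm) (γ : {k // k ≠ r} → ℝ) :
    projQuad M r γ = extend r (-1) γ ⬝ᵥ (M *ᵥ extend r (-1) γ) := by
  have h1 : ∀ k, (M *ᵥ extend r (-1) γ) k = -M k r + ∑ l : {k // k ≠ r}, M k l.1 * γ l := by
    intro k
    have := dotProduct_extend (r := r) (M k) (-1) γ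
    simpa [Matrix.mulVec] using this
  rw [dotProduct_comm, dotProduct_extend]
  simp only [h1]
  unfold projQuad
  have h2 : ∑ k : {k // k ≠ r}, (-M k.1 r + ∑ l : {k // k ≠ r}, M k.1 l.1 * γ l) * γ k =
      -∑ k : {k // k ≠ r}, M r k.1 * γ k +
        ∑ k : {k // k ≠ r}, ∑ l : {k // k ≠ r}, γ k * M k.1 l.1 * γ l := by
    rw [← Finset.sum_neg_distrib, ← Finset.sum_add_distrib]
    refine Finset.sum_congr rfl fun k _ => ?_
    rw [add_mul, Finset.sum_mul, hM.apply]
    congr 1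
    · ring
    · exact Finset.sum_congr rfl fun l _ => by ring
  rw [h2]
  ring

end Extend

/-! ### Bookkeeping over batches and convexity of the lasso objective. -/

namespace Stream

variable {Ω : Type*} (S : Stream Ω) (G : GLM)

lemma N_zero : S.N 0 = 0 := by simp [N]

lemma N_succ (j : ℕ) : S.N (j + 1) = S.N j + S.n (j + 1) := by
  simp [N, Finset.sum_Icc_succ_top]

lemma N_mono : Monotone S.N :=
  monotone_nat_of_le_succ fun j => by rw [N_succ]; exact Nat.le_add_right _ _

/-- Truncated subtraction is harmless at j = 0, where the batch is empty. -/
lemma sum_range_N_eq {j : ℕ} (f : ℕ → ℝ) :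
    ∑ i ∈ Finset.range (S.N j), f i =
      ∑ i ∈ Finset.range (S.N (j - 1)), f i + ∑ i ∈ S.batch j, f i :=
  (Finset.sum_range_add_sum_Ico f (S.N_mono (Nat.sub_le j 1))).symm

lemma sum_batches (j : ℕ) (f : ℕ → ℝ) :
    ∑ l ∈ Finset.Icc 1 j, ∑ i ∈ S.batch l, f i = ∑ i ∈ Finset.range (S.N j), f i := by
  induction j with
  | zero => simp [N_zero]
  | succ j ih =>
    rw [Finset.sum_Icc_succ_top (by omega), ih, S.sum_range_N_eq (j := j + 1)]
    simp

lemma lt_N_of_mem_batch {i j : ℕ} (hi : i ∈ S.batch j) (hj : j ≤ S.b) : i < S.N S.b :=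
  (Finset.mem_Ico.1 hi).2.trans_le (S.N_mono hj)

lemma dotProduct_J_mulVec (j : ℕ) (β u v : Fin S.p → ℝ) (ω : Ω) :
    u ⬝ᵥ (S.J G j β ω *ᵥ v) =
      ∑ i ∈ S.batch j, deriv G.g (S.x i ω ⬝ᵥ β) * (S.x i ω ⬝ᵥ u) * (S.x i ω ⬝ᵥ v) := by
  simp only [J, dotProduct, Matrix.mulVec, Matrix.of_apply, Finset.sum_mul, Finset.mul_sum]
  rw [Finset.sum_congr rfl fun k _ => Finset.sum_comm, Finset.sum_comm]
  refine Finset.sum_congr rfl fun i _ => ?_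
  rw [Finset.sum_comm]
  refine Finset.sum_congr rfl fun k _ => ?_
  refine Finset.sum_congr rfl fun l _ => ?_
  ring

lemma J_isSymm (j : ℕ) (β : Fin S.p → ℝ) (ω : Ω) : (S.J G j β ω).IsSymm := by
  ext k l
  simp only [J, Matrix.transpose_apply, Matrix.of_apply]
  exact Finset.sum_congr rfl fun i _ => by ring

lemma Jtilde_isSymm (j : ℕ) (ω : Ω) : (S.Jtilde G j ω).IsSymm := by
  unfold Jtilde Matrix.IsSymm
  rw [Matrix.transpose_sum]
  exact Finset.sum_congr rfl fun i _ => S.J_isSymm G i _ ω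

lemma dotProduct_Jtilde_mulVec (j : ℕ) (u v : Fin S.p → ℝ) (ω : Ω) :
    u ⬝ᵥ (S.Jtilde G j ω *ᵥ v) = ∑ l ∈ Finset.Icc 1 j, ∑ i ∈ S.batch l,
      deriv G.g (S.x i ω ⬝ᵥ S.βhat l ω) * (S.x i ω ⬝ᵥ u) * (S.x i ω ⬝ᵥ v) := by
  unfold Jtilde
  rw [Matrix.sum_mulVec, dotProduct_sum]
  exact Finset.sum_congr rfl fun l _ => S.dotProduct_J_mulVec G l _ u v ω

lemma γtilde_eq_extend (j : ℕ) (ω : Ω) : S.γtilde j ω = extend S.r (-1) (S.γhat j ω) := rfl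

lemma zhat_eq (j i : ℕ) (ω : Ω) : S.zhat j i ω = -(S.x i ω ⬝ᵥ S.γtilde j ω) := by
  rw [γtilde_eq_extend, dotProduct_extend]
  unfold zhat
  ring

lemma Jtilde_mulVec_γtilde_self (j : ℕ) (ω : Ω) :
    (S.Jtilde G j ω *ᵥ S.γtilde j ω) S.r = -S.τhat G j ω := by
  have := dotProduct_extend (r := S.r) (S.Jtilde G j ω S.r) (-1) (S.γhat j ω)
  rw [γtilde_eq_extend]
  unfold τhat
  simp only [Matrix.mulVec]
  rw [this]
  ring

/-- Multiplication by 2 N_j puts the penalty on the scale √(N_j log p), comparable with the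
deviation bounds. -/
lemma two_mul_N_mul_lam {j : ℕ} (hN : 0 < S.N j) (C : ℝ) :
    2 * (S.N j : ℝ) * S.lam C j = 2 * C * √(S.N j * Real.log S.p) := by
  have hN' : (0 : ℝ) < S.N j := by exact_mod_cast hN
  unfold lam
  have : √((S.N j : ℝ) * Real.log S.p) = S.N j * √(Real.log S.p / S.N j) := by
    rw [show (S.N j : ℝ) * Real.log S.p = (S.N j : ℝ) ^ 2 * (Real.log S.p / S.N j) by field_simp,
      Real.sqrt_mul (sq_nonneg _), Real.sqrt_sq hN'.le]
  rw [this]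
  ring

/-- Comparison of two values of a penalized objective, after multiplication by `2 N_j`. -/
lemma sub_add_penalty_le {j : ℕ} (hN : 0 < S.N j) {C a b c d : ℝ}
    (h : 1 / (2 * (S.N j : ℝ)) * a + S.lam C j * b ≤ 1 / (2 * (S.N j : ℝ)) * c + S.lam C j * d) :
    a - c + 2 * C * √(S.N j * Real.log S.p) * (b - d) ≤ 0 := by
  have hN' : (0 : ℝ) < S.N j := by exact_mod_cast hN
  rw [← S.two_mul_N_mul_lam hN]
  have := mul_le_mul_of_nonneg_left h (by positivity : (0 : ℝ) ≤ 2 * S.N j)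
  have e : ∀ a : ℝ, 2 * (S.N j : ℝ) * (1 / (2 * (S.N j : ℝ)) * a) = a := by
    intro a; field_simp
  rw [mul_add, mul_add, e, e] at this
  linarith

/-- Convexity of the lasso objective: a minimizer is at least as good as the target on the whole
segment between them. -/
lemma lassoObjective_segment_le {C : ℝ} (hC : 0 ≤ C) {j : ℕ} {ω : Ω} {θ : ℝ} (h0 : 0 ≤ θ)
    (h1 : θ ≤ 1) (hmin : IsMinOn (S.lassoObjective G C j ω) Set.univ (S.βhat j ω)) :
    S.lassoObjective G C j ω (S.β₀ + θ • (S.βhat j ω - S.β₀)) ≤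
      S.lassoObjective G C j ω S.β₀ := by
  set β := S.βhat j ω with hβ
  have hconv : S.lassoObjective G C j ω (S.β₀ + θ • (β - S.β₀)) ≤
      (1 - θ) * S.lassoObjective G C j ω S.β₀ + θ * S.lassoObjective G C j ω β := by
    unfold lassoObjective
    simp only [dotProduct_Jtilde_mulVec]
    have t1 : ∑ i ∈ S.batch j, G.d (S.y i ω) (G.g (S.x i ω ⬝ᵥ (S.β₀ + θ • (β - S.β₀)))) ≤
        (1 - θ) * ∑ i ∈ S.batch j, G.d (S.y i ω) (G.g (S.x i ω ⬝ᵥ S.β₀)) +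
          θ * ∑ i ∈ S.batch j, G.d (S.y i ω) (G.g (S.x i ω ⬝ᵥ β)) := by
      rw [Finset.mul_sum, Finset.mul_sum, ← Finset.sum_add_distrib]
      refine Finset.sum_le_sum fun i _ => ?_
      have e1 := G.d_sub_d (S.y i ω) 0 (S.x i ω ⬝ᵥ (S.β₀ + θ • (β - S.β₀)))
      have e2 := G.d_sub_d (S.y i ω) 0 (S.x i ω ⬝ᵥ S.β₀)
      have e3 := G.d_sub_d (S.y i ω) 0 (S.x i ω ⬝ᵥ β)
      have e4 : S.x i ω ⬝ᵥ (S.β₀ + θ • (β - S.β₀)) =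
          (1 - θ) * (S.x i ω ⬝ᵥ S.β₀) + θ * (S.x i ω ⬝ᵥ β) := by
        rw [dotProduct_add, dotProduct_smul, dotProduct_sub, smul_eq_mul]; ring
      have e5 := G.convexOn_cumulant.2 (Set.mem_univ (S.x i ω ⬝ᵥ S.β₀))
        (Set.mem_univ (S.x i ω ⬝ᵥ β)) (sub_nonneg.2 h1) h0 (by ring)
      simp only [smul_eq_mul] at e5
      rw [← e4] at e5
      rw [e4] at e1 e5 ⊢
      nlinarith
    have t2 : ∑ l ∈ Finset.Icc 1 (j - 1), ∑ i ∈ S.batch l,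
          deriv G.g (S.x i ω ⬝ᵥ S.βhat l ω) *
            (S.x i ω ⬝ᵥ (S.β₀ + θ • (β - S.β₀) - S.βhat (j - 1) ω)) *
            (S.x i ω ⬝ᵥ (S.β₀ + θ • (β - S.β₀) - S.βhat (j - 1) ω)) ≤
        (1 - θ) * (∑ l ∈ Finset.Icc 1 (j - 1), ∑ i ∈ S.batch l,
          deriv G.g (S.x i ω ⬝ᵥ S.βhat l ω) * (S.x i ω ⬝ᵥ (S.β₀ - S.βhat (j - 1) ω)) *
            (S.x i ω ⬝ᵥ (S.β₀ - S.βhat (j - 1) ω))) +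
        θ * (∑ l ∈ Finset.Icc 1 (j - 1), ∑ i ∈ S.batch l,
          deriv G.g (S.x i ω ⬝ᵥ S.βhat l ω) * (S.x i ω ⬝ᵥ (β - S.βhat (j - 1) ω)) *
            (S.x i ω ⬝ᵥ (β - S.βhat (j - 1) ω))) := by
      simp only [Finset.mul_sum]
      rw [← Finset.sum_add_distrib]
      refine Finset.sum_le_sum fun l _ => ?_
      rw [← Finset.sum_add_distrib]
      refine Finset.sum_le_sum fun i _ => ?_
      -- Monotonicity of g makes the weights of the past nonnegative even where an estimate might
      -- leave the region of regularity.
      have hg := G.deriv_g_nonneg (S.x i ω ⬝ᵥ S.βhat l ω)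
      set c := deriv G.g (S.x i ω ⬝ᵥ S.βhat l ω)
      have e4 : S.x i ω ⬝ᵥ (S.β₀ + θ • (β - S.β₀) - S.βhat (j - 1) ω) =
          (1 - θ) * (S.x i ω ⬝ᵥ (S.β₀ - S.βhat (j - 1) ω)) +
            θ * (S.x i ω ⬝ᵥ (β - S.βhat (j - 1) ω)) := by
        simp only [dotProduct_add, dotProduct_smul, dotProduct_sub, smul_eq_mul]; ring
      rw [e4]
      set a := S.x i ω ⬝ᵥ (S.β₀ - S.βhat (j - 1) ω)
      set a' := S.x i ω ⬝ᵥ (β - S.βhat (j - 1) ω)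
      have hk : 0 ≤ c * (θ * (1 - θ)) * (a - a') ^ 2 :=
        mul_nonneg (mul_nonneg hg (mul_nonneg h0 (sub_nonneg.2 h1))) (sq_nonneg _)
      linear_combination hk
    have t3 : l1 (S.β₀ + θ • (β - S.β₀)) ≤ (1 - θ) * l1 S.β₀ + θ * l1 β := by
      have : S.β₀ + θ • (β - S.β₀) = (1 - θ) • S.β₀ + θ • β := by
        rw [smul_sub, sub_smul, one_smul]; abel
      rw [this]
      refine (l1_add_le _ _).trans ?_
      rw [l1_smul, l1_smul, abs_of_nonneg h0, abs_of_nonneg (sub_nonneg.2 h1)]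
    have hl : 0 ≤ S.lam C j := mul_nonneg hC (Real.sqrt_nonneg _)
    have hn : (0 : ℝ) ≤ 1 / (2 * (S.N j : ℝ)) := by positivity
    have t3' := mul_le_mul_of_nonneg_left t3 hl
    have t12 := mul_le_mul_of_nonneg_left
      (add_le_add t1 (mul_le_mul_of_nonneg_left t2 (by norm_num : (0 : ℝ) ≤ 1 / 2))) hn
    linarith
  have hm : S.lassoObjective G C j ω β ≤ S.lassoObjective G C j ω S.β₀ := hmin (Set.mem_univ _)
  nlinarith [mul_le_mul_of_nonneg_left hm h0]

end Stream

/-! ### Good outcomes: restricted curvature and the basic inequality. -/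

namespace Stream

variable {Ω : Type*} (S : Stream Ω) (G : GLM)

/-- The properties of an outcome `ω` used in the error analysis: the pointwise regularity
conditions, the concentration bounds for the score, the information matrix `Jpop` and the
projection residuals, and the minimality of the estimators. -/
structure GoodOutcome (Jpop : Matrix (Fin S.p) (Fin S.p) ℝ) (K M L δ K₂ K₃ C C₁ : ℝ)
    (ω : Ω) : Prop where
  bounded_x : ∀ i < S.N S.b, ∀ k, |S.x i ω k| ≤ K
  bounded_projection : ∀ i < S.N S.b, |∑ k : {k // k ≠ S.r}, S.x i ω k.1 * S.γ₀ k| ≤ M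
  lipschitz : ∀ i < S.N S.b, ∀ β β' : Fin S.p → ℝ,
    l1 (β - S.β₀) ≤ δ → l1 (β' - S.β₀) ≤ δ →
      |deriv G.g (S.x i ω ⬝ᵥ β) - deriv G.g (S.x i ω ⬝ᵥ β')| ≤
        L * |S.x i ω ⬝ᵥ β - S.x i ω ⬝ᵥ β'|
  deriv_le : ∀ i < S.N S.b, ∀ β : Fin S.p → ℝ, l1 (β - S.β₀) ≤ δ →
    deriv G.g (S.x i ω ⬝ᵥ β) ≤ K₂
  le_deriv : ∀ i < S.N S.b, ∀ β : Fin S.p → ℝ, l1 (β - S.β₀) ≤ δ →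
    1 / K₃ ≤ deriv G.g (S.x i ω ⬝ᵥ β)
  score : ∀ j ∈ Finset.Icc 1 S.b, ∀ k,
    |∑ i ∈ S.batch j, (S.y i ω - G.g (S.x i ω ⬝ᵥ S.β₀)) * S.x i ω k| ≤
      C₁ * √(S.N j * (Real.log S.p + j))
  info : ∀ j ∈ Finset.Icc 1 S.b, ∀ k l,
    |∑ i ∈ Finset.range (S.N j), (deriv G.g (S.x i ω ⬝ᵥ S.β₀) * S.x i ω k * S.x i ω l -
      Jpop k l)| ≤ C₁ * √(S.N j * (Real.log S.p + j))
  resid : ∀ j ∈ Finset.Icc 1 S.b, ∀ k ≠ S.r,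
    |∑ i ∈ Finset.range (S.N j), deriv G.g (S.x i ω ⬝ᵥ S.β₀) * S.x i ω k *
      (S.x i ω ⬝ᵥ extend S.r (-1) S.γ₀)| ≤ C₁ * √(S.N j * (Real.log S.p + j))
  lasso : ∀ j ∈ Finset.Icc 1 S.b, IsMinOn (S.lassoObjective G C j ω) Set.univ (S.βhat j ω)
  proj : ∀ j ∈ Finset.Icc 1 S.b, IsMinOn (S.projObjective G C j ω) Set.univ (S.γhat j ω)

variable {S G} {Jpop : Matrix (Fin S.p) (Fin S.p) ℝ} {K M L δ κ K₂ K₃ C C₁ : ℝ} {ω : Ω}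

namespace GoodOutcome

/-- Restricted strong convexity of the empirical second moment. -/
lemma restricted_eigenvalue (h : S.GoodOutcome G Jpop K M L δ K₂ K₃ C C₁ ω) (hδ : 0 ≤ δ)
    (hκ : ∀ u : Fin S.p → ℝ, κ * ∑ k, u k ^ 2 ≤ u ⬝ᵥ (Jpop *ᵥ u))
    {j : ℕ} (hj : j ∈ Finset.Icc 1 S.b) (u : Fin S.p → ℝ) :
    κ * S.N j * ∑ k, u k ^ 2 - C₁ * √(S.N j * (Real.log S.p + j)) * l1 u ^ 2 ≤
      K₂ * ∑ i ∈ Finset.range (S.N j), (S.x i ω ⬝ᵥ u) ^ 2 := by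
  have hjb := (Finset.mem_Icc.1 hj).2
  set ρ := C₁ * √(S.N j * (Real.log S.p + j)) with hρ
  set D : Fin S.p → Fin S.p → ℝ := fun k l => ∑ i ∈ Finset.range (S.N j),
    (deriv G.g (S.x i ω ⬝ᵥ S.β₀) * S.x i ω k * S.x i ω l - Jpop k l) with hD
  have e1 : ∑ k, ∑ l, u k * D k l * u l =
      ∑ i ∈ Finset.range (S.N j), deriv G.g (S.x i ω ⬝ᵥ S.β₀) * (S.x i ω ⬝ᵥ u) ^ 2 -
        S.N j * (u ⬝ᵥ (Jpop *ᵥ u)) := by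
    have f1 : ∀ i, deriv G.g (S.x i ω ⬝ᵥ S.β₀) * (S.x i ω ⬝ᵥ u) ^ 2 -
        u ⬝ᵥ (Jpop *ᵥ u) = ∑ k, ∑ l, u k *
          (deriv G.g (S.x i ω ⬝ᵥ S.β₀) * S.x i ω k * S.x i ω l - Jpop k l) * u l := by
      intro i
      have g1 : ∑ k, ∑ l, u k * (deriv G.g (S.x i ω ⬝ᵥ S.β₀) * S.x i ω k * S.x i ω l -
          Jpop k l) * u l = ∑ k, ∑ l, deriv G.g (S.x i ω ⬝ᵥ S.β₀) * ((S.x i ω k * u k) *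
            (S.x i ω l * u l)) - ∑ k, u k * ∑ l, Jpop k l * u l := by
        rw [← Finset.sum_sub_distrib]
        refine Finset.sum_congr rfl fun k _ => ?_
        rw [Finset.mul_sum, ← Finset.sum_sub_distrib]
        exact Finset.sum_congr rfl fun l _ => by ring
      rw [g1]
      congr 1
      generalize deriv G.g (S.x i ω ⬝ᵥ S.β₀) = c
      rw [sq, dotProduct, Finset.sum_mul_sum, Finset.mul_sum]
      exact Finset.sum_congr rfl fun k _ => Finset.mul_sum _ _ _
    have f2 : (S.N j : ℝ) * (u ⬝ᵥ (Jpop *ᵥ u)) =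
        ∑ _i ∈ Finset.range (S.N j), u ⬝ᵥ (Jpop *ᵥ u) := by simp
    rw [f2, ← Finset.sum_sub_distrib, Finset.sum_congr rfl fun i _ => f1 i]
    refine Eq.trans (Finset.sum_congr rfl fun k _ => ?_) Finset.sum_comm
    refine Eq.trans ?_ Finset.sum_comm
    refine Finset.sum_congr rfl fun l _ => ?_
    rw [hD, Finset.mul_sum, Finset.sum_mul]
  have e2 : |∑ k, ∑ l, u k * D k l * u l| ≤ ρ * l1 u ^ 2 := by
    calc |∑ k, ∑ l, u k * D k l * u l| ≤ ∑ k, ∑ l, |u k * D k l * u l| :=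
          (Finset.abs_sum_le_sum_abs _ _).trans
            (Finset.sum_le_sum fun k _ => Finset.abs_sum_le_sum_abs _ _)
      _ ≤ ∑ k, ∑ l, ρ * (|u k| * |u l|) := by
          refine Finset.sum_le_sum fun k _ => Finset.sum_le_sum fun l _ => ?_
          rw [abs_mul, abs_mul]
          have := h.info j hj k l
          calc |u k| * |D k l| * |u l| ≤ |u k| * ρ * |u l| := by gcongr
            _ = ρ * (|u k| * |u l|) := by ring
      _ = ρ * l1 u ^ 2 := by
          rw [sq, l1, Finset.sum_mul_sum, Finset.mul_sum]
          exact Finset.sum_congr rfl fun k _ => (Finset.mul_sum _ _ _).symm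
  have e3 : ∑ i ∈ Finset.range (S.N j), deriv G.g (S.x i ω ⬝ᵥ S.β₀) * (S.x i ω ⬝ᵥ u) ^ 2 ≤
      K₂ * ∑ i ∈ Finset.range (S.N j), (S.x i ω ⬝ᵥ u) ^ 2 := by
    rw [Finset.mul_sum]
    refine Finset.sum_le_sum fun i hi => mul_le_mul_of_nonneg_right ?_ (sq_nonneg _)
    refine h.deriv_le i ((Finset.mem_range.1 hi).trans_le (S.N_mono hjb)) S.β₀ ?_
    simpa [l1] using hδ
  have e4 : κ * S.N j * ∑ k, u k ^ 2 ≤ S.N j * (u ⬝ᵥ (Jpop *ᵥ u)) := by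
    rw [mul_comm κ, mul_assoc]
    exact mul_le_mul_of_nonneg_left (hκ u) (Nat.cast_nonneg _)
  have := neg_le_of_abs_le e2
  linarith

lemma abs_score_dotProduct_le (h : S.GoodOutcome G Jpop K M L δ K₂ K₃ C C₁ ω) {j : ℕ}
    (hj : j ∈ Finset.Icc 1 S.b) (v : Fin S.p → ℝ) :
    |∑ i ∈ S.batch j, (S.y i ω - G.g (S.x i ω ⬝ᵥ S.β₀)) * (S.x i ω ⬝ᵥ v)| ≤
      C₁ * √(S.N j * (Real.log S.p + j)) * l1 v := by
  have e : ∑ i ∈ S.batch j, (S.y i ω - G.g (S.x i ω ⬝ᵥ S.β₀)) * (S.x i ω ⬝ᵥ v) =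
      (fun k => ∑ i ∈ S.batch j, (S.y i ω - G.g (S.x i ω ⬝ᵥ S.β₀)) * S.x i ω k) ⬝ᵥ v := by
    simp only [dotProduct, Finset.mul_sum, Finset.sum_mul]
    rw [Finset.sum_comm]
    exact Finset.sum_congr rfl fun k _ => Finset.sum_congr rfl fun i _ => by ring
  rw [e]
  exact abs_dotProduct_le_l1 (h.score j hj)

lemma l1_segment_le {β₀ v : Fin S.p → ℝ} {θ : ℝ} (hθ : θ ∈ Set.Icc (0 : ℝ) 1) (hv : l1 v ≤ δ) :
    l1 (β₀ + θ • v - β₀) ≤ δ := by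
  rw [add_sub_cancel_left, l1_smul, abs_of_nonneg hθ.1]
  exact (mul_le_of_le_one_left (l1_nonneg v) hθ.2).trans hv

/-- Basic inequality of the online lasso at a point of the segment between the target and the
estimator which is close to the target. -/
lemma lasso_basic (h : S.GoodOutcome G Jpop K M L δ K₂ K₃ C C₁ ω) (hC : 0 ≤ C) (hK₃ : 0 < K₃)
    {j : ℕ} (hj : j ∈ Finset.Icc 1 S.b) (hN : 0 < S.N j)
    (hprev : ∀ l ∈ Finset.Icc 1 (j - 1), l1 (S.βhat l ω - S.β₀) ≤ δ)
    {θ : ℝ} (h0 : 0 ≤ θ) (h1 : θ ≤ 1) {v : Fin S.p → ℝ} (hv : v = θ • (S.βhat j ω - S.β₀))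
    (hvδ : l1 v ≤ δ) :
    1 / (4 * K₃) * ∑ i ∈ Finset.range (S.N j), (S.x i ω ⬝ᵥ v) ^ 2 +
        2 * C * √(S.N j * Real.log S.p) * (l1 (S.β₀ + v) - l1 S.β₀) ≤
      C₁ * √(S.N j * (Real.log S.p + j)) * l1 v +
        K₂ * ∑ i ∈ Finset.range (S.N (j - 1)), (S.x i ω ⬝ᵥ (S.βhat (j - 1) ω - S.β₀)) ^ 2 := by
  have hjb := (Finset.mem_Icc.1 hj).2
  have hseg := S.lassoObjective_segment_le G hC h0 h1 (h.lasso j hj)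
  rw [← hv] at hseg
  unfold lassoObjective at hseg
  simp only [dotProduct_Jtilde_mulVec] at hseg
  have hmain := S.sub_add_penalty_le hN hseg
  have hfit : 1 / (4 * K₃) * ∑ i ∈ S.batch j, (S.x i ω ⬝ᵥ v) ^ 2 -
      ∑ i ∈ S.batch j, (S.y i ω - G.g (S.x i ω ⬝ᵥ S.β₀)) * (S.x i ω ⬝ᵥ v) ≤
      ∑ i ∈ S.batch j, G.d (S.y i ω) (G.g (S.x i ω ⬝ᵥ (S.β₀ + v))) -
        ∑ i ∈ S.batch j, G.d (S.y i ω) (G.g (S.x i ω ⬝ᵥ S.β₀)) := by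
    rw [Finset.mul_sum, ← Finset.sum_sub_distrib, ← Finset.sum_sub_distrib]
    refine Finset.sum_le_sum fun i hi => ?_
    rw [G.d_sub_d, dotProduct_add]
    have hb := G.le_cumulant_bregman (η := S.x i ω ⬝ᵥ S.β₀) (t := S.x i ω ⬝ᵥ v) (m := 1 / K₃)
      (fun θ' hθ' => by
        have := h.le_deriv i (S.lt_N_of_mem_batch hi hjb) (S.β₀ + θ' • v)
          (l1_segment_le hθ' hvδ)
        rwa [dotProduct_add, dotProduct_smul, smul_eq_mul] at this)
    -- The new batch has curvature 1 / (2 K₃); half of it is given up to match what survives for the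
    -- past batches.
    have hc : 1 / (4 * K₃) * (S.x i ω ⬝ᵥ v) ^ 2 ≤ 1 / K₃ / 2 * (S.x i ω ⬝ᵥ v) ^ 2 := by
      refine mul_le_mul_of_nonneg_right ?_ (sq_nonneg _)
      rw [div_div]
      exact one_div_le_one_div_of_le (by positivity) (by linarith)
    linarith
  -- With a the increment v and e the previous error, both seen through x_i, one has (a - e)² - e² ≥
  -- a² / 2 - 2 e². The surrogate thus keeps curvature in a, at the price of the previous prediction
  -- error.
  have hquad : 1 / (4 * K₃) * ∑ i ∈ Finset.range (S.N (j - 1)), (S.x i ω ⬝ᵥ v) ^ 2 -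
      K₂ * ∑ i ∈ Finset.range (S.N (j - 1)), (S.x i ω ⬝ᵥ (S.βhat (j - 1) ω - S.β₀)) ^ 2 ≤
      1 / 2 * (∑ l ∈ Finset.Icc 1 (j - 1), ∑ i ∈ S.batch l,
          deriv G.g (S.x i ω ⬝ᵥ S.βhat l ω) * (S.x i ω ⬝ᵥ (S.β₀ + v - S.βhat (j - 1) ω)) *
            (S.x i ω ⬝ᵥ (S.β₀ + v - S.βhat (j - 1) ω))) -
      1 / 2 * (∑ l ∈ Finset.Icc 1 (j - 1), ∑ i ∈ S.batch l,
          deriv G.g (S.x i ω ⬝ᵥ S.βhat l ω) * (S.x i ω ⬝ᵥ (S.β₀ - S.βhat (j - 1) ω)) *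
            (S.x i ω ⬝ᵥ (S.β₀ - S.βhat (j - 1) ω))) := by
    rw [← S.sum_batches, ← S.sum_batches]
    simp only [Finset.mul_sum, ← Finset.sum_sub_distrib]
    refine Finset.sum_le_sum fun l hl => Finset.sum_le_sum fun i hi => ?_
    have hlb : l ≤ S.b := by
      have := (Finset.mem_Icc.1 hl).2
      omega
    have g1 := h.deriv_le i (S.lt_N_of_mem_batch hi hlb) _ (hprev l hl)
    have g2 := h.le_deriv i (S.lt_N_of_mem_batch hi hlb) _ (hprev l hl)
    simp only [dotProduct_add, dotProduct_sub]
    set c := deriv G.g (S.x i ω ⬝ᵥ S.βhat l ω)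
    set a := S.x i ω ⬝ᵥ v
    set e := S.x i ω ⬝ᵥ S.βhat (j - 1) ω - S.x i ω ⬝ᵥ S.β₀ with he
    have hc : 1 / (4 * K₃) ≤ c / 4 := by
      have : 1 / (4 * K₃) = 1 / K₃ / 4 := by rw [div_div, mul_comm]
      rw [this]; linarith
    have hc0 : 0 ≤ c := (by positivity : 0 ≤ 1 / K₃).trans g2
    have q1 : 1 / (4 * K₃) * a ^ 2 ≤ c / 4 * a ^ 2 := by gcongr
    have q2 : c * e ^ 2 ≤ K₂ * e ^ 2 := by gcongr
    have q3 : 0 ≤ c * (a / 2 - e) ^ 2 := by positivity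
    have hb0 : S.x i ω ⬝ᵥ S.β₀ = S.x i ω ⬝ᵥ S.βhat (j - 1) ω - e := by rw [he]; ring
    rw [hb0]
    nlinarith
  have hsc := (le_abs_self _).trans (h.abs_score_dotProduct_le hj v)
  rw [S.sum_range_N_eq (j := j) (fun i => (S.x i ω ⬝ᵥ v) ^ 2), mul_add]
  linarith

end GoodOutcome

end Stream

/-! ### Error bounds for the online lasso, by induction over the batches. -/

/-- A sample size bound that makes `B √(N t)` negligible with respect to `N`. -/
lemma mul_sqrt_mul_le_of_sq_mul_le {B N t : ℝ} (hN : 0 ≤ N) (hB : 0 ≤ B) (h : B ^ 2 * t ≤ N) :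
    B * √(N * t) ≤ N := by
  rw [← Real.sqrt_sq hB, ← Real.sqrt_mul (sq_nonneg _), Real.sqrt_le_left hN]
  nlinarith

namespace Stream

variable {Ω : Type*} (S : Stream Ω)

/-- A lower bound on the cumulative sample sizes, growing geometrically with the batch number. -/
def SampleSizeBound (Γ a s₀ sr : ℝ) : Prop :=
  ∀ j ∈ Finset.Icc 1 S.b, Γ * (a ^ j * (s₀ * sr)) ^ 2 * (Real.log S.p + j) ≤ S.N j

variable {S} {G : GLM} {Jpop : Matrix (Fin S.p) (Fin S.p) ℝ} {K M L δ κ K₂ K₃ C C₁ : ℝ} {ω : Ω}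

/-- All smallness conditions of the analysis have this shape, with s equal to 1, s₀, s_r or their
product, so one bound with a large enough Γ serves them all. -/
lemma SampleSizeBound.mul_le {Γ a s₀ sr : ℝ} (h : S.SampleSizeBound Γ a s₀ sr) {j : ℕ}
    (hj : j ∈ Finset.Icc 1 S.b) (ha : 0 ≤ a) {B s : ℝ} (hs : 0 ≤ s)
    (hs' : s ≤ s₀ * sr) (hB : B ^ 2 ≤ Γ) :
    (B * (a ^ j * s)) ^ 2 * (Real.log S.p + j) ≤ S.N j := by
  refine le_trans ?_ (h j hj)
  rw [mul_pow]
  gcongr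
  exact (sq_nonneg B).trans hB

lemma SampleSizeBound.mul_sqrt_le {Γ a s₀ sr : ℝ} (h : S.SampleSizeBound Γ a s₀ sr) {j : ℕ}
    (hj : j ∈ Finset.Icc 1 S.b) (ha : 0 ≤ a) {B s : ℝ} (hs : 0 ≤ s)
    (hs' : s ≤ s₀ * sr) (hB0 : 0 ≤ B) (hB : B ^ 2 ≤ Γ) :
    B * (a ^ j * s) * √(S.N j * (Real.log S.p + j)) ≤ S.N j :=
  mul_sqrt_mul_le_of_sq_mul_le (Nat.cast_nonneg _) (by positivity)
    (h.mul_le hj ha hs hs' hB)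

/-- Absorbs the factor exp (2 j) of `lasso_step` into the geometric growth, since exp 2 < 16. -/
lemma exp_two_mul_le_pow {a : ℝ} (ha : 16 ≤ a) (j : ℕ) : Real.exp (2 * j) ≤ a ^ j := by
  rw [mul_comm, Real.exp_nat_mul]
  gcongr
  have h1 := Real.exp_one_lt_d9
  rw [show (2 : ℝ) = 1 + 1 by norm_num, Real.exp_add]
  nlinarith [Real.exp_pos 1]

/-- Size of the deterministic part of the squared prediction error in a lasso step. -/
def errConst (κ K₂ K₃ C : ℝ) : ℝ := 72 * C ^ 2 / (κ / (4 * K₂ * K₃))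

/-- Constant in the bound on the squared prediction error of the online lasso. -/
def predConst (κ K₂ K₃ C : ℝ) : ℝ := 24 * K₃ * errConst κ K₂ K₃ C

/-- Constant in the bound on the `ℓ₁` error of the online lasso. -/
def l1Const (κ K₂ K₃ C : ℝ) : ℝ := 3 * K₂ * predConst κ K₂ K₃ C + 4 * errConst κ K₂ K₃ C

namespace GoodOutcome

set_option maxHeartbeats 1000000 in
/-- Error bounds for the online lasso, uniformly over the batches. -/
theorem lasso_error_bounds (h : S.GoodOutcome G Jpop K M L δ K₂ K₃ C C₁ ω) (hδ : 0 < δ)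
    (hκ0 : 0 < κ) (hκ : ∀ u : Fin S.p → ℝ, κ * ∑ k, u k ^ 2 ≤ u ⬝ᵥ (Jpop *ᵥ u))
    (hK₂ : 1 ≤ K₂) (hK₃ : 1 ≤ K₃) (hC₁ : 0 ≤ C₁) (hC0 : 0 < C) (hC : 3 * C₁ ≤ C)
    (hp : 1 ≤ Real.log S.p) {s₀ sr : ℝ} (hs₀ : 1 ≤ s₀) (hsr : 1 ≤ sr)
    (hcard : (Nat.card {k // S.β₀ k ≠ 0} : ℝ) ≤ s₀) (hN0 : 0 < S.N 1)
    {Γ : ℝ} (hN : S.SampleSizeBound Γ (16 * K₂ * K₃) s₀ sr)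
    (hΓ₁ : (288 * C₁ / κ) ^ 2 ≤ Γ)
    (hΓ₂ : (2 * C₁ * predConst κ K₂ K₃ C / C ^ 2) ^ 2 ≤ Γ)
    (hΓ₃ : (l1Const κ K₂ K₃ C / (C * δ)) ^ 2 ≤ Γ) :
    ∀ j ∈ Finset.Icc 1 S.b, l1 (S.βhat j ω - S.β₀) ≤ δ ∧
      ∑ i ∈ Finset.range (S.N j), (S.x i ω ⬝ᵥ (S.βhat j ω - S.β₀)) ^ 2 ≤
        predConst κ K₂ K₃ C * ((16 * K₂ * K₃) ^ j * (s₀ * Real.log S.p)) ∧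
      2 * C * √(S.N j * Real.log S.p) * l1 (S.βhat j ω - S.β₀) ≤
        l1Const κ K₂ K₃ C * ((16 * K₂ * K₃) ^ j * (s₀ * Real.log S.p)) := by
  set ℓ := Real.log S.p with hℓ
  set a := 16 * K₂ * K₃ with ha
  have hK23 : 1 ≤ K₂ * K₃ := one_le_mul_of_one_le_of_one_le hK₂ hK₃
  have ha16 : 16 ≤ a := by rw [ha]; linarith
  have ha0 : 0 < a := by linarith
  have hs0 : 0 < s₀ := by linarith
  have hℓ0 : 0 < ℓ := by linarith
  have hK₃0 : 0 < K₃ := by linarith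
  have hK₂0 : 0 < K₂ := by linarith
  have hsle : s₀ ≤ s₀ * sr := le_mul_of_one_le_right hs0.le hsr
  set CH := errConst κ K₂ K₃ C with hCH
  set CP := predConst κ K₂ K₃ C with hCP
  set CE := l1Const κ K₂ K₃ C with hCE
  have hCH0 : 0 < CH := by rw [hCH, errConst]; positivity
  have hCP0 : 0 < CP := by rw [hCP, predConst]; positivity
  have hCE0 : 0 < CE := by rw [hCE, l1Const]; positivity
  intro j
  induction j using Nat.strong_induction_on with
  | _ j ih =>
  intro hj
  obtain ⟨hj1, hjb⟩ := Finset.mem_Icc.1 hj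
  have hNj : 0 < S.N j := hN0.trans_le (S.N_mono hj1)
  have hNj' : (0 : ℝ) < S.N j := by exact_mod_cast hNj
  have hprev : ∀ l ∈ Finset.Icc 1 (j - 1), l1 (S.βhat l ω - S.β₀) ≤ δ := by
    intro l hl
    obtain ⟨h1, h2⟩ := Finset.mem_Icc.1 hl
    exact (ih l (by omega) (Finset.mem_Icc.2 ⟨h1, by omega⟩)).1
  set R := s₀ * ℓ with hR
  have hR0 : 0 < R := by positivity
  set E := K₂ * ∑ i ∈ Finset.range (S.N (j - 1)),
    (S.x i ω ⬝ᵥ (S.βhat (j - 1) ω - S.β₀)) ^ 2 with hEdef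
  have hE0 : 0 ≤ E := mul_nonneg hK₂0.le (Finset.sum_nonneg fun _ _ => sq_nonneg _)
  -- The factor a gained in passing from j - 1 to j is kept on the left; it is what closes the
  -- induction.
  have hE : E * a ≤ K₂ * CP * (a ^ j * R) := by
    have : ∑ i ∈ Finset.range (S.N (j - 1)), (S.x i ω ⬝ᵥ (S.βhat (j - 1) ω - S.β₀)) ^ 2 ≤
        CP * (a ^ (j - 1) * R) := by
      -- For j = 1 the past is empty, so the arbitrary value of `βhat 0` plays no role.
      rcases Nat.eq_zero_or_pos (j - 1) with h0 | h0
      · rw [h0, N_zero]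
        simp only [Finset.range_zero, Finset.sum_empty]
        positivity
      · exact (ih (j - 1) (by omega) (Finset.mem_Icc.2 ⟨h0, by omega⟩)).2.1
    have hpow : a ^ j = a ^ (j - 1) * a := by
      rw [← pow_succ]; congr 1; omega
    rw [hEdef, hpow]
    calc K₂ * (∑ i ∈ Finset.range (S.N (j - 1)),
          (S.x i ω ⬝ᵥ (S.βhat (j - 1) ω - S.β₀)) ^ 2) * a
        ≤ K₂ * (CP * (a ^ (j - 1) * R)) * a := by gcongr
      _ = _ := by ring
  have hE' : E ≤ K₂ * CP * (a ^ j * R) :=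
    le_trans (le_mul_of_one_le_right hE0 (by linarith)) hE
  have hexp := exp_two_mul_le_pow ha16 j
  -- The bounds are proved at every point of the segment that lies in the ball, because `βhat j`
  -- itself is not yet known to lie there.
  have step : ∀ θ : ℝ, 0 ≤ θ → θ ≤ 1 → l1 (θ • (S.βhat j ω - S.β₀)) ≤ δ →
      ∑ i ∈ Finset.range (S.N j), (S.x i ω ⬝ᵥ (θ • (S.βhat j ω - S.β₀))) ^ 2 ≤
        CP * (a ^ j * R) ∧
      2 * C * √(S.N j * ℓ) * l1 (θ • (S.βhat j ω - S.β₀)) ≤ CE * (a ^ j * R) := by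
    intro θ h0 h1 hvδ
    set v := θ • (S.βhat j ω - S.β₀) with hv
    have basic := h.lasso_basic hC0.le hK₃0 hj hNj hprev h0 h1 hv hvδ
    rw [← hℓ, ← hEdef] at basic
    have re := h.restricted_eigenvalue hδ.le hκ hj v
    rw [← hℓ] at re
    set P := ∑ i ∈ Finset.range (S.N j), (S.x i ω ⬝ᵥ v) ^ 2 with hP
    have hP0 : 0 ≤ P := Finset.sum_nonneg fun _ _ => sq_nonneg _
    have hstep := lasso_step S.β₀ v (C := C) (C₁ := C₁) (N := S.N j) (ℓ := ℓ)
      (q₀ := κ / (4 * K₂ * K₃)) (ρ₁ := C₁ / (4 * K₂ * K₃)) (s := s₀) (E := E)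
      (Q := 1 / (4 * K₃) * P) (j := j) hC₁ hC hC0 hNj' hp (by positivity) (by positivity) hs₀
      hcard (by
        rw [Fintype.card_fin, hℓ, Real.exp_log]
        rcases Nat.eq_zero_or_pos S.p with h | h
        · rw [hℓ, h] at hp; norm_num at hp
        · exact_mod_cast h)
      hE0 (by positivity)
      (by
        have : 0 ≤ C₁ * √(S.N j * (ℓ + j)) * l1 v :=
          mul_nonneg (by positivity) (l1_nonneg v)
        linarith)
      (by
        have e : κ / (4 * K₂ * K₃) * S.N j * ∑ k, v k ^ 2 -
            C₁ / (4 * K₂ * K₃) * √(S.N j * (ℓ + j)) * l1 v ^ 2 =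
            1 / (4 * K₂ * K₃) * (κ * S.N j * ∑ k, v k ^ 2 -
              C₁ * √(S.N j * (ℓ + j)) * l1 v ^ 2) := by ring
        rw [e]
        calc _ ≤ 1 / (4 * K₂ * K₃) * (K₂ * P) := by gcongr
          _ = 1 / (4 * K₃) * P := by field_simp)
      (by
        refine le_trans ?_ (hN.mul_le hj ha0.le hs0.le hsle hΓ₁)
        rw [← hℓ]
        have e1 : 288 * (C₁ / (4 * K₂ * K₃)) / (κ / (4 * K₂ * K₃)) = 288 * C₁ / κ := by
          field_simp
        have e2 : Real.exp (4 * j) = Real.exp (2 * j) ^ 2 := by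
          rw [← Real.exp_nat_mul]; congr 1; push_cast; ring
        rw [e1, e2]
        calc (288 * C₁ / κ) ^ 2 * Real.exp (2 * j) ^ 2 * s₀ ^ 2 * (ℓ + j)
            ≤ (288 * C₁ / κ) ^ 2 * (a ^ j) ^ 2 * s₀ ^ 2 * (ℓ + j) := by gcongr
          _ = _ := by ring)
      (by
        have hk := hN.mul_sqrt_le hj ha0.le hs0.le hsle
          (B := 2 * C₁ * CP / C ^ 2) (by positivity) hΓ₂
        rw [← hℓ] at hk
        calc 8 * (C₁ / (4 * K₂ * K₃) * √(S.N j * (ℓ + j))) * E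
            ≤ 8 * (C₁ / (4 * K₂ * K₃) * √(S.N j * (ℓ + j))) * (K₂ * CP * (a ^ j * R)) := by
              gcongr
          _ = 1 / K₃ * (C ^ 2 * ℓ *
              (2 * C₁ * CP / C ^ 2 * (a ^ j * s₀) * √(S.N j * (ℓ + j)))) := by
              rw [hR]; field_simp; ring
          _ ≤ 1 * (C ^ 2 * ℓ * S.N j) := by
              gcongr
              rw [div_le_one hK₃0]; exact hK₃
          _ ≤ 4 * C ^ 2 * (S.N j * ℓ) := by
              nlinarith [show 0 ≤ C ^ 2 * ℓ * S.N j by positivity])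
    rw [show 72 * C ^ 2 / (κ / (4 * K₂ * K₃)) = CH from rfl] at hstep
    obtain ⟨hQ, hL⟩ := hstep
    have hX : CH * (Real.exp (2 * j) * s₀ * ℓ) ≤ CH * (a ^ j * R) := by
      rw [hR, ← mul_assoc (a ^ j)]; gcongr
    constructor
    · have h1 : P ≤ 4 * K₃ * (2 * E + 3 * (CH * (a ^ j * R))) := by
        have : P = 4 * K₃ * (1 / (4 * K₃) * P) := by field_simp
        rw [this]
        gcongr
        linarith
      -- This dictates a = 16 K₂ K₃: the inherited error uses half of the constant `CP`, and in `h3`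
      -- the new error uses the other half.
      have h2 : 8 * K₃ * E ≤ CP / 2 * (a ^ j * R) := by
        refine le_of_mul_le_mul_right ?_ ha0
        calc 8 * K₃ * E * a = 8 * K₃ * (E * a) := by ring
          _ ≤ 8 * K₃ * (K₂ * CP * (a ^ j * R)) := by gcongr
          _ = CP / 2 * (a ^ j * R) * a := by rw [ha]; ring
      have h3 : 12 * K₃ * (CH * (a ^ j * R)) = CP / 2 * (a ^ j * R) := by
        rw [hCP, predConst, ← hCH]; ring
      linarith
    · have : CE * (a ^ j * R) = 3 * (K₂ * CP * (a ^ j * R)) + 4 * (CH * (a ^ j * R)) := by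
        rw [hCE, l1Const, ← hCP, ← hCH]; ring
      rw [this]
      linarith
  have hsmall : CE * (a ^ j * R) < 2 * C * √(S.N j * ℓ) * δ := by
    have hk := hN.mul_le hj ha0.le hs0.le hsle (B := CE / (C * δ)) hΓ₃
    rw [← hℓ] at hk
    have hk' : (CE / (C * δ) * (a ^ j * s₀)) ^ 2 * ℓ ≤ S.N j := by
      refine le_trans ?_ hk
      gcongr
      linarith [Nat.cast_nonneg (α := ℝ) j]
    have h1 : CE / (C * δ) * (a ^ j * s₀) * ℓ ≤ √(S.N j * ℓ) := by
      refine Real.le_sqrt_of_sq_le ?_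
      rw [mul_pow, sq ℓ, ← mul_assoc]
      gcongr
    have h2 : CE * (a ^ j * R) = C * δ * (CE / (C * δ) * (a ^ j * s₀) * ℓ) := by
      rw [hR]; field_simp
    have hsq : 0 < √(S.N j * ℓ) := by positivity
    rw [h2]
    calc C * δ * (CE / (C * δ) * (a ^ j * s₀) * ℓ) ≤ C * δ * √(S.N j * ℓ) := by gcongr
      _ < 2 * C * √(S.N j * ℓ) * δ := by nlinarith [show 0 < C * δ * √(S.N j * ℓ) by positivity]
  have hclose : l1 (S.βhat j ω - S.β₀) ≤ δ := by
    -- An estimate outside the ball would put a point of the segment at ℓ₁-distance exactly δ, which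
    -- `step` and `hsmall` exclude.
    by_contra hcon
    rw [not_le] at hcon
    have hpos : 0 < l1 (S.βhat j ω - S.β₀) := hδ.trans hcon
    have hθ0 : 0 ≤ δ / l1 (S.βhat j ω - S.β₀) := by positivity
    have heq : l1 ((δ / l1 (S.βhat j ω - S.β₀)) • (S.βhat j ω - S.β₀)) = δ := by
      rw [l1_smul, abs_of_nonneg hθ0]
      field_simp
    have := (step _ hθ0 ((div_le_one hpos).2 hcon.le) heq.le).2
    rw [heq] at this
    linarith
  have hfin := step 1 zero_le_one le_rfl (by rwa [one_smul])
  rw [one_smul] at hfin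
  exact ⟨hclose, hfin.1, hfin.2⟩

end GoodOutcome

end Stream

/-! ### Error bounds for the low-dimensional projection. -/

lemma sum_Icc_pow_le {a : ℝ} (ha : 2 ≤ a) (j : ℕ) : ∑ l ∈ Finset.Icc 1 j, a ^ l ≤ 2 * a ^ j := by
  induction j with
  | zero => simp
  | succ j ih =>
    rw [Finset.sum_Icc_succ_top (by omega), pow_succ]
    nlinarith [show 0 ≤ a ^ j by positivity]

namespace Stream

variable {Ω : Type*} {S : Stream Ω} {G : GLM} {Jpop : Matrix (Fin S.p) (Fin S.p) ℝ}
  {K M L δ κ K₂ K₃ C C₁ : ℝ} {ω : Ω}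

/-- Constant in the bound on the error that estimating the information matrix causes in the
low-dimensional projection. -/
def plugInConst (K M L κ K₂ K₃ C : ℝ) : ℝ :=
  4 * K₃ * (L * (K + M)) ^ 2 * predConst κ K₂ K₃ C

/-- Constant in the bound on the `ℓ₁` error of the low-dimensional projection. -/
def projConst (K M L κ K₂ K₃ C : ℝ) : ℝ :=
  3 * plugInConst K M L κ K₂ K₃ C + 4 * errConst κ K₂ K₃ C

namespace GoodOutcome

lemma abs_dotProduct_extend_γ₀_le (h : S.GoodOutcome G Jpop K M L δ K₂ K₃ C C₁ ω) {i : ℕ}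
    (hi : i < S.N S.b) : |S.x i ω ⬝ᵥ extend S.r (-1) S.γ₀| ≤ K + M := by
  rw [dotProduct_extend]
  refine (abs_add_le _ _).trans (add_le_add ?_ (h.bounded_projection i hi))
  simpa using h.bounded_x i hi S.r

lemma abs_resid_dotProduct_le (h : S.GoodOutcome G Jpop K M L δ K₂ K₃ C C₁ ω) {j : ℕ}
    (hj : j ∈ Finset.Icc 1 S.b) (v : {k // k ≠ S.r} → ℝ) :
    |∑ i ∈ Finset.range (S.N j), deriv G.g (S.x i ω ⬝ᵥ S.β₀) *
      (S.x i ω ⬝ᵥ extend S.r (-1) S.γ₀) * (S.x i ω ⬝ᵥ extend S.r 0 v)| ≤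
      C₁ * √(S.N j * (Real.log S.p + j)) * l1 v := by
  have e : ∑ i ∈ Finset.range (S.N j), deriv G.g (S.x i ω ⬝ᵥ S.β₀) *
      (S.x i ω ⬝ᵥ extend S.r (-1) S.γ₀) * (S.x i ω ⬝ᵥ extend S.r 0 v) =
      (fun k : {k // k ≠ S.r} => ∑ i ∈ Finset.range (S.N j), deriv G.g (S.x i ω ⬝ᵥ S.β₀) *
        S.x i ω k.1 * (S.x i ω ⬝ᵥ extend S.r (-1) S.γ₀)) ⬝ᵥ v := by
    have h1 : ∀ i, S.x i ω ⬝ᵥ extend S.r 0 v = ∑ k : {k // k ≠ S.r}, S.x i ω k.1 * v k := by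
      intro i; rw [dotProduct_extend]; ring
    simp only [h1, Finset.mul_sum]
    rw [Finset.sum_comm]
    refine Finset.sum_congr rfl fun k _ => ?_
    rw [Finset.sum_mul]
    exact Finset.sum_congr rfl fun i _ => by ring
  rw [e]
  exact abs_dotProduct_le_l1 fun k => h.resid j hj k.1 k.2

/-- Basic inequality of the low-dimensional projection. -/
lemma proj_basic (h : S.GoodOutcome G Jpop K M L δ K₂ K₃ C C₁ ω) (hδ : 0 ≤ δ) (hK₃ : 0 < K₃)
    (hL : 0 ≤ L) {j : ℕ} (hj : j ∈ Finset.Icc 1 S.b) (hN : 0 < S.N j)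
    (hβ : ∀ l ∈ Finset.Icc 1 j, l1 (S.βhat l ω - S.β₀) ≤ δ) {v : {k // k ≠ S.r} → ℝ}
    (hv : v = S.γhat j ω - S.γ₀) :
    1 / (2 * K₃) * ∑ i ∈ Finset.range (S.N j), (S.x i ω ⬝ᵥ extend S.r 0 v) ^ 2 +
        2 * C * √(S.N j * Real.log S.p) * (l1 (S.γ₀ + v) - l1 S.γ₀) ≤
      2 * C₁ * √(S.N j * (Real.log S.p + j)) * l1 v +
        2 * K₃ * (L * (K + M)) ^ 2 * ∑ l ∈ Finset.Icc 1 j, ∑ i ∈ S.batch l,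
          (S.x i ω ⬝ᵥ (S.βhat l ω - S.β₀)) ^ 2 := by
  have hjb := (Finset.mem_Icc.1 hj).2
  have hγ : S.γhat j ω = S.γ₀ + v := by rw [hv]; abel
  have hmin : S.projObjective G C j ω (S.γ₀ + v) ≤ S.projObjective G C j ω S.γ₀ := by
    rw [← hγ]; exact h.proj j hj (Set.mem_univ _)
  unfold projObjective at hmin
  rw [projQuad_eq_extend (S.Jtilde_isSymm G j ω), projQuad_eq_extend (S.Jtilde_isSymm G j ω),
    dotProduct_Jtilde_mulVec, dotProduct_Jtilde_mulVec] at hmin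
  have hmain := S.sub_add_penalty_le hN hmin
  have hext : extend S.r (-1) (S.γ₀ + v) = extend S.r (-1) S.γ₀ + extend S.r 0 v := by
    rw [← extend_add, add_zero]
  have hquad : 1 / (2 * K₃) * ∑ i ∈ Finset.range (S.N j), (S.x i ω ⬝ᵥ extend S.r 0 v) ^ 2 +
      2 * ∑ i ∈ Finset.range (S.N j), deriv G.g (S.x i ω ⬝ᵥ S.β₀) *
        (S.x i ω ⬝ᵥ extend S.r (-1) S.γ₀) * (S.x i ω ⬝ᵥ extend S.r 0 v) -
      2 * K₃ * (L * (K + M)) ^ 2 * ∑ l ∈ Finset.Icc 1 j, ∑ i ∈ S.batch l,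
          (S.x i ω ⬝ᵥ (S.βhat l ω - S.β₀)) ^ 2 ≤
      (∑ l ∈ Finset.Icc 1 j, ∑ i ∈ S.batch l, deriv G.g (S.x i ω ⬝ᵥ S.βhat l ω) *
        (S.x i ω ⬝ᵥ extend S.r (-1) (S.γ₀ + v)) * (S.x i ω ⬝ᵥ extend S.r (-1) (S.γ₀ + v))) -
      ∑ l ∈ Finset.Icc 1 j, ∑ i ∈ S.batch l, deriv G.g (S.x i ω ⬝ᵥ S.βhat l ω) *
        (S.x i ω ⬝ᵥ extend S.r (-1) S.γ₀) * (S.x i ω ⬝ᵥ extend S.r (-1) S.γ₀) := by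
    rw [← S.sum_batches, ← S.sum_batches]
    simp only [Finset.mul_sum, ← Finset.sum_sub_distrib, ← Finset.sum_add_distrib]
    refine Finset.sum_le_sum fun l hl => Finset.sum_le_sum fun i hi => ?_
    have hlb : l ≤ S.b := (Finset.mem_Icc.1 hl).2.trans hjb
    have hib := S.lt_N_of_mem_batch hi hlb
    have g2 := h.le_deriv i hib _ (hβ l hl)
    have g3 := h.lipschitz i hib _ _ (hβ l hl) (show l1 (S.β₀ - S.β₀) ≤ δ by simpa [l1] using hδ)
    have g4 := h.abs_dotProduct_extend_γ₀_le hib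
    rw [hext, dotProduct_add]
    rw [← dotProduct_sub] at g3
    set c := deriv G.g (S.x i ω ⬝ᵥ S.βhat l ω)
    set c₀ := deriv G.g (S.x i ω ⬝ᵥ S.β₀)
    set u := S.x i ω ⬝ᵥ extend S.r (-1) S.γ₀
    set e := S.x i ω ⬝ᵥ extend S.r 0 v
    set Δ := S.x i ω ⬝ᵥ (S.βhat l ω - S.β₀)
    have q1 : 1 / K₃ * e ^ 2 ≤ c * e ^ 2 := by gcongr
    have q2 : |(c - c₀) * u * e| ≤ (L * (K + M)) * |Δ| * |e| := by
      rw [abs_mul, abs_mul]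
      calc |c - c₀| * |u| * |e| ≤ (L * |Δ|) * (K + M) * |e| := by gcongr
        _ = _ := by ring
    -- Young's inequality: half of the curvature pays for exchanging the weight at `βhat l` for the
    -- weight at `β₀` in the cross term.
    have q3 : 2 * ((L * (K + M)) * |Δ| * |e|) ≤
        1 / (2 * K₃) * e ^ 2 + 2 * K₃ * (L * (K + M)) ^ 2 * Δ ^ 2 := by
      have : 1 / (2 * K₃) * e ^ 2 + 2 * K₃ * (L * (K + M)) ^ 2 * Δ ^ 2 -
          2 * ((L * (K + M)) * |Δ| * |e|) =
          1 / (2 * K₃) * (|e| - 2 * K₃ * (L * (K + M)) * |Δ|) ^ 2 := by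
        rw [← sq_abs e, ← sq_abs Δ]
        field_simp
        ring
      have h0 : 0 ≤ 1 / (2 * K₃) * (|e| - 2 * K₃ * (L * (K + M)) * |Δ|) ^ 2 := by positivity
      linarith
    have q4 := neg_le_of_abs_le q2
    have q5 : 1 / K₃ * e ^ 2 = 2 * (1 / (2 * K₃) * e ^ 2) := by field_simp
    nlinarith
  have hres := neg_le_of_abs_le (h.abs_resid_dotProduct_le hj v)
  linarith

set_option maxHeartbeats 1000000 in
/-- Error bounds for the low-dimensional projections, uniformly over the batches. -/
theorem proj_error_bounds (h : S.GoodOutcome G Jpop K M L δ K₂ K₃ C C₁ ω) (hδ : 0 < δ)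
    (hκ0 : 0 < κ) (hκ : ∀ u : Fin S.p → ℝ, κ * ∑ k, u k ^ 2 ≤ u ⬝ᵥ (Jpop *ᵥ u))
    (hL : 0 ≤ L) (hK₂ : 1 ≤ K₂) (hK₃ : 1 ≤ K₃) (hC₁ : 0 ≤ C₁) (hC0 : 0 < C) (hC : 3 * C₁ ≤ C)
    (hp : 1 ≤ Real.log S.p) {s₀ sr : ℝ} (hs₀ : 1 ≤ s₀) (hsr : 1 ≤ sr)
    (hcard : (Nat.card {k // S.γ₀ k ≠ 0} : ℝ) ≤ sr) (hN0 : 0 < S.N 1)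
    {Γ : ℝ} (hN : S.SampleSizeBound Γ (16 * K₂ * K₃) s₀ sr)
    (hΓ₁ : (288 * C₁ / κ) ^ 2 ≤ Γ)
    (hΓ₂ : (C₁ * plugInConst K M L κ K₂ K₃ C / C ^ 2) ^ 2 ≤ Γ)
    (hβ : ∀ j ∈ Finset.Icc 1 S.b, l1 (S.βhat j ω - S.β₀) ≤ δ ∧
      ∑ i ∈ Finset.range (S.N j), (S.x i ω ⬝ᵥ (S.βhat j ω - S.β₀)) ^ 2 ≤
        predConst κ K₂ K₃ C * ((16 * K₂ * K₃) ^ j * (s₀ * Real.log S.p)))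
    {j : ℕ} (hj : j ∈ Finset.Icc 1 S.b) :
    2 * C * √(S.N j * Real.log S.p) * l1 (S.γhat j ω - S.γ₀) ≤
        projConst K M L κ K₂ K₃ C * ((16 * K₂ * K₃) ^ j * ((s₀ + sr) * Real.log S.p)) := by
  set ℓ := Real.log S.p with hℓ
  set a := 16 * K₂ * K₃ with ha
  have hK23 : 1 ≤ K₂ * K₃ := one_le_mul_of_one_le_of_one_le hK₂ hK₃
  have ha16 : 16 ≤ a := by rw [ha]; linarith
  have ha0 : 0 < a := by linarith
  have hs0 : 0 < s₀ := by linarith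
  have hsr0 : 0 < sr := by linarith
  have hℓ0 : 0 < ℓ := by linarith
  have hK₃0 : 0 < K₃ := by linarith
  have hK₂0 : 0 < K₂ := by linarith
  have hsle : s₀ ≤ s₀ * sr := le_mul_of_one_le_right hs0.le hsr
  have hsle' : sr ≤ s₀ * sr := le_mul_of_one_le_left hsr0.le hs₀
  set CH := errConst κ K₂ K₃ C with hCH
  set CP := predConst κ K₂ K₃ C with hCP
  set CI := plugInConst K M L κ K₂ K₃ C with hCI
  have hCH0 : 0 < CH := by rw [hCH, errConst]; positivity
  have hCP0 : 0 < CP := by rw [hCP, predConst]; positivity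
  have hCI0 : 0 ≤ CI := by rw [hCI, plugInConst]; positivity
  obtain ⟨hj1, hjb⟩ := Finset.mem_Icc.1 hj
  have hNj : 0 < S.N j := hN0.trans_le (S.N_mono hj1)
  have hNj' : (0 : ℝ) < S.N j := by exact_mod_cast hNj
  have hmem : ∀ l ∈ Finset.Icc 1 j, l ∈ Finset.Icc 1 S.b := fun l hl =>
    Finset.mem_Icc.2 ⟨(Finset.mem_Icc.1 hl).1, (Finset.mem_Icc.1 hl).2.trans hjb⟩
  set v := S.γhat j ω - S.γ₀ with hv
  have basic := h.proj_basic hδ.le hK₃0 hL hj hNj (fun l hl => (hβ l (hmem l hl)).1) hv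
  rw [← hℓ] at basic
  have re := h.restricted_eigenvalue hδ.le hκ hj (extend S.r 0 v)
  rw [← hℓ, l1_extend, sum_sq_extend, abs_zero, zero_add, zero_pow two_ne_zero, zero_add] at re
  set P := ∑ i ∈ Finset.range (S.N j), (S.x i ω ⬝ᵥ extend S.r 0 v) ^ 2 with hP
  have hP0 : 0 ≤ P := Finset.sum_nonneg fun _ _ => sq_nonneg _
  set E := 2 * K₃ * (L * (K + M)) ^ 2 * ∑ l ∈ Finset.Icc 1 j, ∑ i ∈ S.batch l,
    (S.x i ω ⬝ᵥ (S.βhat l ω - S.β₀)) ^ 2 with hE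
  have hE0 : 0 ≤ E := mul_nonneg (by positivity)
    (Finset.sum_nonneg fun _ _ => Finset.sum_nonneg fun _ _ => sq_nonneg _)
  have hE' : E ≤ CI * (a ^ j * (s₀ * ℓ)) := by
    have h1 : ∑ l ∈ Finset.Icc 1 j, ∑ i ∈ S.batch l, (S.x i ω ⬝ᵥ (S.βhat l ω - S.β₀)) ^ 2 ≤
        ∑ l ∈ Finset.Icc 1 j, CP * (s₀ * ℓ) * a ^ l := by
      -- The bound at step l covers all observations up to batch l, but only those of batch l enter,
      -- so the contributions form a geometric sum.
      refine Finset.sum_le_sum fun l hl => ?_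
      have h2 := (hβ l (hmem l hl)).2
      rw [S.sum_range_N_eq (j := l)] at h2
      have h3 : 0 ≤ ∑ i ∈ Finset.range (S.N (l - 1)),
          (S.x i ω ⬝ᵥ (S.βhat l ω - S.β₀)) ^ 2 := Finset.sum_nonneg fun _ _ => sq_nonneg _
      linarith
    rw [← Finset.mul_sum] at h1
    calc E ≤ 2 * K₃ * (L * (K + M)) ^ 2 * (CP * (s₀ * ℓ) * (2 * a ^ j)) := by
          rw [hE]
          have := sum_Icc_pow_le (by linarith : (2 : ℝ) ≤ a) j
          refine mul_le_mul_of_nonneg_left (h1.trans ?_) (by positivity)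
          gcongr
      _ = CI * (a ^ j * (s₀ * ℓ)) := by rw [hCI, plugInConst, ← hCP]; ring
  have hexp := exp_two_mul_le_pow ha16 j
  have hstep := lasso_step S.γ₀ v (C := C) (C₁ := C₁) (N := S.N j) (ℓ := ℓ)
    (q₀ := κ / (2 * K₂ * K₃)) (ρ₁ := C₁ / (2 * K₂ * K₃)) (s := sr) (E := E)
    (Q := 1 / (2 * K₃) * P) (j := j) hC₁ hC hC0 hNj' hp (by positivity) (by positivity) hsr
    hcard (by
      have hp0 : 0 < S.p := by
        rcases Nat.eq_zero_or_pos S.p with h | h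
        · rw [hℓ, h] at hp; norm_num at hp
        · exact h
      rw [hℓ, Real.exp_log (by exact_mod_cast hp0)]
      have := Fintype.card_subtype_le fun k : Fin S.p => k ≠ S.r
      rw [Fintype.card_fin] at this
      exact_mod_cast this)
    hE0 (by positivity) basic
    (by
      have e : κ / (2 * K₂ * K₃) * S.N j * ∑ k, v k ^ 2 -
          C₁ / (2 * K₂ * K₃) * √(S.N j * (ℓ + j)) * l1 v ^ 2 =
          1 / (2 * K₂ * K₃) * (κ * S.N j * ∑ k, v k ^ 2 -
            C₁ * √(S.N j * (ℓ + j)) * l1 v ^ 2) := by ring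
      rw [e]
      calc _ ≤ 1 / (2 * K₂ * K₃) * (K₂ * P) := by gcongr
        _ = 1 / (2 * K₃) * P := by field_simp)
    (by
      refine le_trans ?_ (hN.mul_le hj ha0.le hsr0.le hsle' hΓ₁)
      rw [← hℓ]
      have e1 : 288 * (C₁ / (2 * K₂ * K₃)) / (κ / (2 * K₂ * K₃)) = 288 * C₁ / κ := by
        field_simp
      have e2 : Real.exp (4 * j) = Real.exp (2 * j) ^ 2 := by
        rw [← Real.exp_nat_mul]; congr 1; push_cast; ring
      rw [e1, e2]
      calc (288 * C₁ / κ) ^ 2 * Real.exp (2 * j) ^ 2 * sr ^ 2 * (ℓ + j)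
          ≤ (288 * C₁ / κ) ^ 2 * (a ^ j) ^ 2 * sr ^ 2 * (ℓ + j) := by gcongr
        _ = _ := by ring)
    (by
      have hk := hN.mul_sqrt_le hj ha0.le hs0.le hsle
        (B := C₁ * CI / C ^ 2) (by positivity) hΓ₂
      rw [← hℓ] at hk
      calc 8 * (C₁ / (2 * K₂ * K₃) * √(S.N j * (ℓ + j))) * E
          ≤ 8 * (C₁ / (2 * K₂ * K₃) * √(S.N j * (ℓ + j))) * (CI * (a ^ j * (s₀ * ℓ))) := by
            gcongr
        _ = 1 / (K₂ * K₃) * (4 * C ^ 2 * ℓ *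
            (C₁ * CI / C ^ 2 * (a ^ j * s₀) * √(S.N j * (ℓ + j)))) := by
            field_simp; ring
        _ ≤ 1 * (4 * C ^ 2 * ℓ * S.N j) := by
            gcongr
            rw [div_le_one (by positivity)]; exact hK23
        _ = 4 * C ^ 2 * (S.N j * ℓ) := by ring)
  refine hstep.2.trans ?_
  have hX : 72 * C ^ 2 / (κ / (2 * K₂ * K₃)) * (Real.exp (2 * j) * sr * ℓ) ≤
      CH * (a ^ j * ((s₀ + sr) * ℓ)) := by
    have : 72 * C ^ 2 / (κ / (2 * K₂ * K₃)) ≤ CH := by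
      rw [hCH, errConst]
      gcongr
      norm_num
    rw [← mul_assoc (a ^ j)]
    gcongr
    linarith
  have hY : CI * (a ^ j * (s₀ * ℓ)) ≤ CI * (a ^ j * ((s₀ + sr) * ℓ)) := by
    gcongr
    linarith
  have : projConst K M L κ K₂ K₃ C * (a ^ j * ((s₀ + sr) * ℓ)) =
      3 * (CI * (a ^ j * ((s₀ + sr) * ℓ))) + 4 * (CH * (a ^ j * ((s₀ + sr) * ℓ))) := by
    rw [projConst, ← hCI, ← hCH]; ring
  rw [this]
  linarith

end GoodOutcome

end Stream

/-! ### First order conditions and decomposition of the debiased estimator. -/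

/-- Plays the role of letting t tend to zero in a difference quotient; the nonsmooth penalty never
has to be differentiated. -/
lemma le_of_forall_le_add_mul {x y z : ℝ} (h : ∀ t : ℝ, 0 < t → t ≤ 1 → x ≤ y + t * z) :
    x ≤ y := by
  by_contra hxy
  rw [not_le] at hxy
  have hz : 0 < |z| + 1 := by positivity
  set t := min 1 ((x - y) / 2 / (|z| + 1)) with ht
  have ht0 : 0 < t := lt_min one_pos (by have : 0 < x - y := by linarith
                                         positivity)
  have h1 := h t ht0 (min_le_left _ _)
  have h2 : t * z ≤ (x - y) / 2 := by
    calc t * z ≤ t * (|z| + 1) := by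
          gcongr
          linarith [le_abs_self z]
      _ ≤ (x - y) / 2 / (|z| + 1) * (|z| + 1) := by gcongr; exact min_le_right _ _
      _ = (x - y) / 2 := by field_simp
  linarith

namespace Stream

variable {Ω : Type*} {S : Stream Ω} {G : GLM} {Jpop : Matrix (Fin S.p) (Fin S.p) ℝ}
  {K M L δ κ K₂ K₃ C C₁ : ℝ} {ω : Ω}

/-- Constant in the bound on the remainder of the expansion of the debiased estimator. -/
def remConst (K M L κ K₂ K₃ C : ℝ) : ℝ :=
  l1Const κ K₂ K₃ C +
    K₂ * K ^ 2 * (projConst K M L κ K₂ K₃ C * l1Const κ K₂ K₃ C / C ^ 2) +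
    L * (K + M + K * (projConst K M L κ K₂ K₃ C / C)) * predConst κ K₂ K₃ C

namespace GoodOutcome

/-- First order condition for the low-dimensional projection, in a direction `d` along which the
penalty grows at rate at most `m`. -/
lemma proj_stationarity (h : S.GoodOutcome G Jpop K M L δ K₂ K₃ C C₁ ω) (hC : 0 ≤ C)
    {j : ℕ} (hj : j ∈ Finset.Icc 1 S.b) (hN : 0 < S.N j) {d : {k // k ≠ S.r} → ℝ} {m : ℝ}
    (hm : ∀ t : ℝ, 0 < t → t ≤ 1 → l1 (S.γhat j ω + t • d) ≤ l1 (S.γhat j ω) + t * m) :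
    0 ≤ extend S.r 0 d ⬝ᵥ (S.Jtilde G j ω *ᵥ S.γtilde j ω) +
      C * √(S.N j * Real.log S.p) * m := by
  have hsym := S.Jtilde_isSymm G j ω
  set e := extend S.r 0 d with he
  set A := S.Jtilde G j ω with hA
  have key : ∀ t : ℝ, 0 < t → t ≤ 1 → 0 ≤ (2 * (e ⬝ᵥ (A *ᵥ S.γtilde j ω)) +
      2 * C * √(S.N j * Real.log S.p) * m) + t * (e ⬝ᵥ (A *ᵥ e)) := by
    intro t ht ht1
    have hmin : S.projObjective G C j ω (S.γhat j ω) ≤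
        S.projObjective G C j ω (S.γhat j ω + t • d) := h.proj j hj (Set.mem_univ _)
    unfold projObjective at hmin
    have h1 := S.sub_add_penalty_le hN hmin
    rw [projQuad_eq_extend hsym, projQuad_eq_extend hsym] at h1
    have hext : extend S.r (-1) (S.γhat j ω + t • d) = S.γtilde j ω + t • e := by
      have := extend_add (r := S.r) (-1) 0 (S.γhat j ω) (t • d)
      rw [add_zero] at this
      rw [this, γtilde_eq_extend]
      congr 1
      funext k
      by_cases hk : k = S.r <;> simp [he, extend, hk]
    rw [hext, ← S.γtilde_eq_extend] at h1
    have hcomm : S.γtilde j ω ⬝ᵥ (A *ᵥ e) = e ⬝ᵥ (A *ᵥ S.γtilde j ω) := by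
      rw [Matrix.dotProduct_mulVec, ← Matrix.mulVec_transpose, hsym.eq, dotProduct_comm]
    have hexp : (S.γtilde j ω + t • e) ⬝ᵥ (A *ᵥ (S.γtilde j ω + t • e)) =
        S.γtilde j ω ⬝ᵥ (A *ᵥ S.γtilde j ω) + 2 * t * (e ⬝ᵥ (A *ᵥ S.γtilde j ω)) +
          t ^ 2 * (e ⬝ᵥ (A *ᵥ e)) := by
      rw [Matrix.mulVec_add, Matrix.mulVec_smul, add_dotProduct, dotProduct_add, dotProduct_add,
        smul_dotProduct, smul_dotProduct, dotProduct_smul, dotProduct_smul, hcomm]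
      simp only [smul_eq_mul]
      ring
    rw [hexp] at h1
    have h2 : 2 * C * √(S.N j * Real.log S.p) * (l1 (S.γhat j ω + t • d) - l1 (S.γhat j ω)) ≤
        2 * C * √(S.N j * Real.log S.p) * (t * m) := by
      gcongr
      linarith [hm t ht ht1]
    refine nonneg_of_mul_nonneg_right (a := t) ?_ ht
    nlinarith
  have := le_of_forall_le_add_mul key
  linarith

/-- The subgradient condition tested against d: the penalty grows at rate at most `l1 d` both along
d and along -d. -/
lemma abs_extend_dotProduct_le (h : S.GoodOutcome G Jpop K M L δ K₂ K₃ C C₁ ω) (hC : 0 ≤ C)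
    {j : ℕ} (hj : j ∈ Finset.Icc 1 S.b) (hN : 0 < S.N j) (d : {k // k ≠ S.r} → ℝ) :
    |extend S.r 0 d ⬝ᵥ (S.Jtilde G j ω *ᵥ S.γtilde j ω)| ≤
      C * √(S.N j * Real.log S.p) * l1 d := by
  have hrate : ∀ d : {k // k ≠ S.r} → ℝ, ∀ t : ℝ, 0 < t → t ≤ 1 →
      l1 (S.γhat j ω + t • d) ≤ l1 (S.γhat j ω) + t * l1 d := fun d t ht _ => by
    refine (l1_add_le _ _).trans ?_
    rw [l1_smul, abs_of_pos ht]
  have h1 := h.proj_stationarity hC hj hN (hrate d)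
  have h2 := h.proj_stationarity hC hj hN (hrate (-d))
  have : extend S.r 0 (-d) = -extend S.r 0 d := by
    funext k
    by_cases hk : k = S.r <;> simp [extend, hk]
  rw [this, neg_dotProduct, l1_neg] at h2
  rw [abs_le]
  constructor <;> linarith

/-- The normalization of the debiased estimator is positive. -/
lemma τhat_pos (h : S.GoodOutcome G Jpop K M L δ K₂ K₃ C C₁ ω) (hδ : 0 ≤ δ)
    (hκ0 : 0 < κ) (hκ : ∀ u : Fin S.p → ℝ, κ * ∑ k, u k ^ 2 ≤ u ⬝ᵥ (Jpop *ᵥ u))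
    (hK₂ : 0 < K₂) (hK₃ : 0 < K₃) (hC : 0 < C) (hp : 0 < Real.log S.p)
    {j : ℕ} (hj : j ∈ Finset.Icc 1 S.b) (hN : 0 < S.N j)
    (hβ : ∀ l ∈ Finset.Icc 1 j, l1 (S.βhat l ω - S.β₀) ≤ δ)
    (hsmall : C₁ * √(S.N j * (Real.log S.p + j)) < κ * S.N j) :
    0 < S.τhat G j ω := by
  have hjb := (Finset.mem_Icc.1 hj).2
  have hN' : (0 : ℝ) < S.N j := by exact_mod_cast hN
  -- Shrinking `γhat` towards zero lowers the penalty at rate `l1 γhat`. Hence `τhat` is at least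
  -- the quadratic form at `γtilde` plus the penalty term.
  have h1 := h.proj_stationarity hC.le hj hN (d := -S.γhat j ω) (m := -l1 (S.γhat j ω))
    (fun t ht ht1 => by
      have : S.γhat j ω + t • -S.γhat j ω = (1 - t) • S.γhat j ω := by
        rw [smul_neg, sub_smul, one_smul, sub_eq_add_neg]
      rw [this, l1_smul, abs_of_nonneg (by linarith)]
      linarith)
  have hext : extend S.r 0 (-S.γhat j ω) = -(S.γtilde j ω) + -(Pi.single S.r (1 : ℝ)) := by
    funext k
    by_cases hk : k = S.r
    · subst hk; simp [extend, γtilde]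
    · simp [extend, γtilde, hk]
  rw [hext, add_dotProduct, neg_dotProduct, neg_dotProduct, single_one_dotProduct,
    Jtilde_mulVec_γtilde_self] at h1
  have hq : 1 / K₃ * ∑ i ∈ Finset.range (S.N j), (S.x i ω ⬝ᵥ S.γtilde j ω) ^ 2 ≤
      S.γtilde j ω ⬝ᵥ (S.Jtilde G j ω *ᵥ S.γtilde j ω) := by
    rw [dotProduct_Jtilde_mulVec, ← S.sum_batches]
    simp only [Finset.mul_sum]
    refine Finset.sum_le_sum fun l hl => Finset.sum_le_sum fun i hi => ?_
    rw [mul_assoc, ← sq]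
    gcongr
    exact h.le_deriv i (S.lt_N_of_mem_batch hi ((Finset.mem_Icc.1 hl).2.trans hjb)) _ (hβ l hl)
  have hS0 : 0 ≤ ∑ i ∈ Finset.range (S.N j), (S.x i ω ⬝ᵥ S.γtilde j ω) ^ 2 :=
    Finset.sum_nonneg fun _ _ => sq_nonneg _
  have hw : 0 < C * √(S.N j * Real.log S.p) := by positivity
  -- Either the penalty term is positive, or `γhat` vanishes and `γtilde` is minus a unit vector, at
  -- which the curvature exceeds the slack by `hsmall`.
  rcases eq_or_lt_of_le (l1_nonneg (S.γhat j ω)) with h0 | h0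
  · have re := h.restricted_eigenvalue hδ hκ hj (S.γtilde j ω)
    have hsq : 1 ≤ ∑ k, S.γtilde j ω k ^ 2 := by
      rw [γtilde_eq_extend, sum_sq_extend]
      have : 0 ≤ ∑ k, S.γhat j ω k ^ 2 := Finset.sum_nonneg fun _ _ => sq_nonneg _
      linarith
    rw [show l1 (S.γtilde j ω) = 1 by rw [γtilde_eq_extend, l1_extend, ← h0]; simp] at re
    have hpos : 0 < K₂ * ∑ i ∈ Finset.range (S.N j), (S.x i ω ⬝ᵥ S.γtilde j ω) ^ 2 := by
      nlinarith [mul_pos hκ0 hN']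
    have : 0 < ∑ i ∈ Finset.range (S.N j), (S.x i ω ⬝ᵥ S.γtilde j ω) ^ 2 :=
      pos_of_mul_pos_right hpos hK₂.le
    have : 0 < 1 / K₃ * ∑ i ∈ Finset.range (S.N j), (S.x i ω ⬝ᵥ S.γtilde j ω) ^ 2 := by
      positivity
    rw [← h0] at h1
    linarith
  · have : 0 ≤ 1 / K₃ * ∑ i ∈ Finset.range (S.N j), (S.x i ω ⬝ᵥ S.γtilde j ω) ^ 2 := by
      positivity
    have := mul_pos hw h0
    linarith

lemma abs_g_expansion_le (h : S.GoodOutcome G Jpop K M L δ K₂ K₃ C C₁ ω) (hL : 0 ≤ L) {i j : ℕ}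
    (hi : i < S.N S.b) (hβ : l1 (S.βhat j ω - S.β₀) ≤ δ) :
    |G.g (S.x i ω ⬝ᵥ S.β₀) - G.g (S.x i ω ⬝ᵥ S.βhat j ω) +
      deriv G.g (S.x i ω ⬝ᵥ S.βhat j ω) * (S.x i ω ⬝ᵥ (S.βhat j ω - S.β₀))| ≤
      L * (S.x i ω ⬝ᵥ (S.βhat j ω - S.β₀)) ^ 2 := by
  rw [dotProduct_sub]
  refine G.abs_g_expansion_le fun θ hθ => ?_
  have h1 := h.lipschitz i hi (S.β₀ + θ • (S.βhat j ω - S.β₀)) (S.βhat j ω)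
    (l1_segment_le hθ hβ) hβ
  simp only [dotProduct_add, dotProduct_smul, dotProduct_sub, smul_eq_mul] at h1
  refine h1.trans (mul_le_mul_of_nonneg_left ?_ hL)
  have : S.x i ω ⬝ᵥ S.β₀ + θ * (S.x i ω ⬝ᵥ S.βhat j ω - S.x i ω ⬝ᵥ S.β₀) -
      S.x i ω ⬝ᵥ S.βhat j ω =
      -((1 - θ) * (S.x i ω ⬝ᵥ S.βhat j ω - S.x i ω ⬝ᵥ S.β₀)) := by ring
  rw [this, abs_neg, abs_mul, abs_of_nonneg (by linarith [hθ.2])]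
  exact mul_le_of_le_one_left (abs_nonneg _) (by linarith [hθ.1])

end GoodOutcome

/-- Algebraic decomposition of the error of the debiased estimator. -/
lemma τhat_mul_βon_sub (S : Stream Ω) (G : GLM) (ω : Ω) (hτ : S.τhat G S.b ω ≠ 0) :
    S.τhat G S.b ω * (S.βon G ω - S.β₀ S.r) =
      ∑ j ∈ Finset.Icc 1 S.b, ∑ i ∈ S.batch j,
        S.zhat j i ω * (S.y i ω - G.g (S.x i ω ⬝ᵥ S.β₀)) +
      (extend S.r 0 (fun k => (S.βhat S.b ω - S.β₀) k.1) ⬝ᵥ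
          (S.Jtilde G S.b ω *ᵥ S.γtilde S.b ω) +
        ∑ j ∈ Finset.Icc 1 S.b, (S.γtilde j ω - S.γtilde S.b ω) ⬝ᵥ
          (S.J G j (S.βhat j ω) ω *ᵥ (S.βhat S.b ω - S.β₀)) +
        ∑ j ∈ Finset.Icc 1 S.b, ∑ i ∈ S.batch j, S.zhat j i ω *
          (G.g (S.x i ω ⬝ᵥ S.β₀) - G.g (S.x i ω ⬝ᵥ S.βhat j ω) +
            deriv G.g (S.x i ω ⬝ᵥ S.βhat j ω) * (S.x i ω ⬝ᵥ (S.βhat j ω - S.β₀)))) := by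
  set Δ := S.βhat S.b ω - S.β₀ with hΔ
  -- Coordinate r meets the entry `-τhat` of `Jtilde γtilde`; in the other coordinates the first
  -- order condition makes that vector small.
  have hdec : Δ = Pi.single S.r (Δ S.r) + extend S.r 0 (fun k => Δ k.1) := by
    funext k
    by_cases hk : k = S.r
    · subst hk; simp
    · simp [extend, hk]
  have hsym := S.Jtilde_isSymm G S.b ω
  have h1 : extend S.r 0 (fun k => Δ k.1) ⬝ᵥ (S.Jtilde G S.b ω *ᵥ S.γtilde S.b ω) =
      S.γtilde S.b ω ⬝ᵥ (S.Jtilde G S.b ω *ᵥ Δ) + S.τhat G S.b ω * Δ S.r := by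
    have e1 : S.γtilde S.b ω ⬝ᵥ (S.Jtilde G S.b ω *ᵥ Δ) =
        Δ ⬝ᵥ (S.Jtilde G S.b ω *ᵥ S.γtilde S.b ω) := by
      rw [Matrix.dotProduct_mulVec, ← Matrix.mulVec_transpose, hsym.eq, dotProduct_comm]
    have e2 : Δ ⬝ᵥ (S.Jtilde G S.b ω *ᵥ S.γtilde S.b ω) =
        Δ S.r * (S.Jtilde G S.b ω *ᵥ S.γtilde S.b ω) S.r +
          extend S.r 0 (fun k => Δ k.1) ⬝ᵥ (S.Jtilde G S.b ω *ᵥ S.γtilde S.b ω) := by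
      conv_lhs => rw [hdec]
      rw [add_dotProduct, single_dotProduct]
    rw [e1, e2, Jtilde_mulVec_γtilde_self]
    ring
  have h2 : S.γtilde S.b ω ⬝ᵥ (S.Jtilde G S.b ω *ᵥ Δ) = ∑ j ∈ Finset.Icc 1 S.b,
      S.γtilde S.b ω ⬝ᵥ (S.J G j (S.βhat j ω) ω *ᵥ Δ) := by
    unfold Jtilde
    rw [Matrix.sum_mulVec, dotProduct_sum]
  have h3 : S.τhat G S.b ω * (S.βon G ω - S.β₀ S.r) = S.τhat G S.b ω * Δ S.r +
      (∑ j ∈ Finset.Icc 1 S.b, ∑ i ∈ S.batch j,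
        S.zhat j i ω * (S.y i ω - G.g (S.x i ω ⬝ᵥ S.βhat j ω)) +
      ∑ j ∈ Finset.Icc 1 S.b,
        S.γtilde j ω ⬝ᵥ (S.J G j (S.βhat j ω) ω *ᵥ (S.βhat S.b ω - S.βhat j ω))) := by
    unfold βon
    rw [hΔ, Pi.sub_apply]
    field_simp
    ring
  rw [h3, h1, h2]
  have h4 : ∀ A B C D E F X : ℝ, A + B = D + (C + E) + F → X + (A + B) = D + (C + X + E + F) := by
    intros; linarith
  refine h4 _ _ _ _ _ _ _ ?_
  -- The remaining identity holds for each observation separately.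
  simp only [← Finset.sum_add_distrib]
  refine Finset.sum_congr rfl fun j _ => ?_
  rw [sub_dotProduct, add_sub_cancel, dotProduct_J_mulVec, dotProduct_J_mulVec]
  simp only [← Finset.sum_add_distrib]
  refine Finset.sum_congr rfl fun i _ => ?_
  rw [zhat_eq, hΔ]
  simp only [dotProduct_sub]
  ring

end Stream

/-! ### Bound on the remainder of the expansion. -/

namespace Stream

variable {Ω : Type*} {S : Stream Ω} {G : GLM} {Jpop : Matrix (Fin S.p) (Fin S.p) ℝ}
  {K M L δ κ K₂ K₃ C C₁ : ℝ} {ω : Ω}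

namespace GoodOutcome

lemma abs_dotProduct_J_mulVec_le (h : S.GoodOutcome G Jpop K M L δ K₂ K₃ C C₁ ω)
    (hK : 0 ≤ K) (hK₂ : 0 ≤ K₂) {j : ℕ} (hj : j ∈ Finset.Icc 1 S.b)
    (hβ : l1 (S.βhat j ω - S.β₀) ≤ δ) (u v : Fin S.p → ℝ) :
    |u ⬝ᵥ (S.J G j (S.βhat j ω) ω *ᵥ v)| ≤ K₂ * K ^ 2 * (S.N j * l1 u * l1 v) := by
  have hjb := (Finset.mem_Icc.1 hj).2
  rw [dotProduct_J_mulVec]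
  refine (Finset.abs_sum_le_sum_abs _ _).trans ?_
  have h1 : ∀ i ∈ S.batch j, |deriv G.g (S.x i ω ⬝ᵥ S.βhat j ω) * (S.x i ω ⬝ᵥ u) *
      (S.x i ω ⬝ᵥ v)| ≤ K₂ * (K * l1 u) * (K * l1 v) := by
    intro i hi
    have hib := S.lt_N_of_mem_batch hi hjb
    rw [abs_mul, abs_mul, abs_of_nonneg (G.deriv_g_nonneg _)]
    have hu := l1_nonneg u
    have e1 := h.deriv_le i hib _ hβ
    have e2 := abs_dotProduct_le_l1 (v := u) (h.bounded_x i hib)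
    have e3 := abs_dotProduct_le_l1 (v := v) (h.bounded_x i hib)
    gcongr
  refine (Finset.sum_le_sum h1).trans ?_
  rw [Finset.sum_const, nsmul_eq_mul]
  have hc : ((S.batch j).card : ℝ) ≤ S.N j := by
    rw [batch, Nat.card_Ico]
    exact_mod_cast Nat.sub_le _ _
  have hnn : 0 ≤ K₂ * (K * l1 u) * (K * l1 v) := by
    have := l1_nonneg u
    have := l1_nonneg v
    positivity
  calc ((S.batch j).card : ℝ) * (K₂ * (K * l1 u) * (K * l1 v))
      ≤ S.N j * (K₂ * (K * l1 u) * (K * l1 v)) := by gcongr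
    _ = _ := by ring

lemma abs_zhat_le (h : S.GoodOutcome G Jpop K M L δ K₂ K₃ C C₁ ω) {i j : ℕ}
    (hi : i < S.N S.b) : |S.zhat j i ω| ≤ K + M + K * l1 (S.γhat j ω - S.γ₀) := by
  have e : S.γtilde j ω = extend S.r (-1) S.γ₀ + extend S.r 0 (S.γhat j ω - S.γ₀) := by
    rw [← extend_add, add_zero, add_sub_cancel, γtilde_eq_extend]
  rw [zhat_eq, abs_neg, e, dotProduct_add]
  refine (abs_add_le _ _).trans (add_le_add (h.abs_dotProduct_extend_γ₀_le hi) ?_)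
  refine (abs_dotProduct_le_l1 (h.bounded_x i hi)).trans (le_of_eq ?_)
  rw [l1_extend, abs_zero, zero_add]

set_option maxHeartbeats 1000000 in
/-- Bound on the remainder of the expansion of the debiased estimator. -/
theorem abs_expansion_remainder_le (h : S.GoodOutcome G Jpop K M L δ K₂ K₃ C C₁ ω)
    (hK : 0 ≤ K) (hM : 0 ≤ M) (hL : 0 ≤ L) (hκ0 : 0 < κ) (hK₂ : 1 ≤ K₂) (hK₃ : 1 ≤ K₃)
    (hC0 : 0 < C) (hp : 1 ≤ Real.log S.p) {s₀ sr : ℝ} (hs₀ : 1 ≤ s₀) (hsr : 1 ≤ sr)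
    (hN0 : 0 < S.N 1) (hb : 1 ≤ S.b) {Γ : ℝ} (hN : S.SampleSizeBound Γ (16 * K₂ * K₃) s₀ sr)
    (hΓ : 1 ≤ Γ) (hτ : S.τhat G S.b ω ≠ 0)
    (hβ : ∀ j ∈ Finset.Icc 1 S.b, l1 (S.βhat j ω - S.β₀) ≤ δ ∧
      ∑ i ∈ Finset.range (S.N j), (S.x i ω ⬝ᵥ (S.βhat j ω - S.β₀)) ^ 2 ≤
        predConst κ K₂ K₃ C * ((16 * K₂ * K₃) ^ j * (s₀ * Real.log S.p)) ∧
      2 * C * √(S.N j * Real.log S.p) * l1 (S.βhat j ω - S.β₀) ≤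
        l1Const κ K₂ K₃ C * ((16 * K₂ * K₃) ^ j * (s₀ * Real.log S.p)))
    (hγ : ∀ j ∈ Finset.Icc 1 S.b, 2 * C * √(S.N j * Real.log S.p) * l1 (S.γhat j ω - S.γ₀) ≤
        projConst K M L κ K₂ K₃ C * ((16 * K₂ * K₃) ^ j * ((s₀ + sr) * Real.log S.p))) :
    |S.τhat G S.b ω * (S.βon G ω - S.β₀ S.r) - ∑ j ∈ Finset.Icc 1 S.b, ∑ i ∈ S.batch j,
        S.zhat j i ω * (S.y i ω - G.g (S.x i ω ⬝ᵥ S.β₀))| ≤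
      remConst K M L κ K₂ K₃ C *
        (S.b * ((16 * K₂ * K₃) ^ S.b) ^ 2 * ((s₀ + sr) * s₀ * Real.log S.p)) := by
  set ℓ := Real.log S.p with hℓ
  set a := 16 * K₂ * K₃ with ha
  have hK23 : 1 ≤ K₂ * K₃ := one_le_mul_of_one_le_of_one_le hK₂ hK₃
  have ha1 : 1 ≤ a := by rw [ha]; linarith
  have ha0 : 0 < a := by linarith
  have hs0 : 0 < s₀ := by linarith
  have hsr0 : 0 < sr := by linarith
  have hℓ0 : 0 < ℓ := by linarith
  have hK₃0 : 0 < K₃ := by linarith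
  have hK₂0 : 0 < K₂ := by linarith
  set CP := predConst κ K₂ K₃ C with hCP
  set CE := l1Const κ K₂ K₃ C with hCE
  set CG := projConst K M L κ K₂ K₃ C with hCG
  have hCP0 : 0 < CP := by rw [hCP, predConst, errConst]; positivity
  have hCE0 : 0 < CE := by rw [hCE, l1Const, predConst, errConst]; positivity
  have hCG0 : 0 < CG := by rw [hCG, projConst, plugInConst, predConst, errConst]; positivity
  have hbb : S.b ∈ Finset.Icc 1 S.b := Finset.mem_Icc.2 ⟨hb, le_rfl⟩
  have hNpos : ∀ j ∈ Finset.Icc 1 S.b, (0 : ℝ) < S.N j := fun j hj => by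
    exact_mod_cast hN0.trans_le (S.N_mono (Finset.mem_Icc.1 hj).1)
  have hb1 : (1 : ℝ) ≤ S.b := by exact_mod_cast hb
  set Δ := S.βhat S.b ω - S.β₀ with hΔ
  set A := a ^ S.b with hA
  have hA1 : 1 ≤ A := one_le_pow₀ ha1
  have hpow : ∀ j ∈ Finset.Icc 1 S.b, a ^ j ≤ A := fun j hj =>
    pow_le_pow_right₀ ha1 (Finset.mem_Icc.1 hj).2
  set X := CG / (2 * C) * (A * ((s₀ + sr) * ℓ)) with hX
  set Y := CE / (2 * C) * (A * (s₀ * ℓ)) with hY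
  have hX0 : 0 ≤ X := by positivity
  have hY0 : 0 ≤ Y := by positivity
  have hγX : ∀ j ∈ Finset.Icc 1 S.b, √(S.N j * ℓ) * l1 (S.γhat j ω - S.γ₀) ≤ X := by
    intro j hj
    have h1 := hγ j hj
    have h2 := hpow j hj
    have h3 : CG * (a ^ j * ((s₀ + sr) * ℓ)) ≤ CG * (A * ((s₀ + sr) * ℓ)) := by gcongr
    rw [hX, div_mul_eq_mul_div, le_div_iff₀ (by positivity)]
    linarith
  have hΔY : √(S.N S.b * ℓ) * l1 Δ ≤ Y := by
    have h1 := (hβ S.b hbb).2.2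
    rw [hY, div_mul_eq_mul_div, le_div_iff₀ (by positivity)]
    linarith
  -- The sample size dominates (a^j s₀ s_r)² log p and s₀ + s_r ≤ 2 s₀ s_r, so the projection errors
  -- are bounded, and with them the residuals `zhat`.
  have hγ1 : ∀ j ∈ Finset.Icc 1 S.b, l1 (S.γhat j ω - S.γ₀) ≤ CG / C := by
    intro j hj
    have h1 := hγ j hj
    have h2 := hN.mul_le hj ha0.le (by positivity) le_rfl (B := 1) (by simpa using hΓ)
    rw [← hℓ, one_mul] at h2
    have h3 : a ^ j * (s₀ * sr) * ℓ ≤ √(S.N j * ℓ) := by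
      refine Real.le_sqrt_of_sq_le ?_
      rw [mul_pow, sq ℓ, ← mul_assoc]
      refine mul_le_mul_of_nonneg_right (le_trans ?_ h2) hℓ0.le
      gcongr
      linarith [Nat.cast_nonneg (α := ℝ) j]
    have h4 : s₀ + sr ≤ 2 * (s₀ * sr) := by nlinarith
    have hsq : 0 < √(S.N j * ℓ) := Real.sqrt_pos.2 (mul_pos (hNpos j hj) hℓ0)
    have h5 : CG * (a ^ j * ((s₀ + sr) * ℓ)) ≤ CG * (2 * √(S.N j * ℓ)) := by
      refine mul_le_mul_of_nonneg_left ?_ hCG0.le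
      calc a ^ j * ((s₀ + sr) * ℓ) ≤ a ^ j * (2 * (s₀ * sr) * ℓ) := by gcongr
        _ = 2 * (a ^ j * (s₀ * sr) * ℓ) := by ring
        _ ≤ 2 * √(S.N j * ℓ) := by gcongr
    rw [le_div_iff₀ hC0]
    refine le_of_mul_le_mul_left ?_ (show 0 < 2 * √(S.N j * ℓ) by positivity)
    linarith
  rw [S.τhat_mul_βon_sub G ω hτ, add_sub_cancel_left]
  set Rs := (s₀ + sr) * s₀ * ℓ with hRs
  have hRs0 : 0 < Rs := by positivity
  have hsR : s₀ * ℓ ≤ Rs := by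
    rw [hRs, mul_assoc]
    exact le_mul_of_one_le_left (by positivity) (by linarith)
  have hbA : A ≤ S.b * A ^ 2 := by
    calc A ≤ A ^ 2 := le_self_pow₀ hA1 two_ne_zero
      _ ≤ S.b * A ^ 2 := le_mul_of_one_le_left (by positivity) hb1
  have b1 : |extend S.r 0 (fun k => Δ k.1) ⬝ᵥ (S.Jtilde G S.b ω *ᵥ S.γtilde S.b ω)| ≤
      CE * (S.b * A ^ 2 * Rs) := by
    refine (h.abs_extend_dotProduct_le hC0.le hbb (by exact_mod_cast hNpos _ hbb) _).trans ?_
    have e1 : l1 (fun k : {k // k ≠ S.r} => Δ k.1) ≤ l1 Δ := by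
      unfold l1
      rw [Fintype.sum_eq_add_sum_subtype_ne _ S.r]
      linarith [abs_nonneg (Δ S.r)]
    calc C * √(S.N S.b * ℓ) * l1 (fun k : {k // k ≠ S.r} => Δ k.1)
        ≤ C * √(S.N S.b * ℓ) * l1 Δ := by gcongr
      _ = C * (√(S.N S.b * ℓ) * l1 Δ) := by ring
      _ ≤ C * Y := by gcongr
      _ = CE / 2 * (A * (s₀ * ℓ)) := by rw [hY]; field_simp
      _ ≤ CE * (S.b * A ^ 2 * Rs) := by
          gcongr
          linarith
  have b2 : |∑ j ∈ Finset.Icc 1 S.b, (S.γtilde j ω - S.γtilde S.b ω) ⬝ᵥ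
      (S.J G j (S.βhat j ω) ω *ᵥ Δ)| ≤
      K₂ * K ^ 2 * (CG * CE / C ^ 2) * (S.b * A ^ 2 * Rs) := by
    have hterm : ∀ j ∈ Finset.Icc 1 S.b, |(S.γtilde j ω - S.γtilde S.b ω) ⬝ᵥ
        (S.J G j (S.βhat j ω) ω *ᵥ Δ)| ≤ K₂ * K ^ 2 * (CG * CE / C ^ 2) * (A ^ 2 * Rs) := by
      intro j hj
      refine (h.abs_dotProduct_J_mulVec_le hK hK₂0.le hj (hβ j hj).1 _ _).trans ?_
      have e1 : S.γtilde j ω - S.γtilde S.b ω =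
          extend S.r 0 ((S.γhat j ω - S.γ₀) - (S.γhat S.b ω - S.γ₀)) := by
        funext k
        by_cases hk : k = S.r <;> simp [γtilde, extend, hk]
      have e2 : l1 (S.γtilde j ω - S.γtilde S.b ω) ≤
          l1 (S.γhat j ω - S.γ₀) + l1 (S.γhat S.b ω - S.γ₀) := by
        rw [e1, l1_extend, abs_zero, zero_add]
        exact l1_sub_le _ _
      -- Since N_j ≤ N_b, the final errors obey their bounds at the scale of batch j too. The
      -- product of two errors at scale √(N_j ℓ) then supplies the factor N_j.
      have e3 : √(S.N j * ℓ) ≤ √(S.N S.b * ℓ) := by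
        gcongr
        exact_mod_cast S.N_mono (Finset.mem_Icc.1 hj).2
      have e4 : √(S.N j * ℓ) * l1 (S.γtilde j ω - S.γtilde S.b ω) ≤ 2 * X := by
        have f1 := hγX j hj
        have f2 := hγX S.b hbb
        have f3 : √(S.N j * ℓ) * l1 (S.γhat S.b ω - S.γ₀) ≤
            √(S.N S.b * ℓ) * l1 (S.γhat S.b ω - S.γ₀) :=
          mul_le_mul_of_nonneg_right e3 (l1_nonneg _)
        have f4 := mul_le_mul_of_nonneg_left e2 (Real.sqrt_nonneg (S.N j * ℓ))
        linarith
      have e5 : √(S.N j * ℓ) * l1 Δ ≤ Y :=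
        (mul_le_mul_of_nonneg_right e3 (l1_nonneg _)).trans hΔY
      have e6 : S.N j * l1 (S.γtilde j ω - S.γtilde S.b ω) * l1 Δ * ℓ ≤ 2 * X * Y := by
        have f0 : √(S.N j * ℓ) * √(S.N j * ℓ) = S.N j * ℓ :=
          Real.mul_self_sqrt (mul_nonneg (hNpos j hj).le hℓ0.le)
        calc S.N j * l1 (S.γtilde j ω - S.γtilde S.b ω) * l1 Δ * ℓ
            = (S.N j * ℓ) * (l1 (S.γtilde j ω - S.γtilde S.b ω) * l1 Δ) := by ring
          _ = (√(S.N j * ℓ) * l1 (S.γtilde j ω - S.γtilde S.b ω)) *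
                (√(S.N j * ℓ) * l1 Δ) := by
              linear_combination (-(l1 (S.γtilde j ω - S.γtilde S.b ω) * l1 Δ)) * f0
          _ ≤ 2 * X * Y := mul_le_mul e4 e5
              (mul_nonneg (Real.sqrt_nonneg _) (l1_nonneg _)) (by positivity)
      have e7 : 2 * X * Y = CG * CE / (2 * C ^ 2) * (A ^ 2 * Rs) * ℓ := by
        rw [hX, hY, hRs]; field_simp
      rw [e7] at e6
      have e8 := le_of_mul_le_mul_right e6 hℓ0
      rw [mul_assoc (K₂ * K ^ 2)]
      refine mul_le_mul_of_nonneg_left (e8.trans ?_) (by positivity)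
      gcongr
      nlinarith [sq_nonneg C]
    refine (Finset.abs_sum_le_sum_abs _ _).trans ((Finset.sum_le_sum hterm).trans ?_)
    rw [Finset.sum_const, Nat.card_Icc, nsmul_eq_mul]
    simp only [Nat.add_sub_cancel]
    exact le_of_eq (by ring)
  -- Bounded residuals multiply quadratic Taylor errors, whose sum over a batch is part of the
  -- squared prediction error.
  have b3 : |∑ j ∈ Finset.Icc 1 S.b, ∑ i ∈ S.batch j, S.zhat j i ω *
      (G.g (S.x i ω ⬝ᵥ S.β₀) - G.g (S.x i ω ⬝ᵥ S.βhat j ω) +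
        deriv G.g (S.x i ω ⬝ᵥ S.βhat j ω) * (S.x i ω ⬝ᵥ (S.βhat j ω - S.β₀)))| ≤
      L * (K + M + K * (CG / C)) * CP * (S.b * A ^ 2 * Rs) := by
    have hterm : ∀ j ∈ Finset.Icc 1 S.b, |∑ i ∈ S.batch j, S.zhat j i ω *
      (G.g (S.x i ω ⬝ᵥ S.β₀) - G.g (S.x i ω ⬝ᵥ S.βhat j ω) +
        deriv G.g (S.x i ω ⬝ᵥ S.βhat j ω) * (S.x i ω ⬝ᵥ (S.βhat j ω - S.β₀)))| ≤
        L * (K + M + K * (CG / C)) * CP * (A ^ 2 * Rs) := by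
      intro j hj
      have hP := (hβ j hj).2.1
      rw [S.sum_range_N_eq (j := j)] at hP
      have hP0 : 0 ≤ ∑ i ∈ Finset.range (S.N (j - 1)),
          (S.x i ω ⬝ᵥ (S.βhat j ω - S.β₀)) ^ 2 := Finset.sum_nonneg fun _ _ => sq_nonneg _
      refine (Finset.abs_sum_le_sum_abs _ _).trans ?_
      calc ∑ i ∈ S.batch j, |S.zhat j i ω *
            (G.g (S.x i ω ⬝ᵥ S.β₀) - G.g (S.x i ω ⬝ᵥ S.βhat j ω) +
            deriv G.g (S.x i ω ⬝ᵥ S.βhat j ω) * (S.x i ω ⬝ᵥ (S.βhat j ω - S.β₀)))|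
          ≤ ∑ i ∈ S.batch j, (K + M + K * (CG / C)) *
              (L * (S.x i ω ⬝ᵥ (S.βhat j ω - S.β₀)) ^ 2) := by
            refine Finset.sum_le_sum fun i hi => ?_
            have hib := S.lt_N_of_mem_batch hi (Finset.mem_Icc.1 hj).2
            rw [abs_mul]
            refine mul_le_mul ?_ (h.abs_g_expansion_le hL hib (hβ j hj).1) (abs_nonneg _)
              (by positivity)
            refine (h.abs_zhat_le hib).trans ?_
            have := hγ1 j hj
            gcongr
        _ = L * (K + M + K * (CG / C)) *
              ∑ i ∈ S.batch j, (S.x i ω ⬝ᵥ (S.βhat j ω - S.β₀)) ^ 2 := by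
            rw [Finset.mul_sum]
            exact Finset.sum_congr rfl fun i _ => by ring
        _ ≤ L * (K + M + K * (CG / C)) * (CP * (a ^ j * (s₀ * ℓ))) := by
            refine mul_le_mul_of_nonneg_left ?_ (by positivity)
            linarith
        _ ≤ L * (K + M + K * (CG / C)) * (CP * (A ^ 2 * Rs)) := by
            have : a ^ j ≤ A ^ 2 := (hpow j hj).trans (le_self_pow₀ hA1 two_ne_zero)
            gcongr
        _ = _ := by ring
    refine (Finset.abs_sum_le_sum_abs _ _).trans ((Finset.sum_le_sum hterm).trans ?_)
    rw [Finset.sum_const, Nat.card_Icc, nsmul_eq_mul]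
    simp only [Nat.add_sub_cancel]
    exact le_of_eq (by ring)
  refine (abs_add_le _ _).trans ((add_le_add ((abs_add_le _ _).trans (add_le_add b1 b2)) b3).trans
    (le_of_eq ?_))
  rw [remConst, ← hCE, ← hCG, ← hCP]
  ring

end GoodOutcome

end Stream

/-! ### Population matrix: curvature, normal equations, sparsity of the projection. -/

/-- A symmetric matrix whose eigenvalues are at least `κ` is bounded below by `κ`. -/
lemma mul_sum_sq_le_of_eigenvalue {p : ℕ} {A : Matrix (Fin p) (Fin p) ℝ} (hA : A.IsSymm) {κ : ℝ}
    (h : ∀ t : ℝ, Module.End.HasEigenvalue (Matrix.toLin' A) t → κ ≤ t) (u : Fin p → ℝ) :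
    κ * ∑ k, u k ^ 2 ≤ u ⬝ᵥ (A *ᵥ u) := by
  have hB : (A - κ • (1 : Matrix (Fin p) (Fin p) ℝ)).IsHermitian := by
    rw [Matrix.IsHermitian, Matrix.conjTranspose_eq_transpose_of_trivial, Matrix.transpose_sub,
      Matrix.transpose_smul, Matrix.transpose_one, hA.eq]
  have hpos : (A - κ • (1 : Matrix (Fin p) (Fin p) ℝ)).PosSemidef := by
    rw [hB.posSemidef_iff_eigenvalues_nonneg]
    intro i
    simp only [Pi.zero_apply]
    have h1 := hB.mulVec_eigenvectorBasis i
    set v : Fin p → ℝ := ⇑(hB.eigenvectorBasis i) with hv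
    have hv0 : v ≠ 0 := by
      intro h0
      have : hB.eigenvectorBasis i = 0 := by
        ext k
        exact congrFun h0 k
      exact hB.eigenvectorBasis.orthonormal.ne_zero i this
    have h2 : A *ᵥ v = (hB.eigenvalues i + κ) • v := by
      rw [Matrix.sub_mulVec, Matrix.smul_mulVec, Matrix.one_mulVec] at h1
      rw [add_smul, ← h1]
      abel
    have h3 := h _ (Module.End.hasEigenvalue_of_hasEigenvector
      (Module.End.hasEigenvector_iff.2 ⟨Module.End.mem_eigenspace_iff.2
        (by rw [Matrix.toLin'_apply]; exact h2), hv0⟩))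
    linarith
  have h4 := hpos.dotProduct_mulVec_nonneg u
  rw [star_trivial, Matrix.sub_mulVec, Matrix.smul_mulVec, Matrix.one_mulVec, dotProduct_sub,
    dotProduct_smul, smul_eq_mul] at h4
  have h5 : u ⬝ᵥ u = ∑ k, u k ^ 2 := Finset.sum_congr rfl fun k _ => (sq _).symm
  rw [← h5]
  linarith

/-- Normal equations for the population projection. -/
lemma mulVec_extend_eq_zero_of_isMinOn {p : ℕ} {A : Matrix (Fin p) (Fin p) ℝ} (hA : A.IsSymm)
    {r : Fin p} {γ : {k // k ≠ r} → ℝ} (h : IsMinOn (projQuad A r) Set.univ γ) {k : Fin p}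
    (hk : k ≠ r) : (A *ᵥ extend r (-1) γ) k = 0 := by
  set u := extend r (-1) γ with hu
  have key : ∀ d : {k // k ≠ r} → ℝ, 0 ≤ extend r 0 d ⬝ᵥ (A *ᵥ u) := by
    intro d
    set e := extend r 0 d with he
    have h1 : ∀ t : ℝ, 0 < t → t ≤ 1 → 0 ≤ 2 * (e ⬝ᵥ (A *ᵥ u)) + t * (e ⬝ᵥ (A *ᵥ e)) := by
      intro t ht _
      have hmin : projQuad A r γ ≤ projQuad A r (γ + t • d) := h (Set.mem_univ _)
      have hext : extend r (-1) (γ + t • d) = u + t • e := by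
        have := extend_add (r := r) (-1) 0 γ (t • d)
        rw [add_zero] at this
        rw [this]
        congr 1
        funext k
        by_cases hk : k = r <;> simp [he, extend, hk]
      have hcomm : u ⬝ᵥ (A *ᵥ e) = e ⬝ᵥ (A *ᵥ u) := by
        rw [Matrix.dotProduct_mulVec, ← Matrix.mulVec_transpose, hA.eq, dotProduct_comm]
      rw [projQuad_eq_extend hA, projQuad_eq_extend hA, hext, Matrix.mulVec_add,
        Matrix.mulVec_smul, add_dotProduct, dotProduct_add, dotProduct_add, smul_dotProduct,
        smul_dotProduct, dotProduct_smul, dotProduct_smul, hcomm, ← hu] at hmin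
      simp only [smul_eq_mul] at hmin
      refine nonneg_of_mul_nonneg_right (a := t) ?_ ht
      linarith
    linarith [le_of_forall_le_add_mul h1]
  have h1 := key (Pi.single ⟨k, hk⟩ 1)
  have h2 := key (-Pi.single ⟨k, hk⟩ 1)
  have e1 : extend r 0 (Pi.single (⟨k, hk⟩ : {k // k ≠ r}) (1 : ℝ)) = Pi.single k 1 := by
    funext l
    by_cases hl : l = r
    · subst hl
      simp [Ne.symm hk]
    · by_cases hlk : l = k
      · subst hlk; simp [extend, hl]
      · simp [extend, hl, hlk]
  have e2 : extend r 0 (-Pi.single (⟨k, hk⟩ : {k // k ≠ r}) (1 : ℝ)) = -Pi.single k 1 := by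
    rw [← e1]
    funext l
    by_cases hl : l = r <;> simp [extend, hl]
  rw [e1, single_one_dotProduct] at h1
  rw [e2, neg_dotProduct, single_one_dotProduct] at h2
  linarith

/-- The projection coefficients vanish where the column of the inverse matrix does. -/
lemma card_support_le_of_isMinOn {p : ℕ} {A : Matrix (Fin p) (Fin p) ℝ} (hA : A.IsSymm)
    {κ : ℝ} (hκ0 : 0 < κ) (hκ : ∀ u : Fin p → ℝ, κ * ∑ k, u k ^ 2 ≤ u ⬝ᵥ (A *ᵥ u))
    {r : Fin p} {γ : {k // k ≠ r} → ℝ} (h : IsMinOn (projQuad A r) Set.univ γ) :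
    Nat.card {k // γ k ≠ 0} ≤ Nat.card {k // k ≠ r ∧ A⁻¹ k r ≠ 0} := by
  have hdet : A.det ≠ 0 := by
    intro h0
    obtain ⟨v, hv0, hv⟩ := Matrix.exists_mulVec_eq_zero_iff.2 h0
    have h1 := hκ v
    rw [hv, dotProduct_zero] at h1
    refine hv0 (funext fun k => ?_)
    have h2 : ∑ k, v k ^ 2 = 0 :=
      le_antisymm (nonpos_of_mul_nonpos_right h1 hκ0) (Finset.sum_nonneg fun _ _ => sq_nonneg _)
    have h3 := (Finset.sum_eq_zero_iff_of_nonneg (fun k _ => sq_nonneg (v k))).1 h2 k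
      (Finset.mem_univ _)
    simpa using h3
  -- By the normal equations the matrix sends the extended projection to a multiple of the r-th unit
  -- vector, so that projection is a multiple of column r of the inverse.
  have hAu : A *ᵥ extend r (-1) γ = Pi.single r ((A *ᵥ extend r (-1) γ) r) := by
    funext k
    by_cases hk : k = r
    · subst hk; simp
    · rw [mulVec_extend_eq_zero_of_isMinOn hA h hk, Pi.single_apply, if_neg hk]
  have hu : ∀ k, extend r (-1) γ k = A⁻¹ k r * (A *ᵥ extend r (-1) γ) r := by
    intro k
    have h1 : A⁻¹ *ᵥ (A *ᵥ extend r (-1) γ) = extend r (-1) γ := by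
      rw [Matrix.mulVec_mulVec, Matrix.nonsing_inv_mul _ (isUnit_iff_ne_zero.2 hdet),
        Matrix.one_mulVec]
    rw [← congrFun h1 k]
    conv_lhs => rw [hAu]
    rw [Matrix.mulVec_single]
    simp
  refine Nat.card_le_card_of_injective
    (fun k : {k // γ k ≠ 0} => (⟨k.1.1, k.1.2, fun h0 => k.2 ?_⟩ :
      {k // k ≠ r ∧ A⁻¹ k r ≠ 0})) ?_
  · have := hu k.1.1
    rw [extend_ne, h0, zero_mul] at this
    exact this
  · intro k l hkl
    simp only [Subtype.mk.injEq] at hkl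
    exact Subtype.ext (Subtype.ext hkl)

/-- Independence is assumed for a family indexed by `Fin`, while batches are sets of natural
numbers. -/
lemma sum_attachFin {n : ℕ} (T : Finset ℕ) (hT : ∀ i ∈ T, i < n) (f : ℕ → ℝ) :
    ∑ i ∈ T.attachFin hT, f i = ∑ i ∈ T, f i := by
  conv_rhs => rw [← Finset.map_valEmbedding_attachFin hT]
  rw [Finset.sum_map]
  rfl

/-! ### Concentration: the probability of a good outcome. -/

namespace Stream

variable {Ω : Type*} {S : Stream Ω} {G : GLM} [MeasurableSpace Ω] {μ : Measure Ω}
  {K M L δ κ K₂ K₃ : ℝ}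

/-- Allows the upper bounds to be raised to at least one, while δ and κ stay fixed. -/
lemma Regular.mono {K' M' L' K₂' K₃' : ℝ} (h : S.Regular G μ K M L δ K₂ K₃ κ) (hK : K ≤ K')
    (hM : M ≤ M') (hL : L ≤ L') (hK₂ : K₂ ≤ K₂') (hK₃ : K₃ ≤ K₃') :
    S.Regular G μ K' M' L' δ K₂' K₃' κ where
  bounded_x := h.bounded_x.mono fun _ hω i hi k => (hω i hi k).trans hK
  isMinOn_γ₀ := h.isMinOn_γ₀
  bounded_predictor := h.bounded_predictor.mono fun _ hω i hi => (hω i hi).trans hM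
  bounded_projection := h.bounded_projection.mono fun _ hω i hi => (hω i hi).trans hM
  lipschitz := h.lipschitz.mono fun _ hω i hi β β' hβ hβ' =>
    (hω i hi β β' hβ hβ').trans (mul_le_mul_of_nonneg_right hL (abs_nonneg _))
  bounded_deriv := h.bounded_deriv.mono fun _ hω i hi β hβ => (hω i hi β hβ).trans hK₂
  bounded_inv_deriv := h.bounded_inv_deriv.mono fun _ hω i hi β hβ =>
    ⟨(hω i hi β hβ).1, (hω i hi β hβ).2.trans hK₃⟩
  eigenvalue := h.eigenvalue

lemma popJ_isSymm : (S.popJ G μ).IsSymm := by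
  ext k l
  simp only [popJ, Matrix.transpose_apply, Matrix.of_apply]
  congr 2
  funext ω
  exact (S.J_isSymm G 1 S.β₀ ω).apply k l

/-- Chernoff bound for sums of a fixed function of the observations. -/
lemma IsSample.measure_abs_sum_gt_le (hS : S.IsSample G μ) {F : (Fin S.p → ℝ) × ℝ → ℝ}
    (hF : Measurable F) {T : Finset ℕ} (hT : ∀ i ∈ T, i < S.N S.b) {σ q N t : ℝ} (hσ : 0 ≤ σ)
    (hN0 : 0 < N) (hN : (T.card : ℝ) ≤ N) (ht : 0 ≤ t)
    (h : ∀ i ∈ T, ∀ θ : ℝ, |θ| = √(t / N) →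
      Integrable (fun ω => Real.exp (θ * F (S.x i ω, S.y i ω))) μ ∧
        mgf (fun ω => F (S.x i ω, S.y i ω)) μ θ ≤ Real.exp (σ * θ ^ 2)) :
    μ {ω | (σ + q) * √(N * t) < |∑ i ∈ T, F (S.x i ω, S.y i ω)|} ≤
      ENNReal.ofReal (2 * Real.exp (-(q * t))) := by
  have hind : iIndepFun (fun (i : Fin (S.N S.b)) ω => F (S.x i ω, S.y i ω)) μ :=
    hS.indep.comp (fun _ => F) (fun _ => hF)
  have hm : ∀ i : Fin (S.N S.b), Measurable fun ω => F (S.x i ω, S.y i ω) := fun i =>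
    hF.comp ((hS.measurable_x i i.2).prodMk (hS.measurable_y i i.2))
  have := OnlineGLM.measure_abs_sum_gt_le (q := q) hind hm (T.attachFin hT) hσ hN0
    (by rwa [Finset.card_attachFin]) ht
    (fun i hi θ hθ => h i (Finset.mem_attachFin hT |>.1 hi) θ hθ)
  have e : ∀ ω, ∑ i ∈ T.attachFin hT, F (S.x i ω, S.y i ω) =
      ∑ i ∈ T, F (S.x i ω, S.y i ω) := fun ω =>
    sum_attachFin T hT fun i => F (S.x i ω, S.y i ω)
  simpa only [e] using this

lemma measurable_dotProduct_left {p : ℕ} (u : Fin p → ℝ) :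
    Measurable fun z : (Fin p → ℝ) × ℝ => z.1 ⬝ᵥ u := by
  unfold dotProduct
  fun_prop

/-- The score is sub-Gaussian near the origin. -/
lemma IsSample.integrable_exp_score_and_mgf_le [IsProbabilityMeasure μ] (hS : S.IsSample G μ)
    (hR : S.Regular G μ K M L δ K₂ K₃ κ) (hK₂ : 0 ≤ K₂) {i : ℕ} (hi : i < S.N S.b)
    (k : Fin S.p) {θ : ℝ} (hθ : 2 * G.φ * |θ| ≤ δ) :
    Integrable (fun ω => Real.exp (θ * ((S.y i ω - G.g (S.x i ω ⬝ᵥ S.β₀)) * S.x i ω k))) μ ∧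
      mgf (fun ω => (S.y i ω - G.g (S.x i ω ⬝ᵥ S.β₀)) * S.x i ω k) μ θ ≤
        Real.exp (2 * G.φ * K₂ * K ^ 2 * θ ^ 2) := by
  have hφ := G.φ_pos
  have hg : Measurable G.g := G.differentiable_g.continuous.measurable
  set h : (Fin S.p → ℝ) × ℝ → ℝ := fun z =>
    Real.exp (θ * ((z.2 - G.g (z.1 ⬝ᵥ S.β₀)) * z.1 k)) with hh
  have hm : Measurable h := by
    have h1 : Measurable fun z : (Fin S.p → ℝ) × ℝ => G.g (z.1 ⬝ᵥ S.β₀) :=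
      hg.comp (measurable_dotProduct_left S.β₀)
    have h2 : Measurable fun z : (Fin S.p → ℝ) × ℝ => z.1 k :=
      (measurable_pi_apply k).comp measurable_fst
    exact (((measurable_snd.sub h1).mul h2).const_mul θ).exp
  have hbound : ∫⁻ ω, ENNReal.ofReal (h (S.x i ω, S.y i ω)) ∂μ ≤
      ENNReal.ofReal (Real.exp (2 * G.φ * K₂ * K ^ 2 * θ ^ 2)) := by
    rw [hS.lintegral_comp hi hm.ennreal_ofReal]
    calc _ ≤ ∫⁻ _ω, ENNReal.ofReal (Real.exp (2 * G.φ * K₂ * K ^ 2 * θ ^ 2)) ∂μ := by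
          refine lintegral_mono_ae ?_
          filter_upwards [hR.bounded_x, hR.bounded_deriv] with ω hx hd
          have e := G.lintegral_exp_mul_density (S.x i ω ⬝ᵥ S.β₀) (θ * S.x i ω k)
          have e' : ∀ y, h (S.x i ω, y) =
              Real.exp (θ * S.x i ω k * (y - G.g (S.x i ω ⬝ᵥ S.β₀))) := by
            intro y; simp only [hh]; ring_nf
          simp only [e']
          rw [e]
          refine ENNReal.ofReal_le_ofReal (Real.exp_le_exp.2 ?_)
          have hb := G.cumulant_bregman_le (η := S.x i ω ⬝ᵥ S.β₀)
            (t := 2 * G.φ * (θ * S.x i ω k)) (K₂ := K₂) (fun s hs => by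
              -- The tilted predictor is xᵀβ for a β that differs from `β₀` in coordinate k alone,
              -- by at most 2 φ |θ| ≤ δ. This is why only small θ are admitted.
              have h3 := hd i hi (S.β₀ + Pi.single k (s * (2 * G.φ * θ))) (by
                rw [add_sub_cancel_left]
                unfold l1
                rw [Finset.sum_eq_single k (fun l _ hl => by simp [hl]) (by simp),
                  Pi.single_eq_same, abs_mul, abs_of_nonneg hs.1, abs_mul,
                  abs_of_pos (by positivity : 0 < 2 * G.φ)]
                exact (mul_le_of_le_one_left (by positivity) hs.2).trans hθ)
              rw [dotProduct_add, dotProduct_single] at h3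
              refine (le_of_eq ?_).trans ((le_abs_self _).trans h3)
              congr 1
              ring)
          rw [div_le_iff₀ (by positivity)]
          refine hb.trans ?_
          have hxk : S.x i ω k ^ 2 ≤ K ^ 2 := by
            have := hx i hi k
            rw [← sq_abs]
            gcongr
          calc K₂ * (2 * G.φ * (θ * S.x i ω k)) ^ 2
              = 4 * G.φ ^ 2 * K₂ * θ ^ 2 * S.x i ω k ^ 2 := by ring
            _ ≤ 4 * G.φ ^ 2 * K₂ * θ ^ 2 * K ^ 2 := by gcongr
            _ = 2 * G.φ * K₂ * K ^ 2 * θ ^ 2 * (2 * G.φ) := by ring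
      _ = _ := by simp
  have hm' : Measurable fun ω => h (S.x i ω, S.y i ω) :=
    hm.comp ((hS.measurable_x i hi).prodMk (hS.measurable_y i hi))
  have hnn : 0 ≤ᵐ[μ] fun ω => h (S.x i ω, S.y i ω) := ae_of_all _ fun ω => (Real.exp_pos _).le
  refine ⟨⟨hm'.aestronglyMeasurable, ?_⟩, ?_⟩
  · rw [hasFiniteIntegral_iff_ofReal hnn]
    exact hbound.trans_lt ENNReal.ofReal_lt_top
  · unfold mgf
    rw [integral_eq_lintegral_of_nonneg_ae hnn hm'.aestronglyMeasurable]
    exact ENNReal.toReal_le_of_le_ofReal (Real.exp_pos _).le hbound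

end Stream

namespace Stream

variable {Ω : Type*} {S : Stream Ω} {G : GLM} [MeasurableSpace Ω] {μ : Measure Ω}
  {K M L δ κ K₂ K₃ C : ℝ}

lemma measurable_deriv_g_dotProduct (G : GLM) {p : ℕ} (u : Fin p → ℝ) :
    Measurable fun z : (Fin p → ℝ) × ℝ => deriv G.g (z.1 ⬝ᵥ u) :=
  (measurable_deriv G.g).comp (measurable_dotProduct_left u)

lemma measurable_info (G : GLM) {p : ℕ} (u : Fin p → ℝ) (k l : Fin p) :
    Measurable fun z : (Fin p → ℝ) × ℝ => deriv G.g (z.1 ⬝ᵥ u) * z.1 k * z.1 l :=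
  ((measurable_deriv_g_dotProduct G u).mul ((measurable_pi_apply k).comp measurable_fst)).mul
    ((measurable_pi_apply l).comp measurable_fst)

lemma Regular.abs_deriv_le (hR : S.Regular G μ K M L δ K₂ K₃ κ) (hδ : 0 ≤ δ) :
    ∀ᵐ ω ∂μ, ∀ i < S.N S.b, |deriv G.g (S.x i ω ⬝ᵥ S.β₀)| ≤ K₂ :=
  hR.bounded_deriv.mono fun _ hω i hi => hω i hi S.β₀ (by simpa [l1] using hδ)

lemma Regular.abs_info_le (hR : S.Regular G μ K M L δ K₂ K₃ κ) (hδ : 0 ≤ δ) :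
    ∀ᵐ ω ∂μ, ∀ i < S.N S.b, ∀ k l,
      |deriv G.g (S.x i ω ⬝ᵥ S.β₀) * S.x i ω k * S.x i ω l| ≤ K₂ * K ^ 2 := by
  filter_upwards [hR.abs_deriv_le hδ, hR.bounded_x] with ω hd hx i hi k l
  have h1 := hd i hi
  have h2 := hx i hi k
  have h3 := hx i hi l
  have hK₂ : 0 ≤ K₂ := (abs_nonneg _).trans h1
  have hK : 0 ≤ K := (abs_nonneg _).trans h2
  rw [abs_mul, abs_mul]
  calc |deriv G.g (S.x i ω ⬝ᵥ S.β₀)| * |S.x i ω k| * |S.x i ω l| ≤ K₂ * K * K := by gcongr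
    _ = K₂ * K ^ 2 := by ring

section

variable [IsProbabilityMeasure μ]

lemma IsSample.integrable_info (hS : S.IsSample G μ) (hR : S.Regular G μ K M L δ K₂ K₃ κ)
    (hδ : 0 ≤ δ) {i : ℕ} (hi : i < S.N S.b) (k l : Fin S.p) :
    Integrable (fun ω => deriv G.g (S.x i ω ⬝ᵥ S.β₀) * S.x i ω k * S.x i ω l) μ := by
  refine Integrable.of_bound (C := K₂ * K ^ 2) ?_ ?_
  · exact ((measurable_info G S.β₀ k l).comp
      ((hS.measurable_x i hi).prodMk (hS.measurable_y i hi))).aestronglyMeasurable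
  · exact (hR.abs_info_le hδ).mono fun ω hω => hω i hi k l

/-- The population information matrix is the expected information of one observation. -/
lemma IsSample.popJ_apply (hS : S.IsSample G μ) (hR : S.Regular G μ K M L δ K₂ K₃ κ)
    (hδ : 0 ≤ δ) (hb : 1 ≤ S.b) (hN : 0 < S.N 1) {i : ℕ} (hi : i < S.N S.b) (k l : Fin S.p) :
    S.popJ G μ k l = ∫ ω, deriv G.g (S.x i ω ⬝ᵥ S.β₀) * S.x i ω k * S.x i ω l ∂μ := by
  have hlt : ∀ i' ∈ S.batch 1, i' < S.N S.b := fun i' hi' => S.lt_N_of_mem_batch hi' hb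
  simp only [popJ, J, Matrix.of_apply]
  rw [integral_finsetSum _ fun i' hi' => hS.integrable_info hR hδ (hlt i' hi') k l]
  have h1 : ∀ i' ∈ S.batch 1,
      ∫ ω, deriv G.g (S.x i' ω ⬝ᵥ S.β₀) * S.x i' ω k * S.x i' ω l ∂μ =
      ∫ ω, deriv G.g (S.x i ω ⬝ᵥ S.β₀) * S.x i ω k * S.x i ω l ∂μ := fun i' hi' =>
    ((hS.ident i' (hlt i' hi') i hi).comp (measurable_info G S.β₀ k l)).integral_eq
  rw [Finset.sum_congr rfl h1, Finset.sum_const]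
  have hc : (S.batch 1).card = S.N 1 := by simp [batch, N_zero]
  have hN' : (S.N 1 : ℝ) ≠ 0 := by exact_mod_cast hN.ne'
  rw [hc, nsmul_eq_mul]
  field_simp

/-- Concentration of the empirical information. -/
lemma IsSample.integrable_exp_info_and_mgf_le (hS : S.IsSample G μ)
    (hR : S.Regular G μ K M L δ K₂ K₃ κ) (hδ : 0 ≤ δ) (hb : 1 ≤ S.b) (hN : 0 < S.N 1) {i : ℕ}
    (hi : i < S.N S.b) (k l : Fin S.p) (θ : ℝ) :
    Integrable (fun ω => Real.exp (θ * (deriv G.g (S.x i ω ⬝ᵥ S.β₀) * S.x i ω k * S.x i ω l -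
      S.popJ G μ k l))) μ ∧
      mgf (fun ω => deriv G.g (S.x i ω ⬝ᵥ S.β₀) * S.x i ω k * S.x i ω l - S.popJ G μ k l) μ θ ≤
        Real.exp ((2 * K₂ * K ^ 2) ^ 2 * θ ^ 2) := by
  have hm := (measurable_info G S.β₀ k l).comp
    ((hS.measurable_x i hi).prodMk (hS.measurable_y i hi))
  have hint := hS.integrable_info hR hδ hi k l
  have hJ := hS.popJ_apply hR hδ hb hN hi k l
  have hJle : |S.popJ G μ k l| ≤ K₂ * K ^ 2 := by
    rw [hJ, ← Real.norm_eq_abs]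
    have := norm_integral_le_of_norm_le_const (μ := μ) (C := K₂ * K ^ 2)
      (f := fun ω => deriv G.g (S.x i ω ⬝ᵥ S.β₀) * S.x i ω k * S.x i ω l) ((hR.abs_info_le hδ).mono fun ω hω => hω i hi k l)
    simpa using this
  refine integrable_exp_and_mgf_le_of_abs_le (hm.sub_const _) ?_ ?_ θ
  · filter_upwards [hR.abs_info_le hδ] with ω hω
    refine (abs_sub _ _).trans ?_
    have := hω i hi k l
    simp only [Function.comp_apply]
    linarith
  · simp only [Function.comp_apply]
    rw [integral_sub hint (integrable_const _), ← hJ]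
    simp

/-- Concentration of the projection residuals. -/
lemma IsSample.integrable_exp_resid_and_mgf_le (hS : S.IsSample G μ)
    (hR : S.Regular G μ K M L δ K₂ K₃ κ) (hδ : 0 ≤ δ) (hb : 1 ≤ S.b) (hN : 0 < S.N 1) {i : ℕ}
    (hi : i < S.N S.b) {k : Fin S.p} (hk : k ≠ S.r) (θ : ℝ) :
    Integrable (fun ω => Real.exp (θ * (deriv G.g (S.x i ω ⬝ᵥ S.β₀) * S.x i ω k *
      (S.x i ω ⬝ᵥ extend S.r (-1) S.γ₀)))) μ ∧
      mgf (fun ω => deriv G.g (S.x i ω ⬝ᵥ S.β₀) * S.x i ω k *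
        (S.x i ω ⬝ᵥ extend S.r (-1) S.γ₀)) μ θ ≤
        Real.exp ((K₂ * K * (K + M)) ^ 2 * θ ^ 2) := by
  have hm : Measurable fun ω => deriv G.g (S.x i ω ⬝ᵥ S.β₀) * S.x i ω k *
      (S.x i ω ⬝ᵥ extend S.r (-1) S.γ₀) :=
    (((measurable_deriv_g_dotProduct G S.β₀).mul
      ((measurable_pi_apply k).comp measurable_fst)).mul
      (measurable_dotProduct_left (extend S.r (-1) S.γ₀))).comp
    ((hS.measurable_x i hi).prodMk (hS.measurable_y i hi))
  refine integrable_exp_and_mgf_le_of_abs_le hm ?_ ?_ θ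
  · filter_upwards [hR.abs_deriv_le hδ, hR.bounded_x, hR.bounded_projection] with ω hd hx hp
    have h1 := hd i hi
    have h2 := hx i hi k
    have h3 : |S.x i ω ⬝ᵥ extend S.r (-1) S.γ₀| ≤ K + M := by
      rw [dotProduct_extend]
      refine (abs_add_le _ _).trans (add_le_add ?_ (hp i hi))
      simpa using hx i hi S.r
    have hK₂ : 0 ≤ K₂ := (abs_nonneg _).trans h1
    have hK : 0 ≤ K := (abs_nonneg _).trans h2
    rw [abs_mul, abs_mul]
    gcongr
  · have e : ∀ ω, deriv G.g (S.x i ω ⬝ᵥ S.β₀) * S.x i ω k *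
        (S.x i ω ⬝ᵥ extend S.r (-1) S.γ₀) = ∑ l, deriv G.g (S.x i ω ⬝ᵥ S.β₀) * S.x i ω k *
          S.x i ω l * extend S.r (-1) S.γ₀ l := by
      intro ω
      generalize deriv G.g (S.x i ω ⬝ᵥ S.β₀) = c
      rw [dotProduct, Finset.mul_sum]
      exact Finset.sum_congr rfl fun l _ => by ring
    simp only [e]
    rw [integral_finsetSum _ fun l _ => (hS.integrable_info hR hδ hi k l).mul_const _]
    simp only [integral_mul_const]
    -- The mean of the residual term is an entry k ≠ r of `popJ` applied to the extended projection,
    -- which the normal equations annihilate.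
    rw [← mulVec_extend_eq_zero_of_isMinOn popJ_isSymm hR.isMinOn_γ₀ hk]
    exact Finset.sum_congr rfl fun l _ =>
      congrArg (· * extend S.r (-1) S.γ₀ l) (hS.popJ_apply hR hδ hb hN hi k l).symm

/-- Constant in the concentration bounds. -/
def concConst (φ K M K₂ : ℝ) : ℝ :=
  2 * φ * K₂ * K ^ 2 + (2 * K₂ * K ^ 2) ^ 2 + (K₂ * K * (K + M)) ^ 2 + 4

set_option maxHeartbeats 1000000 in
/-- All but a small fraction of the outcomes are good. -/
theorem measure_not_goodOutcome_le (hS : S.IsSample G μ)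
    (hR : S.Regular G μ K M L δ K₂ K₃ κ) (hE : S.IsEstimator G μ C) (hδ : 0 < δ)
    (hK₂ : 0 < K₂) (hK₃ : 0 < K₃)
    (hb : 1 ≤ S.b) (hN : 0 < S.N 1) (hp : 1 ≤ Real.log S.p)
    (hsize : ∀ j ∈ Finset.Icc 1 S.b, (2 * G.φ / δ) ^ 2 * (Real.log S.p + j) ≤ S.N j) :
    μ {ω | ¬S.GoodOutcome G (S.popJ G μ) K M L δ K₂ K₃ C (concConst G.φ K M K₂) ω} ≤
      ENNReal.ofReal (6 / S.p) := by
  have hφ := G.φ_pos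
  set ℓ := Real.log S.p with hℓ
  set C₁ := concConst G.φ K M K₂ with hC₁
  have hNj : ∀ j ∈ Finset.Icc 1 S.b, (0 : ℝ) < S.N j := fun j hj => by
    exact_mod_cast hN.trans_le (S.N_mono (Finset.mem_Icc.1 hj).1)
  have hp0 : (0 : ℝ) < S.p := by
    rcases Nat.eq_zero_or_pos S.p with h | h
    · rw [hℓ, h] at hp; norm_num at hp
    · exact_mod_cast h
  have hpexp : Real.exp ℓ = S.p := Real.exp_log hp0
  set lev : ℕ → ℝ := fun j => C₁ * √(S.N j * (ℓ + j)) with hlev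
  -- The summand 4 of `concConst` is the deviation rate q in the Chernoff bound.
  have hC₁σ : ∀ σ : ℝ, σ ∈ ({2 * G.φ * K₂ * K ^ 2, (2 * K₂ * K ^ 2) ^ 2,
      (K₂ * K * (K + M)) ^ 2} : Set ℝ) → 0 ≤ σ ∧ σ + 4 ≤ C₁ := by
    have n1 : 0 ≤ 2 * G.φ * K₂ * K ^ 2 := by positivity
    have n2 : 0 ≤ (2 * K₂ * K ^ 2) ^ 2 := by positivity
    have n3 : 0 ≤ (K₂ * K * (K + M)) ^ 2 := by positivity
    rintro σ (rfl | rfl | rfl) <;> refine ⟨by assumption, ?_⟩ <;> rw [hC₁, concConst] <;> linarith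
  have tail : ∀ j ∈ Finset.Icc 1 S.b, ∀ F : (Fin S.p → ℝ) × ℝ → ℝ, Measurable F →
      ∀ T : Finset ℕ, T ⊆ Finset.range (S.N j) → ∀ σ : ℝ, σ ∈ ({2 * G.φ * K₂ * K ^ 2,
        (2 * K₂ * K ^ 2) ^ 2, (K₂ * K * (K + M)) ^ 2} : Set ℝ) →
      (∀ i < S.N S.b, ∀ θ : ℝ, 2 * G.φ * |θ| ≤ δ →
        Integrable (fun ω => Real.exp (θ * F (S.x i ω, S.y i ω))) μ ∧
          mgf (fun ω => F (S.x i ω, S.y i ω)) μ θ ≤ Real.exp (σ * θ ^ 2)) →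
      μ {ω | lev j < |∑ i ∈ T, F (S.x i ω, S.y i ω)|} ≤
        ENNReal.ofReal (2 * Real.exp (-(4 * (ℓ + j)))) := by
    intro j hj F hF T hT σ hσ hmgf
    obtain ⟨hσ0, hσC⟩ := hC₁σ σ hσ
    have hTlt : ∀ i ∈ T, i < S.N S.b := fun i hi =>
      (Finset.mem_range.1 (hT hi)).trans_le (S.N_mono (Finset.mem_Icc.1 hj).2)
    have hcard : (T.card : ℝ) ≤ S.N j := by
      have := Finset.card_le_card hT
      rw [Finset.card_range] at this
      exact_mod_cast this
    refine (measure_mono ?_).trans (hS.measure_abs_sum_gt_le (q := 4) hF hTlt hσ0 (hNj j hj)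
      hcard (t := ℓ + j) (by positivity) fun i hi θ hθ => hmgf i (hTlt i hi) θ ?_)
    · intro ω hω
      rw [Set.mem_ofPred_eq] at hω ⊢
      refine lt_of_le_of_lt ?_ hω
      rw [hlev]
      simp only
      gcongr
    · rw [hθ]
      -- The sample size keeps the Chernoff argument in the range where the score is sub-Gaussian.
      have h1 : √((ℓ + j) / S.N j) ≤ δ / (2 * G.φ) := by
        rw [Real.sqrt_le_left (by positivity), div_le_iff₀ (hNj j hj)]
        have h2 := hsize j hj
        calc ℓ + j = (δ / (2 * G.φ)) ^ 2 * ((2 * G.φ / δ) ^ 2 * (ℓ + j)) := by field_simp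
          _ ≤ (δ / (2 * G.φ)) ^ 2 * S.N j := by gcongr
      calc 2 * G.φ * √((ℓ + j) / S.N j) ≤ 2 * G.φ * (δ / (2 * G.φ)) := by gcongr
        _ = δ := by field_simp
  have hg : Measurable G.g := G.differentiable_g.continuous.measurable
  set E₁ : ℕ → Fin S.p → Set Ω := fun j k =>
    {ω | lev j < |∑ i ∈ S.batch j, (S.y i ω - G.g (S.x i ω ⬝ᵥ S.β₀)) * S.x i ω k|} with hE₁
  set E₂ : ℕ → Fin S.p → Fin S.p → Set Ω := fun j k l =>
    {ω | lev j < |∑ i ∈ Finset.range (S.N j), (deriv G.g (S.x i ω ⬝ᵥ S.β₀) * S.x i ω k *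
      S.x i ω l - S.popJ G μ k l)|} with hE₂
  set E₃ : ℕ → {k // k ≠ S.r} → Set Ω := fun j k =>
    {ω | lev j < |∑ i ∈ Finset.range (S.N j), deriv G.g (S.x i ω ⬝ᵥ S.β₀) * S.x i ω k.1 *
      (S.x i ω ⬝ᵥ extend S.r (-1) S.γ₀)|} with hE₃
  have hE₁le : ∀ j ∈ Finset.Icc 1 S.b, ∀ k,
      μ (E₁ j k) ≤ ENNReal.ofReal (2 * Real.exp (-(4 * (ℓ + j)))) := fun j hj k =>
    tail j hj (fun z => (z.2 - G.g (z.1 ⬝ᵥ S.β₀)) * z.1 k)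
      ((measurable_snd.sub (hg.comp (measurable_dotProduct_left S.β₀))).mul
        ((measurable_pi_apply k).comp measurable_fst)) (S.batch j)
      (fun i hi => Finset.mem_range.2 (Finset.mem_Ico.1 hi).2) _ (by simp)
      fun i hi θ hθ => hS.integrable_exp_score_and_mgf_le hR hK₂.le hi k hθ
  have hE₂le : ∀ j ∈ Finset.Icc 1 S.b, ∀ k l,
      μ (E₂ j k l) ≤ ENNReal.ofReal (2 * Real.exp (-(4 * (ℓ + j)))) := fun j hj k l =>
    tail j hj (fun z => deriv G.g (z.1 ⬝ᵥ S.β₀) * z.1 k * z.1 l - S.popJ G μ k l)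
      ((measurable_info G S.β₀ k l).sub_const _) _ Finset.Subset.rfl _ (by simp)
      fun i hi θ _ => hS.integrable_exp_info_and_mgf_le hR hδ.le hb hN hi k l θ
  have hE₃le : ∀ j ∈ Finset.Icc 1 S.b, ∀ k,
      μ (E₃ j k) ≤ ENNReal.ofReal (2 * Real.exp (-(4 * (ℓ + j)))) := fun j hj k =>
    tail j hj (fun z => deriv G.g (z.1 ⬝ᵥ S.β₀) * z.1 k.1 * (z.1 ⬝ᵥ extend S.r (-1) S.γ₀))
      (((measurable_deriv_g_dotProduct G S.β₀).mul
      ((measurable_pi_apply k.1).comp measurable_fst)).mul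
      (measurable_dotProduct_left (extend S.r (-1) S.γ₀))) _ Finset.Subset.rfl _ (by simp)
      fun i hi θ _ => hS.integrable_exp_resid_and_mgf_le hR hδ.le hb hN hi k.2 θ
  set bad : Set Ω := ⋃ j ∈ Finset.Icc 1 S.b, ((⋃ k, E₁ j k) ∪ (⋃ k, ⋃ l, E₂ j k l)) ∪
    (⋃ k, E₃ j k) with hbad
  have hbadle : μ bad ≤ ENNReal.ofReal (6 / S.p) := by
    have hper : ∀ j ∈ Finset.Icc 1 S.b,
        μ (((⋃ k, E₁ j k) ∪ (⋃ k, ⋃ l, E₂ j k l)) ∪ (⋃ k, E₃ j k)) ≤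
          ENNReal.ofReal (6 / S.p * (1 / 2) ^ j) := by
      intro j hj
      set ε := 2 * Real.exp (-(4 * (ℓ + j))) with hε
      have hε0 : 0 ≤ ε := by positivity
      have hp1 : (1 : ℝ) ≤ S.p := by rw [← hpexp]; exact Real.one_le_exp (by linarith)
      have u1 : μ (⋃ k, E₁ j k) ≤ ENNReal.ofReal ((S.p : ℝ) ^ 2 * ε) := by
        refine (measure_iUnion_fintype_le _ _).trans
          ((Finset.sum_le_sum fun k _ => hE₁le j hj k).trans ?_)
        rw [Finset.sum_const, Finset.card_univ, Fintype.card_fin, ← ENNReal.ofReal_nsmul,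
          nsmul_eq_mul]
        refine ENNReal.ofReal_le_ofReal ?_
        gcongr
        exact le_self_pow₀ hp1 two_ne_zero
      have u2 : μ (⋃ k, ⋃ l, E₂ j k l) ≤ ENNReal.ofReal ((S.p : ℝ) ^ 2 * ε) := by
        refine (measure_iUnion_fintype_le _ _).trans
          ((Finset.sum_le_sum fun k _ => (measure_iUnion_fintype_le _ _).trans
            (Finset.sum_le_sum fun l _ => hE₂le j hj k l)).trans ?_)
        rw [Finset.sum_const, Finset.sum_const, Finset.card_univ, Fintype.card_fin,
          ← ENNReal.ofReal_nsmul, ← ENNReal.ofReal_nsmul, nsmul_eq_mul, nsmul_eq_mul]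
        refine ENNReal.ofReal_le_ofReal (le_of_eq ?_)
        ring
      have u3 : μ (⋃ k, E₃ j k) ≤ ENNReal.ofReal ((S.p : ℝ) ^ 2 * ε) := by
        refine (measure_iUnion_fintype_le _ _).trans
          ((Finset.sum_le_sum fun k _ => hE₃le j hj k).trans ?_)
        rw [Finset.sum_const, Finset.card_univ, ← ENNReal.ofReal_nsmul,
          nsmul_eq_mul]
        refine ENNReal.ofReal_le_ofReal ?_
        have hc : (Fintype.card {k // k ≠ S.r} : ℝ) ≤ S.p := by
          have := Fintype.card_subtype_le fun k : Fin S.p => k ≠ S.r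
          rw [Fintype.card_fin] at this
          exact_mod_cast this
        gcongr
        exact hc.trans (le_self_pow₀ hp1 two_ne_zero)
      refine (measure_union_le _ _).trans ((add_le_add ((measure_union_le _ _).trans
        (add_le_add u1 u2)) u3).trans ?_)
      rw [← ENNReal.ofReal_add (by positivity) (by positivity),
        ← ENNReal.ofReal_add (by positivity) (by positivity)]
      refine ENNReal.ofReal_le_ofReal ?_
      have hhalf : Real.exp (-(j : ℝ)) ≤ (1 / 2) ^ j := by
        rw [← neg_one_mul, mul_comm, Real.exp_nat_mul]
        gcongr
        rw [Real.exp_neg, one_div]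
        gcongr
        have := Real.add_one_le_exp (1 : ℝ)
        linarith
      -- Of the exponent 4 ℓ, half pays for at most p² events per family and another ℓ yields 1 / p.
      -- The part in j bounds the sum over batches irrespective of their number.
      have hexp : (S.p : ℝ) ^ 2 * Real.exp (-(4 * (ℓ + j))) ≤ 1 / S.p * Real.exp (-(j : ℝ)) := by
        rw [← hpexp, ← Real.exp_nat_mul, one_div, ← Real.exp_neg, ← Real.exp_add, ← Real.exp_add]
        refine Real.exp_le_exp.2 ?_
        push_cast
        linarith [Nat.cast_nonneg (α := ℝ) j]
      calc (S.p : ℝ) ^ 2 * ε + (S.p : ℝ) ^ 2 * ε + (S.p : ℝ) ^ 2 * ε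
          = 6 * ((S.p : ℝ) ^ 2 * Real.exp (-(4 * (ℓ + j)))) := by rw [hε]; ring
        _ ≤ (6 : ℝ) * (1 / (S.p : ℝ) * (1 / 2) ^ j) := by
            refine mul_le_mul_of_nonneg_left (hexp.trans ?_) (by norm_num)
            gcongr
        _ = 6 / (S.p : ℝ) * (1 / 2) ^ j := by ring
    refine (measure_biUnion_finset_le _ _).trans ((Finset.sum_le_sum hper).trans ?_)
    rw [← ENNReal.ofReal_sum_of_nonneg fun j _ => by positivity, ← Finset.mul_sum]
    refine ENNReal.ofReal_le_ofReal (mul_le_of_le_one_right (by positivity) ?_)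
    have hgeom : ∀ n : ℕ, ∑ j ∈ Finset.Icc 1 n, (1 / 2 : ℝ) ^ j = 1 - (1 / 2) ^ n := by
      intro n
      induction n with
      | zero => simp
      | succ n ih =>
        rw [Finset.sum_Icc_succ_top (by omega), ih, pow_succ]
        ring
    rw [hgeom]
    have : (0 : ℝ) ≤ (1 / 2) ^ S.b := by positivity
    linarith
  have hgood : ∀ᵐ ω ∂μ, ω ∉ bad →
      S.GoodOutcome G (S.popJ G μ) K M L δ K₂ K₃ C C₁ ω := by
    filter_upwards [hR.bounded_x, hR.bounded_projection, hR.lipschitz, hR.bounded_deriv,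
      hR.bounded_inv_deriv, hE.lasso, hE.proj] with ω h1 h2 h3 h4 h5 h6 h7 hω
    rw [hbad] at hω
    simp only [Set.mem_iUnion, Set.mem_union, not_exists, not_or] at hω
    refine ⟨h1, h2, h3, fun i hi β hβ => (le_abs_self _).trans (h4 i hi β hβ), ?_, ?_, ?_, ?_,
      h6, h7⟩
    · intro i hi β hβ
      obtain ⟨hne, hle⟩ := h5 i hi β hβ
      have hpos : 0 < deriv G.g (S.x i ω ⬝ᵥ β) := lt_of_le_of_ne (G.deriv_g_nonneg _) hne.symm
      rw [abs_of_pos (by positivity)] at hle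
      exact (one_div_le hpos hK₃).1 hle
    · intro j hj k
      exact not_lt.1 ((hω j hj).1.1 k)
    · intro j hj k l
      exact not_lt.1 ((hω j hj).1.2 k l)
    · intro j hj k hk
      exact not_lt.1 ((hω j hj).2 ⟨k, hk⟩)
  -- The exceptional outcomes lie, up to a null set, in an explicit union of deviation events, so
  -- the estimators need not be measurable.
  refine le_trans (measure_mono_ae ?_) hbadle
  filter_upwards [hgood] with ω hω hng
  by_contra hnb
  exact hng (hω hnb)

end

end Stream

/-! ### Nonasymptotic expansion and passage to the limit. -/

namespace Stream

/-- Growth rate of the error bound for the online lasso with the batch number. -/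
def growthConst (κ K₂ K₃ C : ℝ) : ℝ :=
  2 * (16 * K₂ * K₃) ^ 2 + 16 * K₂ * K₃ * (l1Const κ K₂ K₃ C / (2 * C ^ 2))

/-- Constant in the sample size conditions. -/
def sizeConst (φ K M L δ κ K₂ K₃ C : ℝ) : ℝ :=
  1 + (288 * concConst φ K M K₂ / κ) ^ 2 +
    (2 * concConst φ K M K₂ * predConst κ K₂ K₃ C / C ^ 2) ^ 2 +
    (l1Const κ K₂ K₃ C / (C * δ)) ^ 2 +
    (concConst φ K M K₂ * plugInConst K M L κ K₂ K₃ C / C ^ 2) ^ 2 + (2 * φ / δ) ^ 2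

lemma concConst_pos {φ K M K₂ : ℝ} (hφ : 0 < φ) (hK₂ : 0 ≤ K₂) : 0 < concConst φ K M K₂ := by
  unfold concConst
  positivity

lemma l1Const_nonneg {κ K₂ K₃ C : ℝ} (hκ : 0 < κ) (hK₂ : 0 ≤ K₂) (hK₃ : 0 ≤ K₃) :
    0 ≤ l1Const κ K₂ K₃ C := by
  unfold l1Const predConst errConst
  positivity

lemma remConst_nonneg {K M L κ K₂ K₃ C : ℝ} (hK : 0 ≤ K) (hM : 0 ≤ M) (hL : 0 ≤ L) (hκ : 0 < κ)
    (hK₂ : 0 ≤ K₂) (hK₃ : 0 ≤ K₃) (hC : 0 < C) : 0 ≤ remConst K M L κ K₂ K₃ C := by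
  unfold remConst projConst plugInConst l1Const predConst errConst
  positivity

variable {Ω : Type*} {S : Stream Ω} {G : GLM} {K M L δ κ K₂ K₃ C : ℝ}

lemma sampleSizeBound_of_le {Γ a A s₀ sr : ℝ} (hΓ : 0 ≤ Γ) (hA : 2 * a ^ 2 ≤ A)
    (hp : 1 ≤ Real.log S.p)
    (h : ∀ j ∈ Finset.Icc 1 S.b, Γ * A ^ j * s₀ ^ 2 * sr ^ 2 * Real.log S.p ≤ S.N j) :
    S.SampleSizeBound Γ a s₀ sr := by
  intro j hj
  refine le_trans ?_ (h j hj)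
  -- Trading log p + j for log p costs 2^j, hence the 2 in the requirement 2 a² ≤ A.
  have h1 : Real.log S.p + j ≤ 2 ^ j * Real.log S.p := by
    have h2 : (j : ℝ) + 1 ≤ 2 ^ j := by exact_mod_cast Nat.lt_two_pow_self (n := j)
    nlinarith [Nat.cast_nonneg (α := ℝ) j]
  calc Γ * (a ^ j * (s₀ * sr)) ^ 2 * (Real.log S.p + j)
      ≤ Γ * (a ^ j * (s₀ * sr)) ^ 2 * (2 ^ j * Real.log S.p) := by gcongr
    _ = Γ * (2 * a ^ 2) ^ j * s₀ ^ 2 * sr ^ 2 * Real.log S.p := by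
        rw [mul_pow 2 (a ^ 2) j, ← pow_mul, mul_comm 2 j, pow_mul]
        ring
    _ ≤ Γ * A ^ j * s₀ ^ 2 * sr ^ 2 * Real.log S.p := by gcongr

/-- The error bound for the online lasso in terms of the tuning parameter. -/
lemma l1_le_growthConst_pow_mul_lam {v : Fin S.p → ℝ} {s : ℝ} {j : ℕ} (hj : 1 ≤ j)
    (hκ : 0 < κ) (hK₂ : 1 ≤ K₂) (hK₃ : 1 ≤ K₃) (hC : 0 < C) (hp : 1 ≤ Real.log S.p) (hs : 0 ≤ s)
    (hN : 0 < S.N j)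
    (h : 2 * C * √(S.N j * Real.log S.p) * l1 v ≤
      l1Const κ K₂ K₃ C * ((16 * K₂ * K₃) ^ j * (s * Real.log S.p))) :
    l1 v ≤ growthConst κ K₂ K₃ C ^ j * s * S.lam C j := by
  set a := 16 * K₂ * K₃ with ha
  set q := l1Const κ K₂ K₃ C / (2 * C ^ 2) with hq
  have hq0 : 0 ≤ q := div_nonneg (l1Const_nonneg hκ (by linarith) (by linarith)) (by positivity)
  have ha1 : 1 ≤ a := by
    have := one_le_mul_of_one_le_of_one_le hK₂ hK₃
    rw [ha]; linarith
  have hN' : (0 : ℝ) < S.N j := by exact_mod_cast hN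
  have hℓ : 0 < Real.log S.p := by linarith
  have hlam : 0 < S.lam C j := by rw [lam]; positivity
  have hlamsq : S.lam C j * (C * √(S.N j * Real.log S.p)) = C ^ 2 * Real.log S.p := by
    have h1 : √(Real.log S.p / S.N j) * √(S.N j * Real.log S.p) = Real.log S.p := by
      rw [← Real.sqrt_mul (by positivity), ← Real.sqrt_sq hℓ.le]
      congr 1
      field_simp
      rw [Real.sqrt_sq hℓ.le]
    rw [lam]
    linear_combination C ^ 2 * h1
  -- As j ≥ 1, one factor of `growthConst` can absorb the constant q.
  have hpow : q * a ^ j ≤ growthConst κ K₂ K₃ C ^ j := by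
    obtain ⟨i, rfl⟩ := Nat.exists_eq_add_of_le' hj
    have h1 : a * q ≤ growthConst κ K₂ K₃ C := by
      rw [growthConst]; nlinarith [sq_nonneg a]
    have h2 : a ≤ growthConst κ K₂ K₃ C := by
      rw [growthConst]; nlinarith [mul_nonneg (zero_le_one.trans ha1) hq0]
    have h3 : 0 ≤ growthConst κ K₂ K₃ C := by linarith
    calc q * a ^ (i + 1) = a ^ i * (a * q) := by ring
      _ ≤ growthConst κ K₂ K₃ C ^ i * growthConst κ K₂ K₃ C := by gcongr
      _ = growthConst κ K₂ K₃ C ^ (i + 1) := by ring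
  have hD : 0 < 2 * C * √(S.N j * Real.log S.p) := by positivity
  refine le_of_mul_le_mul_left (h.trans ?_) hD
  calc l1Const κ K₂ K₃ C * (a ^ j * (s * Real.log S.p))
      = 2 * (q * a ^ j) * s * (C ^ 2 * Real.log S.p) := by rw [hq]; field_simp
    _ ≤ 2 * growthConst κ K₂ K₃ C ^ j * s * (C ^ 2 * Real.log S.p) := by gcongr
    _ = 2 * C * √(S.N j * Real.log S.p) * (growthConst κ K₂ K₃ C ^ j * s * S.lam C j) := by
        rw [← hlamsq]; ring

/-- Nonasymptotic form of the expansion of the debiased estimator. -/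
theorem measure_not_expansion_le [MeasurableSpace Ω] {μ : Measure Ω} [IsProbabilityMeasure μ] (hS : S.IsSample G μ)
    (hR : S.Regular G μ K M L δ K₂ K₃ κ) (hE : S.IsEstimator G μ C) (hδ : 0 < δ) (hκ : 0 < κ)
    (hK : 0 ≤ K) (hM : 0 ≤ M) (hL : 0 ≤ L) (hK₂ : 1 ≤ K₂) (hK₃ : 1 ≤ K₃)
    (hC : 3 * concConst G.φ K M K₂ ≤ C) (hb : 1 ≤ S.b) (hN : 0 < S.N 1)
    (hp : 1 ≤ Real.log S.p)
    (hsize : ∀ j ∈ Finset.Icc 1 S.b, sizeConst G.φ K M L δ κ K₂ K₃ C * growthConst κ K₂ K₃ C ^ j *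
      S.s₀ ^ 2 * S.sr G μ ^ 2 * Real.log S.p ≤ S.N j) :
    μ {ω | ¬((∀ j ∈ Finset.Icc 1 S.b,
        l1 (S.βhat j ω - S.β₀) ≤ growthConst κ K₂ K₃ C ^ j * S.s₀ * S.lam C j) ∧
      0 < S.τhat G S.b ω ∧
      |S.τhat G S.b ω * (S.βon G ω - S.β₀ S.r) - ∑ j ∈ Finset.Icc 1 S.b, ∑ i ∈ S.batch j,
        S.zhat j i ω * (S.y i ω - G.g (S.x i ω ⬝ᵥ S.β₀))| ≤
      remConst K M L κ K₂ K₃ C * (S.b * ((16 * K₂ * K₃) ^ S.b) ^ 2 *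
        (((S.s₀ : ℝ) + S.sr G μ) * S.s₀ * Real.log S.p)))} ≤ ENNReal.ofReal (6 / S.p) := by
  set Γ := sizeConst G.φ K M L δ κ K₂ K₃ C with hΓ
  set C₁ := concConst G.φ K M K₂ with hC₁
  have hC₁0 : 0 < C₁ := concConst_pos G.φ_pos (by linarith)
  have hC0 : 0 < C := by linarith
  have q1 := sq_nonneg (288 * C₁ / κ)
  have q2 := sq_nonneg (2 * C₁ * predConst κ K₂ K₃ C / C ^ 2)
  have q3 := sq_nonneg (l1Const κ K₂ K₃ C / (C * δ))
  have q4 := sq_nonneg (C₁ * plugInConst K M L κ K₂ K₃ C / C ^ 2)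
  have q5 := sq_nonneg (2 * G.φ / δ)
  have hΓ' := hΓ
  rw [sizeConst, ← hC₁] at hΓ'
  set a := 16 * K₂ * K₃ with ha
  have ha1 : 1 ≤ a := by
    have := one_le_mul_of_one_le_of_one_le hK₂ hK₃
    rw [ha]; linarith
  have ha0 : 0 ≤ a := by linarith
  have hs₀ : (1 : ℝ) ≤ S.s₀ := by exact_mod_cast le_max_left _ _
  have hsr : (1 : ℝ) ≤ S.sr G μ := by exact_mod_cast le_max_left _ _
  have hss : (1 : ℝ) ≤ S.s₀ * S.sr G μ := one_le_mul_of_one_le_of_one_le hs₀ hsr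
  have hN' : S.SampleSizeBound Γ a S.s₀ (S.sr G μ) := by
    refine sampleSizeBound_of_le (by linarith) ?_ hp hsize
    have := l1Const_nonneg (C := C) hκ (zero_le_one.trans hK₂) (zero_le_one.trans hK₃)
    rw [growthConst]
    exact le_add_of_nonneg_right (by positivity)
  have hlow := mul_sum_sq_le_of_eigenvalue (popJ_isSymm (S := S) (G := G) (μ := μ)) hR.eigenvalue
  have hcard : (Nat.card {k // S.β₀ k ≠ 0} : ℝ) ≤ S.s₀ := by exact_mod_cast le_max_right _ _
  have hcardr : (Nat.card {k // S.γ₀ k ≠ 0} : ℝ) ≤ S.sr G μ := by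
    exact_mod_cast (card_support_le_of_isMinOn popJ_isSymm hκ hlow hR.isMinOn_γ₀).trans
      (le_max_right _ _)
  have hNj : ∀ j ∈ Finset.Icc 1 S.b, 0 < S.N j := fun j hj =>
    hN.trans_le (S.N_mono (Finset.mem_Icc.1 hj).1)
  have hbmem : S.b ∈ Finset.Icc 1 S.b := Finset.mem_Icc.2 ⟨hb, le_rfl⟩
  refine (measure_mono ?_).trans (measure_not_goodOutcome_le hS hR hE hδ (by linarith)
    (by linarith) hb hN hp fun j hj => ?_)
  · intro ω hω hgood
    refine hω ?_
    have hβ := hgood.lasso_error_bounds hδ hκ hlow hK₂ hK₃ hC₁0.le hC0 hC hp hs₀ hsr hcard hN hN'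
      (by linarith) (by linarith) (by linarith)
    have hτ : 0 < S.τhat G S.b ω := by
      refine hgood.τhat_pos hδ.le hκ hlow (by linarith) (by linarith) hC0 (by linarith) hbmem
        (hNj _ hbmem) (fun j hj => (hβ j hj).1) ?_
      have h1 := hN'.mul_sqrt_le hbmem ha0 zero_le_one hss (B := 288 * C₁ / κ) (by positivity)
        (by linarith)
      have hN0 : (0 : ℝ) < S.N S.b := by exact_mod_cast hNj _ hbmem
      set R := √(S.N S.b * (Real.log S.p + S.b))
      have hR0 : 0 ≤ R := Real.sqrt_nonneg _
      have h2 : 288 * C₁ / κ * R ≤ S.N S.b := by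
        refine le_trans ?_ h1
        have := one_le_pow₀ ha1 (n := S.b)
        rw [mul_one]
        gcongr
        exact le_mul_of_one_le_right (by positivity) this
      rw [div_mul_eq_mul_div, div_le_iff₀ hκ] at h2
      have h3 : 0 ≤ C₁ * R := by positivity
      have h4 : 0 < S.N S.b * κ := by positivity
      linarith
    refine ⟨fun j hj => ?_, hτ, ?_⟩
    · exact l1_le_growthConst_pow_mul_lam (Finset.mem_Icc.1 hj).1 hκ hK₂ hK₃ hC0 hp (by linarith)
        (hNj j hj) (hβ j hj).2.2
    · exact hgood.abs_expansion_remainder_le hK hM hL hκ hK₂ hK₃ hC0 hp hs₀ hsr hN hb hN'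
        (by linarith) hτ.ne' hβ fun j hj => hgood.proj_error_bounds hδ hκ hlow hL hK₂ hK₃ hC₁0.le
          hC0 hC hp hs₀ hsr hcardr hN hN' (by linarith) (by linarith)
          (fun j hj => ⟨(hβ j hj).1, (hβ j hj).2.1⟩) hj
  · refine le_trans ?_ (hN'.mul_le hj ha0 zero_le_one hss (B := 2 * G.φ / δ) (by linarith))
    have hφ := G.φ_pos
    have h1 := one_le_pow₀ ha1 (n := j)
    gcongr
    rw [mul_one]
    exact le_mul_of_one_le_right (by positivity) h1

end Stream

/-- The remainder of the expansion is asymptotically negligible. -/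
lemma tendsto_remainder_zero {b N : ℕ → ℕ} {s₀ sr ℓ : ℕ → ℝ} {a ε : ℝ} (ha : 1 ≤ a) (hε : 0 < ε)
    (hs₀ : ∀ m, 0 ≤ s₀ m) (hsr : ∀ m, 0 ≤ sr m) (hℓ : ∀ m, 0 ≤ ℓ m) (hN : Tendsto N atTop atTop)
    (hb : (fun m => (b m : ℝ)) =o[atTop] fun m => Real.log (N m))
    (h₁ : Tendsto (fun m => s₀ m ^ 2 * ℓ m * Real.log (N m) * (N m : ℝ) ^ (-(1 / 2) + ε : ℝ))
      atTop (𝓝 0))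
    (h₂ : Tendsto (fun m => s₀ m * sr m * ℓ m * (N m : ℝ) ^ (-(1 / 2) + ε : ℝ)) atTop (𝓝 0)) :
    Tendsto (fun m => b m * (a ^ b m) ^ 2 * ((s₀ m + sr m) * s₀ m * ℓ m) / √(N m)) atTop (𝓝 0) := by
  have hlog : 0 < Real.log (2 * a ^ 2) := Real.log_pos (by nlinarith)
  have hNr : Tendsto (fun m => (N m : ℝ)) atTop atTop := tendsto_natCast_atTop_atTop.comp hN
  have hsum := h₁.add h₂
  rw [add_zero] at hsum
  refine squeeze_zero' (Eventually.of_forall fun m => ?_) ?_ hsum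
  · have := hs₀ m; have := hsr m; have := hℓ m
    positivity
  filter_upwards [hb.bound (div_pos hε hlog), hNr.eventually_ge_atTop 1,
    (Real.tendsto_log_atTop.comp hNr).eventually_ge_atTop 1] with m hbm hN1 hlogN
  have hs := hs₀ m
  have hr := hsr m
  have hl := hℓ m
  have hN0 : (0 : ℝ) < N m := by linarith
  simp only [Function.comp_apply] at hlogN
  rw [Real.norm_of_nonneg (Nat.cast_nonneg _), Real.norm_of_nonneg (by linarith),
    div_mul_eq_mul_div, le_div_iff₀ hlog] at hbm
  -- The little-o bound was taken with constant ε / log (2 a²), so (2 a²)^b stays below N^ε.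
  have hpow : b m * (a ^ b m) ^ 2 ≤ (N m : ℝ) ^ ε := by
    have h2 : (b m : ℝ) ≤ 2 ^ b m := by exact_mod_cast (Nat.lt_two_pow_self (n := b m)).le
    calc b m * (a ^ b m) ^ 2 ≤ 2 ^ b m * (a ^ b m) ^ 2 := by gcongr
      _ = (2 * a ^ 2) ^ b m := by rw [mul_pow, ← pow_mul, ← pow_mul, mul_comm (b m) 2]
      _ = Real.exp (b m * Real.log (2 * a ^ 2)) := by
          rw [Real.exp_nat_mul, Real.exp_log (by positivity)]
      _ ≤ Real.exp (Real.log (N m) * ε) := Real.exp_le_exp.2 (by linarith)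
      _ = (N m : ℝ) ^ ε := (Real.rpow_def_of_pos hN0 ε).symm
  have hrw : (N m : ℝ) ^ (-(1 / 2) + ε : ℝ) = (N m : ℝ) ^ ε / √(N m) := by
    rw [Real.rpow_add hN0, Real.rpow_neg hN0.le, ← Real.sqrt_eq_rpow]
    ring
  rw [hrw]
  calc b m * (a ^ b m) ^ 2 * ((s₀ m + sr m) * s₀ m * ℓ m) / √(N m)
      ≤ (N m : ℝ) ^ ε * ((s₀ m + sr m) * s₀ m * ℓ m) / √(N m) := by gcongr
    _ = s₀ m ^ 2 * ℓ m * 1 * ((N m : ℝ) ^ ε / √(N m)) +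
        s₀ m * sr m * ℓ m * ((N m : ℝ) ^ ε / √(N m)) := by ring
    _ ≤ _ := by gcongr

end OnlineGLM

end

theorem theorem3 (G : OnlineGLM.GLM) (K M L δ K₂ K₃ κ : ℝ) (hδ : 0 < δ) (hκ : 0 < κ) :
    ∃ C₀ : ℝ, 0 < C₀ ∧ ∀ C : ℝ, C₀ ≤ C → ∃ A : ℝ, 1 ≤ A ∧ ∃ c : ℝ, 0 < c ∧
      ∀ (Ω : ℕ → Type*) [∀ m, MeasurableSpace (Ω m)] (μ : ∀ m, Measure (Ω m))
        [∀ m, IsProbabilityMeasure (μ m)] (S : ∀ m, OnlineGLM.Stream (Ω m)),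
        (∀ m, (S m).IsSample G (μ m)) →
        (∀ m, (S m).Regular G (μ m) K M L δ K₂ K₃ κ) →
        (∀ m, (S m).IsEstimator G (μ m) C) →
        -- asymptotic regime
        Tendsto (fun m => (S m).N (S m).b) atTop atTop →
        Tendsto (fun m => (S m).p) atTop atTop →
        (fun m => ((S m).b : ℝ)) =o[atTop] (fun m => Real.log ((S m).N (S m).b)) →
        -- sample size conditions, with `c₁^{(j)} = A ^ j`
        (∀ m, c * (S m).s₀ * Real.log (S m).p ≤ (S m).n 1) →
        (∀ m, ∀ j ∈ Finset.Icc 1 (S m).b,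
          c * A ^ j * (S m).s₀ ^ 2 * (S m).sr G (μ m) ^ 2 * Real.log (S m).p ≤ (S m).N j) →
        (∃ ε : ℝ, 0 < ε ∧
          Tendsto (fun m => ((S m).s₀ : ℝ) ^ 2 * Real.log (S m).p *
            Real.log ((S m).N (S m).b) * ((S m).N (S m).b : ℝ) ^ (-(1 / 2) + ε : ℝ))
            atTop (𝓝 0) ∧
          Tendsto (fun m => ((S m).s₀ : ℝ) * (S m).sr G (μ m) * Real.log (S m).p *
            ((S m).N (S m).b : ℝ) ^ (-(1 / 2) + ε : ℝ)) atTop (𝓝 0)) →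
        -- `A ^ j` is a valid constant in the `ℓ₁` error bound of the online lasso
        Tendsto (fun m => μ m {ω | ∃ j ∈ Finset.Icc 1 (S m).b,
          A ^ j * (S m).s₀ * (S m).lam C j < OnlineGLM.l1 ((S m).βhat j ω - (S m).β₀)})
          atTop (𝓝 0) ∧
        -- the debiased estimator is well defined
        Tendsto (fun m => μ m {ω | (S m).τhat G (S m).b ω ≤ 0}) atTop (𝓝 0) ∧
        -- the expansion
        ∃ V : ∀ m, Ω m → ℝ,
          (∀ m ω, (S m).τhat G (S m).b ω / √((S m).N (S m).b : ℝ) *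
            ((S m).βon G ω - (S m).β₀ (S m).r) = (S m).W G ω + V m ω) ∧
          ∀ η : ℝ, 0 < η → Tendsto (fun m => μ m {ω | η ≤ |V m ω|}) atTop (𝓝 0) := by
  -- The given constants may be small or negative; the nonasymptotic bounds are applied to their
  -- maxima with 1.
  have hK' := le_max_right K 1
  have hM' := le_max_right M 1
  have hL' := le_max_right L 1
  have hK₂' := le_max_right K₂ 1
  have hK₃' := le_max_right K₃ 1
  set C₁ := OnlineGLM.Stream.concConst G.φ (max K 1) (max M 1) (max K₂ 1) with hC₁
  have hC₁0 : 0 < C₁ := OnlineGLM.Stream.concConst_pos G.φ_pos (by linarith)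
  refine ⟨3 * C₁, by positivity, fun C hC => ?_⟩
  have hC0 : 0 < C := by linarith
  set a := 16 * max K₂ 1 * max K₃ 1 with ha
  have ha1 : 1 ≤ a := by
    have := one_le_mul_of_one_le_of_one_le hK₂' hK₃'
    rw [ha]; linarith
  refine ⟨OnlineGLM.Stream.growthConst κ (max K₂ 1) (max K₃ 1) C, ?_,
    OnlineGLM.Stream.sizeConst G.φ (max K 1) (max M 1) (max L 1) δ κ (max K₂ 1) (max K₃ 1) C, ?_, ?_⟩
  · have h1 := OnlineGLM.Stream.l1Const_nonneg (C := C) hκ (zero_le_one.trans hK₂')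
      (zero_le_one.trans hK₃')
    have h2 : 0 ≤ a * (OnlineGLM.Stream.l1Const κ (max K₂ 1) (max K₃ 1) C / (2 * C ^ 2)) := by positivity
    rw [OnlineGLM.Stream.growthConst]
    nlinarith
  · rw [OnlineGLM.Stream.sizeConst]
    positivity
  intro Ω _ μ _ S hS hR hE hNlim hplim hb hn₁ hsize ⟨ε, hε, h₁, h₂⟩
  set R := OnlineGLM.Stream.remConst (max K 1) (max M 1) (max L 1) κ (max K₂ 1) (max K₃ 1) C with hRdef
  have hR0 : 0 ≤ R := OnlineGLM.Stream.remConst_nonneg (by linarith) (by linarith) (by linarith) hκ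
    (by linarith) (by linarith) hC0
  have hplim' : Tendsto (fun m => ((S m).p : ℝ)) atTop atTop :=
    tendsto_natCast_atTop_atTop.comp hplim
  have hev := ((Real.tendsto_log_atTop.comp hplim').eventually_ge_atTop 1).and
    (hNlim.eventually_gt_atTop 0)
  have hbad : ∀ᶠ m in atTop, μ m {ω | ¬((∀ j ∈ Finset.Icc 1 (S m).b,
        OnlineGLM.l1 ((S m).βhat j ω - (S m).β₀) ≤
          OnlineGLM.Stream.growthConst κ (max K₂ 1) (max K₃ 1) C ^ j * (S m).s₀ * (S m).lam C j) ∧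
      0 < (S m).τhat G (S m).b ω ∧
      |(S m).τhat G (S m).b ω * ((S m).βon G ω - (S m).β₀ (S m).r) -
        ∑ j ∈ Finset.Icc 1 (S m).b, ∑ i ∈ (S m).batch j,
          (S m).zhat j i ω * ((S m).y i ω - G.g ((S m).x i ω ⬝ᵥ (S m).β₀))| ≤
      R * ((S m).b * (a ^ (S m).b) ^ 2 * ((((S m).s₀ : ℝ) + (S m).sr G (μ m)) * (S m).s₀ *
        Real.log (S m).p)))} ≤ ENNReal.ofReal (6 / (S m).p) := by
    filter_upwards [hev] with m ⟨hp, hNb⟩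
    have hb1 : 1 ≤ (S m).b := by
      by_contra h
      rw [Nat.lt_one_iff.1 (not_le.1 h)] at hNb
      simp [OnlineGLM.Stream.N] at hNb
    -- The first batch must be nonempty, because `popJ` divides by its size.
    have hN1 : 0 < (S m).N 1 := by
      have h1 : (0 : ℝ) < (S m).n 1 := by
        refine lt_of_lt_of_le ?_ (hn₁ m)
        have hs₀ : (0 : ℝ) < (S m).s₀ := by exact_mod_cast lt_of_lt_of_le one_pos (le_max_left _ _)
        have : (0 : ℝ) < Real.log (S m).p := one_pos.trans_le hp
        have : 0 < OnlineGLM.Stream.sizeConst G.φ (max K 1) (max M 1) (max L 1) δ κ (max K₂ 1) (max K₃ 1)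
            C := by
          rw [OnlineGLM.Stream.sizeConst]; positivity
        positivity
      simpa [OnlineGLM.Stream.N] using h1
    exact OnlineGLM.Stream.measure_not_expansion_le (hS m)
      ((hR m).mono (le_max_left _ _) (le_max_left _ _) (le_max_left _ _) (le_max_left _ _)
        (le_max_left _ _)) (hE m) hδ hκ (by linarith) (by linarith) (by linarith) hK₂' hK₃' hC hb1
      hN1 hp (hsize m)
  have hzero : Tendsto (fun m => ENNReal.ofReal (6 / (S m).p)) atTop (𝓝 0) := by
    rw [← ENNReal.ofReal_zero]
    exact ENNReal.tendsto_ofReal (hplim'.const_div_atTop 6)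
  have hrem := (OnlineGLM.tendsto_remainder_zero (s₀ := fun m => ((S m).s₀ : ℝ))
    (sr := fun m => ((S m).sr G (μ m) : ℝ)) (ℓ := fun m => Real.log (S m).p) ha1 hε
    (fun m => Nat.cast_nonneg _) (fun m => Nat.cast_nonneg _)
    (fun m => Real.log_natCast_nonneg _) hNlim hb h₁ h₂).const_mul R
  rw [mul_zero] at hrem
  -- V is taken to be the difference of the two sides, so only its convergence to zero has content.
  refine ⟨?_, ?_, fun m ω => (S m).τhat G (S m).b ω / √((S m).N (S m).b : ℝ) *
    ((S m).βon G ω - (S m).β₀ (S m).r) - (S m).W G ω, fun m ω => by ring, fun η hη => ?_⟩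
  · refine tendsto_of_tendsto_of_tendsto_of_le_of_le' tendsto_const_nhds hzero
      (Eventually.of_forall fun _ => zero_le) ?_
    filter_upwards [hbad] with m hm
    refine (measure_mono ?_).trans hm
    rintro ω ⟨j, hj, hlt⟩ hgood
    exact absurd (hgood.1 j hj) (not_le.2 hlt)
  · refine tendsto_of_tendsto_of_tendsto_of_le_of_le' tendsto_const_nhds hzero
      (Eventually.of_forall fun _ => zero_le) ?_
    filter_upwards [hbad] with m hm
    refine (measure_mono ?_).trans hm
    intro ω hω hgood
    exact absurd hgood.2.1 (not_lt.2 hω)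
  · refine tendsto_of_tendsto_of_tendsto_of_le_of_le' tendsto_const_nhds hzero
      (Eventually.of_forall fun _ => zero_le) ?_
    filter_upwards [hbad, hrem.eventually_lt_const hη, hev] with m hm hlt ⟨_, hNb⟩
    refine (measure_mono ?_).trans hm
    intro ω hω hgood
    rw [Set.mem_ofPred_eq] at hω
    refine absurd hω (not_le.2 (lt_of_le_of_lt ?_ hlt))
    have hsq : 0 < √((S m).N (S m).b : ℝ) := Real.sqrt_pos.2 (by exact_mod_cast hNb)
    rw [OnlineGLM.Stream.W, one_div_mul_eq_div, div_mul_eq_mul_div, ← sub_div, abs_div,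
      abs_of_pos hsq, ← mul_div_assoc]
    exact div_le_div_of_nonneg_right hgood.2.2 hsq.le
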